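/- Let $m,g,q\ge 0$ be integers, $A\in\mathbb C^{m\times m}$, $B\in\mathbb C^{m\times g}$, $C\in\mathbb C^{q\times m}$, $0<\sigma<\infty$, $\sigma'>0$ and $p_e\in[0,1]$. For $n=0,1,2,\dots$ consider $$x[n+1]=Ax[n]+Bw[n],\qquad y[n]=\beta[n]\,(Cx[n]+v[n]),$$ where the random variables $x[0]$, $w[n]$, $v[n]$, $\beta[n]$ $(n\ge 0)$ are mutually independent; $\beta[n]\in\{0,1\}$ with $\mathbb P(\beta[n]=0)=p_e$; the vectors $x[0],w[n],v[n]$ are zero-mean Gaussian, either all of them circularly symmetric complex Gaussian ($\mathbb E[XX^{T}]=0$), or all of them real-valued and $A,B,C$ real; and, with $\preceq$ the Loewner order, $$\mathbb E[x[0]x[0]^\dagger]\preceq\sigma^2I,\qquad \sigma'^2I\preceq\mathbb E[w[n]w[n]^\dagger]\preceq\sigma^2I,\qquad \sigma'^2I\preceq\mathbb E[v[n]v[n]^\dagger]\preceq\sigma^2I\qquad(n\ge0).$$ The system is called intermittent observable if there are estimators $\widehat x[n]$, each a measurable function of $y[0],\dots,y[n]$, with $\sup_{n\ge0}\mathbb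 E[(x[n]-\widehat x[n])^\dagger(x[n]-\widehat x[n])]<\infty$. Assume that $(A,B)$ is controllable, i.e. $[B,AB,\dots,A^{m-1}B]$ has rank $m$. A finite multiset $\{a_1,\dots,a_\nu\}$ of complex numbers is a cycle if there is an integer $n\ge1$ with $(a_j/a_k)^n=1$ for all $j,k$ (where $0/0=1$ and $a/0=\infty$ for $a\neq0$); the least such $n$ is its period. Let $A=UA'U^{-1}$ with $A'=\mathrm{diag}\{A_{1,1},\dots,A_{1,\nu_1},\dots,A_{\mu,1},\dots,A_{\mu,\nu_\mu}\}$ be a Jordan form of $A$ whose upper-triangular Jordan blocks $A_{i,j}$, with eigenvalues $\lambda_{i,j}$, are grouped so that each $\{\lambda_{i,1},\dots,\lambda_{i,\nu_i}\}$ is a cycle (of length $\nu_i\ge1$ and period $p_i$) and $\{\lambda_{i,j},\lambda_{i',j'}\}$ is not a cycle for $i\ne i'$. Write $CU=[C_{1,1},\dots,C_{\mu,\nu_\mu}]$ in the corresponding column blocks, let $A_i=\mathrm{diag}\{\lambda_{i,1},\dots,\lambda_{i,\nu_i}\}$, and let $C_i$ be the $q\times\nu_i$ matrix whose $j$-th column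 is the first column of $C_{i,j}$. Let $l_i$ be the minimum cardinality of a set $S'\subseteq\{0,\dots,p_i-1\}$ such that the matrix obtained by stacking the blocks $C_iA_i^{s}$, $s\in\{0,\dots,p_i-1\}\setminus S'$, has rank less than $\nu_i$. **Theorem.** The system is intermittent observable if and only if $$p_e<\frac{1}{\max_{1\le i\le\mu}|\lambda_{i,1}|^{2p_i/l_i}},$$ or, equivalently, if and only if $p_e^{\,l_i/p_i}\,|\lambda_{i,1}|^2<1$ for all $1\le i\le\mu$. Here, for $l_i=0$, $|\lambda_{i,1}|^{2p_i/0}$ means $0$ if $|\lambda_{i,1}|<1$ and $\infty$ if $|\lambda_{i,1}|\ge1$; moreover $1/0=\infty$, $1/\infty=0$, $0^0=1$, and the maximum over the empty set is $0$. -/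

import Mathlib

open MeasureTheory ProbabilityTheory
open scoped ENNReal ComplexOrder

namespace IntermittentKalman

noncomputable section

/-! ### The random system -/

/-- The state process `x[0] = x₀`, `x[n+1] = A x[n] + B w[n]`. -/
def state {Ω : Type*} {m g : ℕ} (A : Matrix (Fin m) (Fin m) ℂ) (B : Matrix (Fin m) (Fin g) ℂ)
    (x₀ : Ω → Fin m → ℂ) (w : ℕ → Ω → Fin g → ℂ) : ℕ → Ω → Fin m → ℂ
  | 0 => x₀
  | n + 1 => fun ω => A.mulVec (state A B x₀ w n ω) + B.mulVec (w n ω)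

/-- The observation process `y[n] = β[n] (C x[n] + v[n])`; `β n ω = true` means that the `n`-th
packet is received (`β[n] = 1`), `β n ω = false` that it is erased (`β[n] = 0`). -/
def observation {Ω : Type*} {m q : ℕ} (C : Matrix (Fin q) (Fin m) ℂ)
    (x : ℕ → Ω → Fin m → ℂ) (v : ℕ → Ω → Fin q → ℂ) (β : ℕ → Ω → Bool) :
    ℕ → Ω → Fin q → ℂ :=
  fun n ω => if β n ω then C.mulVec (x n ω) + v n ω else 0

/-- The matrix of second moments `E[X X†]`. -/
def secondMoment {Ω : Type*} [MeasurableSpace Ω] (P : Measure Ω) {k : ℕ} (X : Ω → Fin k → ℂ) :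
    Matrix (Fin k) (Fin k) ℂ :=
  Matrix.of fun i j => ∫ ω, X ω i * star (X ω j) ∂P

/-- `X` is a zero-mean random vector of `ℂ^k` whose real and imaginary parts are jointly Gaussian
(a degenerate law is allowed). -/
structure IsCenteredGaussian {Ω : Type*} [MeasurableSpace Ω] (P : Measure Ω) {k : ℕ}
    (X : Ω → Fin k → ℂ) : Prop where
  measurable : Measurable X
  gaussian : HasGaussianLaw X P
  mean_zero : ∀ i, ∫ ω, X ω i ∂P = 0

/-- Vanishing pseudo-covariance `E[X Xᵀ] = 0`: for a centered Gaussian vector this is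
circular symmetry. -/
def IsProper {Ω : Type*} [MeasurableSpace Ω] (P : Measure Ω) {k : ℕ} (X : Ω → Fin k → ℂ) : Prop :=
  ∀ i j, ∫ ω, X ω i * X ω j ∂P = 0

/-- `X` takes values in `ℝ^k` almost surely. -/
def IsRealValued {Ω : Type*} [MeasurableSpace Ω] (P : Measure Ω) {k : ℕ} (X : Ω → Fin k → ℂ) :
    Prop :=
  ∀ᵐ ω ∂P, ∀ i, (X ω i).im = 0

/-- All entries of `M` are real. -/
def IsRealMatrix {r s : ℕ} (M : Matrix (Fin r) (Fin s) ℂ) : Prop :=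
  ∀ i j, (M i j).im = 0

/-- Labels for the primitive random variables: the initial state, the disturbances `w[n]`,
the observation noises `v[n]` and the channel variables `β[n]`. -/
inductive Source where
  | init : Source
  | disturbance : ℕ → Source
  | noise : ℕ → Source
  | channel : ℕ → Source

/-- The σ-algebra generated by one primitive random variable. -/
@[reducible] def sourceSigma {Ω : Type*} {m g q : ℕ} (x₀ : Ω → Fin m → ℂ) (w : ℕ → Ω → Fin g → ℂ)
    (v : ℕ → Ω → Fin q → ℂ) (β : ℕ → Ω → Bool) : Source → MeasurableSpace Ω
  | .init => MeasurableSpace.comap x₀ inferInstance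
  | .disturbance n => MeasurableSpace.comap (w n) inferInstance
  | .noise n => MeasurableSpace.comap (v n) inferInstance
  | .channel n => MeasurableSpace.comap (β n) inferInstance

/-- An intermittent system `(A, B, C, σ, σ')` with erasure probability `pe`, given by its primitive
random variables on the probability space `(Ω, P)`. -/
structure IsIntermittentSystem {Ω : Type*} [MeasurableSpace Ω] (P : Measure Ω) {m g q : ℕ}
    (A : Matrix (Fin m) (Fin m) ℂ) (B : Matrix (Fin m) (Fin g) ℂ) (C : Matrix (Fin q) (Fin m) ℂ)
    (σ σ' pe : ℝ) (x₀ : Ω → Fin m → ℂ) (w : ℕ → Ω → Fin g → ℂ) (v : ℕ → Ω → Fin q → ℂ)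
    (β : ℕ → Ω → Bool) : Prop where
  pe_nonneg : 0 ≤ pe
  pe_le_one : pe ≤ 1
  gaussian_init : IsCenteredGaussian P x₀
  gaussian_disturbance : ∀ n, IsCenteredGaussian P (w n)
  gaussian_noise : ∀ n, IsCenteredGaussian P (v n)
  /-- Either the Gaussian vectors are circularly symmetric complex ones,
  or the whole system is real. -/
  proper_or_real :
    (IsProper P x₀ ∧ (∀ n, IsProper P (w n)) ∧ (∀ n, IsProper P (v n))) ∨
    (IsRealMatrix A ∧ IsRealMatrix B ∧ IsRealMatrix C ∧
      IsRealValued P x₀ ∧ (∀ n, IsRealValued P (w n)) ∧ (∀ n, IsRealValued P (v n)))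
  /-- `β` is a Bernoulli process: together with `indep`, the `β[n]` are i.i.d. -/
  measurable_channel : ∀ n, Measurable (β n)
  erasure : ∀ n, P {ω | β n ω = false} = ENNReal.ofReal pe
  indep : iIndep (sourceSigma x₀ w v β) P
  /-- Upper bounds `E[X X†] ≼ σ² I`. -/
  upper_init : ((σ ^ 2 : ℂ) • (1 : Matrix (Fin m) (Fin m) ℂ) - secondMoment P x₀).PosSemidef
  upper_disturbance :
    ∀ n, ((σ ^ 2 : ℂ) • (1 : Matrix (Fin g) (Fin g) ℂ) - secondMoment P (w n)).PosSemidef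
  upper_noise :
    ∀ n, ((σ ^ 2 : ℂ) • (1 : Matrix (Fin q) (Fin q) ℂ) - secondMoment P (v n)).PosSemidef
  /-- Lower bounds `E[X X†] ≽ σ'² I`. -/
  lower_disturbance :
    ∀ n, (secondMoment P (w n) - (σ' ^ 2 : ℂ) • (1 : Matrix (Fin g) (Fin g) ℂ)).PosSemidef
  lower_noise :
    ∀ n, (secondMoment P (v n) - (σ' ^ 2 : ℂ) • (1 : Matrix (Fin q) (Fin q) ℂ)).PosSemidef

/-- Intermittent observability: some causal estimator `x̂[n] = f_n(y[0], …, y[n])` has a mean square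
error `E[(x[n] - x̂[n])† (x[n] - x̂[n])]` that is bounded uniformly in `n`. -/
def IsIntermittentObservable {Ω : Type*} [MeasurableSpace Ω] (P : Measure Ω) {m g q : ℕ}
    (A : Matrix (Fin m) (Fin m) ℂ) (B : Matrix (Fin m) (Fin g) ℂ) (C : Matrix (Fin q) (Fin m) ℂ)
    (x₀ : Ω → Fin m → ℂ) (w : ℕ → Ω → Fin g → ℂ) (v : ℕ → Ω → Fin q → ℂ)
    (β : ℕ → Ω → Bool) : Prop :=
  ∃ f : (n : ℕ) → (Fin (n + 1) → Fin q → ℂ) → Fin m → ℂ,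
    (∀ n, Measurable (f n)) ∧
      (⨆ n, ∫⁻ ω, ∑ i, ‖state A B x₀ w n ω i -
        f n (fun k => observation C (state A B x₀ w) v β k ω) i‖ₑ ^ 2 ∂P) < ∞

/-- `(A, B)` is controllable: `[B, AB, …, A^(m-1) B]` has full rank. -/
def Controllable {m g : ℕ} (A : Matrix (Fin m) (Fin m) ℂ) (B : Matrix (Fin m) (Fin g) ℂ) : Prop :=
  (Matrix.of fun (i : Fin m) (k : Fin m × Fin g) => (A ^ (k.1 : ℕ) * B) i k.2).rank = m

/-! ### Eigenvalue cycles -/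

/-- `(a j / a k)^n = 1` for all `j, k`, with `n ≥ 1` and the conventions `0/0 = 1`, `1/0 = ∞`;
these conventions are what the division-free form `a j ^ n = a k ^ n` says. -/
def IsCyclePeriod {ι : Type*} (a : ι → ℂ) (n : ℕ) : Prop :=
  0 < n ∧ ∀ j k, a j ^ n = a k ^ n

/-- The multiset `{a j}` is a cycle. -/
def IsCycle {ι : Type*} (a : ι → ℂ) : Prop :=
  ∃ n, IsCyclePeriod a n

/-- The period of a cycle: the least `n ≥ 1` with `(a j / a k)^n = 1` for all `j, k`. -/
def cyclePeriod {ι : Type*} (a : ι → ℂ) : ℕ :=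
  sInf {n | IsCyclePeriod a n}

/-- The upper-triangular Jordan block of size `d` with eigenvalue `lam`. -/
def jordanBlock (d : ℕ) (lam : ℂ) : Matrix (Fin d) (Fin d) ℂ :=
  Matrix.of fun a b => if a = b then lam else if (a : ℕ) + 1 = b then 1 else 0

/-- A Jordan form `A = U A' U⁻¹` of `A` whose Jordan blocks `A_{i,j}` (`i < μ`, `j < ν i`) are
grouped by maximal eigenvalue cycles. -/
structure JordanCycleForm {m : ℕ} (A : Matrix (Fin m) (Fin m) ℂ) where
  /-- the number of eigenvalue cycles -/
  μ : ℕ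
  /-- the lengths of the cycles -/
  ν : Fin μ → ℕ
  ν_pos : ∀ i, 0 < ν i
  /-- the size of the block `A_{i,j}` -/
  size : (i : Fin μ) → Fin (ν i) → ℕ
  size_pos : ∀ i j, 0 < size i j
  /-- the eigenvalue `λ_{i,j}` of the block `A_{i,j}` -/
  eig : (i : Fin μ) → Fin (ν i) → ℂ
  /-- `{λ_{i,1}, …, λ_{i,ν i}}` is a cycle -/
  cycle : ∀ i, IsCycle (eig i)
  /-- `{λ_{i,j}, λ_{i',j'}}` is not a cycle for `i ≠ i'` -/
  not_cycle : ∀ i i', i ≠ i' → ∀ j j', ¬ IsCycle ![eig i j, eig i' j']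
  /-- the change of coordinates -/
  U : Matrix (Fin m) ((k : (i : Fin μ) × Fin (ν i)) × Fin (size k.1 k.2)) ℂ
  /-- its inverse -/
  Uinv : Matrix ((k : (i : Fin μ) × Fin (ν i)) × Fin (size k.1 k.2)) (Fin m) ℂ
  U_mul_Uinv : U * Uinv = 1
  Uinv_mul_U : Uinv * U = 1
  eq_conj : A = U * Matrix.blockDiagonal'
    (fun k : (i : Fin μ) × Fin (ν i) => jordanBlock (size k.1 k.2) (eig k.1 k.2)) * Uinv

namespace JordanCycleForm

variable {m q : ℕ} {A : Matrix (Fin m) (Fin m) ℂ}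

/-- `λ_{i,1}`. -/
def firstEig (J : JordanCycleForm A) (i : Fin J.μ) : ℂ :=
  J.eig i ⟨0, J.ν_pos i⟩

/-- The period `p_i` of the `i`-th eigenvalue cycle. -/
def period (J : JordanCycleForm A) (i : Fin J.μ) : ℕ :=
  cyclePeriod (J.eig i)

/-- `A_i = diag(λ_{i,1}, …, λ_{i,ν i})`. -/
def cycleA (J : JordanCycleForm A) (i : Fin J.μ) : Matrix (Fin (J.ν i)) (Fin (J.ν i)) ℂ :=
  Matrix.diagonal (J.eig i)

/-- `C_i`: its `j`-th column is the first column of the part `C_{i,j}` of `C' = C U` that belongs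
to the block `A_{i,j}`. -/
def cycleC (J : JordanCycleForm A) (C : Matrix (Fin q) (Fin m) ℂ) (i : Fin J.μ) :
    Matrix (Fin q) (Fin (J.ν i)) ℂ :=
  Matrix.of fun r j => (C * J.U) r ⟨⟨i, j⟩, ⟨0, J.size_pos i j⟩⟩

/-- The matrix with the block rows `C_i A_i^s`, `s ∈ S`. -/
def gramian (J : JordanCycleForm A) (C : Matrix (Fin q) (Fin m) ℂ) (i : Fin J.μ) (S : Finset ℕ) :
    Matrix (S × Fin q) (Fin (J.ν i)) ℂ :=
  Matrix.of fun s j => (J.cycleC C i * J.cycleA i ^ (s.1 : ℕ)) s.2 j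

/-- `l_i`: the least cardinality of a set `S' ⊆ {0, …, p_i - 1}` of erased residues such that the
matrix with the block rows `C_i A_i^s`, `s ∈ {0, …, p_i - 1} \ S'`, has rank less than `ν i`. -/
def minErasures (J : JordanCycleForm A) (C : Matrix (Fin q) (Fin m) ℂ) (i : Fin J.μ) : ℕ :=
  sInf {c | ∃ S' ⊆ Finset.range (J.period i),
    S'.card = c ∧ (J.gramian C i (Finset.range (J.period i) \ S')).rank < J.ν i}

/-- `|λ_{i,1}|^(2 p_i / l_i)`; for `l_i = 0` the exponent is `∞`, and `a^∞` is `0` for `a < 1`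
and `∞` for `a ≥ 1`. -/
def growth (J : JordanCycleForm A) (C : Matrix (Fin q) (Fin m) ℂ) (i : Fin J.μ) : ℝ≥0∞ :=
  if J.minErasures C i = 0 then
    if ‖J.firstEig i‖ < 1 then 0 else ∞
  else
    ENNReal.ofReal (‖J.firstEig i‖ ^ (2 * (J.period i : ℝ) / (J.minErasures C i : ℝ)))

end JordanCycleForm

end

end IntermittentKalman

/-! Both criteria amount to `pe ^ l * |λ| ^ (2 * p) < 1` for every cycle, with `l`, `λ`, `p`
belonging to that cycle. Over one period the squared error in the cycle grows by `|λ| ^ (2 * p)`,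
while `pe ^ l` is the probability of losing a cheapest set of residues whose loss hides a direction
of the cycle.

Sufficiency. The projections onto the generalized eigenspaces of the cycles add up to the identity,
so each component is estimated on its own; if `|λ| < 1`, the estimate zero will do. Otherwise time
is cut into superblocks of `M` periods. A superblock whose received times do not resolve the
eigenvector part of the cycle has lost all `M` occurrences of at least `l` residues. If a fixed
proportion of the superblocks of a long block does resolve it, the whole component is determined,
Jordan chains and the interference of other cycles included (`exists_proj_eq_zero_of_many_rich`): a
dense set of superblocks shares one reception pattern, dense sets contain iterated common
differences `d`, and the operators `A ^ (P * d) - λ ^ (P * d)` strip Jordan coordinates one at a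
time while preserving invisibility. A count of the remaining patterns (`exists_block_length`) bounds
the probability of a bad block of length `L` by some `π₀` with `π₀ * r ^ (2 * L) < 1`, where `r >
|λ|`. The estimator reconstructs from the latest good block. Its Gaussian error is bounded by a
variable independent of the channel and of size `r ^ (j * L)` if `j` blocks were bad, so the mean
square error is dominated by a geometric series.

Necessity. A combination `z` of first Jordan vectors is visible only at `l` residues and is
multiplied by `λ ^ p` every period. By controllability a window of `m` inputs steers `0` to `z` (to
its real or imaginary part in the real case), and output noise can mask the window. There is a
linear functional `ζ` of the noise whose correlations with the states and the output noises are this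
trajectory. When the packets at the visible times are erased, `ζ` is uncorrelated with everything
received, hence independent of it by joint Gaussianity, and no estimator can capture it. Disjoint
windows give orthogonal functionals, so Bessel's inequality (`sum_le_integral_norm_sq`) adds up
their contributions. If `pe ^ l * |λ| ^ (2 * p) ≥ 1`, each of them is at least a fixed positive
constant; adding them, instead of taking the largest, covers the case of equality. -/

namespace IntermittentKalman

/-! ### Jordan coordinates -/

namespace JordanCycleForm

variable {m q : ℕ} {A : Matrix (Fin m) (Fin m) ℂ} (J : JordanCycleForm A)

/-- The labels of the Jordan blocks. -/
abbrev Block : Type := (i : Fin J.μ) × Fin (J.ν i)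

/-- The coordinates of a vector in the Jordan basis, extended by zero beyond the block size. -/
noncomputable def coord (x : Fin m → ℂ) (k : J.Block) (a : ℕ) : ℂ :=
  if h : a < J.size k.1 k.2 then J.Uinv.mulVec x ⟨k, ⟨a, h⟩⟩ else 0

lemma coord_of_le {x : Fin m → ℂ} {k : J.Block} {a : ℕ} (h : J.size k.1 k.2 ≤ a) :
    J.coord x k a = 0 := dif_neg (by omega)

lemma coord_fin (x : Fin m → ℂ) (k : J.Block) (a : Fin (J.size k.1 k.2)) :
    J.coord x k a = J.Uinv.mulVec x ⟨k, a⟩ := by simp [coord]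

lemma coord_sub (x y : Fin m → ℂ) (k : J.Block) (a : ℕ) :
    J.coord (x - y) k a = J.coord x k a - J.coord y k a := by
  unfold coord; split_ifs <;> simp [Matrix.mulVec_sub]

lemma coord_smul (c : ℂ) (x : Fin m → ℂ) (k : J.Block) (a : ℕ) :
    J.coord (c • x) k a = c * J.coord x k a := by
  unfold coord; split_ifs <;> simp [Matrix.mulVec_smul]

lemma U_mulVec_Uinv_mulVec (x : Fin m → ℂ) : J.U.mulVec (J.Uinv.mulVec x) = x := by
  rw [Matrix.mulVec_mulVec, J.U_mul_Uinv, Matrix.one_mulVec]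

lemma Uinv_mulVec_U_mulVec (x) : J.Uinv.mulVec (J.U.mulVec x) = x := by
  rw [Matrix.mulVec_mulVec, J.Uinv_mul_U, Matrix.one_mulVec]

lemma mulVec_eq_sum_coord {r : ℕ} (C : Matrix (Fin r) (Fin m) ℂ) (x : Fin m → ℂ) (s : Fin r) :
    C.mulVec x s = ∑ k : J.Block, ∑ a : Fin (J.size k.1 k.2), (C * J.U) s ⟨k, a⟩ * J.coord x k a := by
  conv_lhs => rw [← J.U_mulVec_Uinv_mulVec x, Matrix.mulVec_mulVec]
  simp only [Matrix.mulVec, dotProduct, coord_fin]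
  rw [Fintype.sum_sigma]

lemma eq_zero_of_coord {x : Fin m → ℂ} (h : ∀ k a, J.coord x k a = 0) : x = 0 := by
  have h0 : J.Uinv.mulVec x = 0 := by
    ext ⟨k, a⟩
    rw [← coord_fin, h]; rfl
  rw [← J.U_mulVec_Uinv_mulVec x, h0, Matrix.mulVec_zero]

lemma Uinv_mul_A : J.Uinv * A = Matrix.blockDiagonal'
    (fun k : J.Block => jordanBlock (J.size k.1 k.2) (J.eig k.1 k.2)) * J.Uinv := by
  refine (congrArg (J.Uinv * ·) J.eq_conj).trans ?_
  rw [← Matrix.mul_assoc, ← Matrix.mul_assoc, J.Uinv_mul_U, Matrix.one_mul]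

/-- Since `coord` vanishes beyond the block, the end of a Jordan chain needs no separate case. -/
lemma coord_mulVec (x : Fin m → ℂ) (k : J.Block) (a : ℕ) :
    J.coord (A.mulVec x) k a = J.eig k.1 k.2 * J.coord x k a + J.coord x k (a + 1) := by
  by_cases h : a < J.size k.1 k.2
  swap
  · rw [coord_of_le _ (by omega), coord_of_le _ (by omega), coord_of_le _ (by omega)]; simp
  have h1 : J.coord (A.mulVec x) k a = J.Uinv.mulVec (A.mulVec x) ⟨k, ⟨a, h⟩⟩ :=
    J.coord_fin _ k ⟨a, h⟩
  rw [h1, Matrix.mulVec_mulVec, J.Uinv_mul_A, ← Matrix.mulVec_mulVec]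
  have h2 : ∀ z, (Matrix.blockDiagonal' (fun k : J.Block =>
      jordanBlock (J.size k.1 k.2) (J.eig k.1 k.2))).mulVec z ⟨k, ⟨a, h⟩⟩ =
      ∑ b, jordanBlock (J.size k.1 k.2) (J.eig k.1 k.2) ⟨a, h⟩ b * z ⟨k, b⟩ := by
    intro z
    simp only [Matrix.mulVec, dotProduct]
    rw [Fintype.sum_sigma, Finset.sum_eq_single k]
    · simp only [Matrix.blockDiagonal'_apply_eq]
    · intro k' _ hk'
      refine Finset.sum_eq_zero fun b _ => ?_
      rw [Matrix.blockDiagonal'_apply_ne _ _ _ hk'.symm, zero_mul]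
    · simp
  rw [h2]
  have h3 : ∀ b : Fin (J.size k.1 k.2),
      jordanBlock (J.size k.1 k.2) (J.eig k.1 k.2) ⟨a, h⟩ b * J.Uinv.mulVec x ⟨k, b⟩ =
      (if b = ⟨a, h⟩ then J.eig k.1 k.2 * J.coord x k a else 0) +
        (if (b : ℕ) = a + 1 then J.coord x k (a + 1) else 0) := by
    intro b
    rw [← coord_fin]
    simp only [jordanBlock, Matrix.of_apply]
    by_cases hb : b = ⟨a, h⟩
    · subst hb; simp
    · have hb' : (⟨a, h⟩ : Fin _) ≠ b := fun e => hb e.symm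
      rw [if_neg hb', if_neg hb]
      by_cases hb2 : (b : ℕ) = a + 1
      · rw [if_pos hb2.symm, if_pos hb2, hb2]; simp
      · rw [if_neg (fun e => hb2 e.symm), if_neg hb2]; simp
  rw [Finset.sum_congr rfl fun b _ => h3 b, Finset.sum_add_distrib]
  congr 1
  · simp
  · by_cases h4 : a + 1 < J.size k.1 k.2
    · rw [Finset.sum_eq_single (⟨a + 1, h4⟩ : Fin _)]
      · simp
      · intro b _ hb
        exact if_neg fun e => hb (Fin.ext e)
      · simp
    · rw [coord_of_le _ (by omega)]; simp

lemma coord_pow_eq_zero {x : Fin m → ℂ} {k : J.Block} {a : ℕ} (h : ∀ b, a ≤ b → J.coord x k b = 0)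
    (D : ℕ) : ∀ b, a ≤ b → J.coord ((A ^ D).mulVec x) k b = 0 := by
  induction D with
  | zero => simpa using h
  | succ D ih =>
    intro b hb
    rw [pow_succ', ← Matrix.mulVec_mulVec, coord_mulVec, ih b hb, ih (b + 1) (by omega)]; simp

lemma coord_pow_top {x : Fin m → ℂ} {k : J.Block} {a : ℕ} (h : ∀ b, a < b → J.coord x k b = 0)
    (D : ℕ) : J.coord ((A ^ D).mulVec x) k a = J.eig k.1 k.2 ^ D * J.coord x k a := by
  induction D with
  | zero => simp
  | succ D ih =>
    rw [pow_succ', ← Matrix.mulVec_mulVec, coord_mulVec, ih,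
      J.coord_pow_eq_zero (a := a + 1) (fun b hb => h b hb) D (a + 1) le_rfl]
    ring

/-- For `D > 0` and a nonzero eigenvalue the second term prevents a power of a Jordan block of size
at least two from being scalar. The truncated exponent at `D = 0` is harmless because of the factor
`D`. -/
lemma coord_pow_subtop {x : Fin m → ℂ} {k : J.Block} {a : ℕ}
    (h : ∀ b, a + 1 < b → J.coord x k b = 0) (D : ℕ) :
    J.coord ((A ^ D).mulVec x) k a = J.eig k.1 k.2 ^ D * J.coord x k a +
      D * J.eig k.1 k.2 ^ (D - 1) * J.coord x k (a + 1) := by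
  induction D with
  | zero => simp
  | succ D ih =>
    rw [pow_succ', ← Matrix.mulVec_mulVec, coord_mulVec, ih, J.coord_pow_top h]
    rcases D with _ | D
    · simp
    · simp only [Nat.add_sub_cancel]; push_cast; ring

/-- The projection onto the generalized eigenspace of the `i`-th eigenvalue cycle. -/
noncomputable def proj (i : Fin J.μ) : Matrix (Fin m) (Fin m) ℂ :=
  J.U * Matrix.diagonal (fun p : (k : J.Block) × Fin (J.size k.1 k.2) => if p.1.1 = i then (1 : ℂ) else 0) * J.Uinv

lemma coord_proj (i : Fin J.μ) (x : Fin m → ℂ) (k : J.Block) (a : ℕ) :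
    J.coord ((J.proj i).mulVec x) k a = if k.1 = i then J.coord x k a else 0 := by
  unfold coord
  split_ifs with h1 h2
  · rw [proj, ← Matrix.mulVec_mulVec, ← Matrix.mulVec_mulVec, Uinv_mulVec_U_mulVec]
    simp [Matrix.mulVec_diagonal, h2]
  · rw [proj, ← Matrix.mulVec_mulVec, ← Matrix.mulVec_mulVec, Uinv_mulVec_U_mulVec]
    simp [Matrix.mulVec_diagonal, h2]
  · rfl
  · rfl

lemma sum_proj : ∑ i, J.proj i = 1 := by
  have : (∑ i, Matrix.diagonal (fun p : (k : J.Block) × Fin (J.size k.1 k.2) =>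
      if p.1.1 = i then (1 : ℂ) else 0)) = 1 := by
    ext p p'
    rw [Matrix.sum_apply]
    by_cases h : p = p'
    · subst h; simp
    · simp [Matrix.diagonal_apply_ne _ h, Matrix.one_apply_ne h]
  simp only [proj]
  rw [← Matrix.sum_mul, ← Matrix.mul_sum, this, Matrix.mul_one, J.U_mul_Uinv]

lemma ext_coord {x y : Fin m → ℂ} (h : ∀ k a, J.coord x k a = J.coord y k a) : x = y := by
  rw [← sub_eq_zero]
  exact J.eq_zero_of_coord fun k a => by rw [coord_sub, h, sub_self]

lemma proj_mulVec_mulVec (i : Fin J.μ) (x : Fin m → ℂ) :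
    (J.proj i).mulVec (A.mulVec x) = A.mulVec ((J.proj i).mulVec x) := by
  refine J.ext_coord fun k a => ?_
  simp only [coord_proj, coord_mulVec]
  split_ifs <;> simp

lemma proj_pow_mulVec (i : Fin J.μ) (n : ℕ) (x : Fin m → ℂ) :
    (J.proj i).mulVec ((A ^ n).mulVec x) = (A ^ n).mulVec ((J.proj i).mulVec x) := by
  induction n with
  | zero => simp
  | succ n ih =>
    rw [pow_succ', ← Matrix.mulVec_mulVec, proj_mulVec_mulVec, ih, Matrix.mulVec_mulVec]

lemma proj_mulVec_eq_zero_iff (i : Fin J.μ) (x : Fin m → ℂ) :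
    (J.proj i).mulVec x = 0 ↔ ∀ j a, J.coord x ⟨i, j⟩ a = 0 := by
  constructor
  · intro h j a
    have := J.coord_proj i x ⟨i, j⟩ a
    rw [h] at this
    simpa [coord] using this.symm
  · intro h
    refine J.eq_zero_of_coord fun k a => ?_
    rw [coord_proj]
    split_ifs with hk
    · obtain ⟨i', j⟩ := k
      obtain rfl : i' = i := hk
      exact h j a
    · rfl

/-! Eigenvalue cycles. -/

lemma period_spec (i : Fin J.μ) : IsCyclePeriod (J.eig i) (J.period i) :=
  Nat.sInf_mem (J.cycle i)

lemma period_pos (i : Fin J.μ) : 0 < J.period i := (J.period_spec i).1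

lemma eig_pow_eq (i : Fin J.μ) {n : ℕ} (hn : J.period i ∣ n) (j k : Fin (J.ν i)) :
    J.eig i j ^ n = J.eig i k ^ n := by
  obtain ⟨c, rfl⟩ := hn
  rw [pow_mul, pow_mul, (J.period_spec i).2 j k]

lemma norm_eig (i : Fin J.μ) (j : Fin (J.ν i)) : ‖J.eig i j‖ = ‖J.firstEig i‖ := by
  have h := congrArg norm ((J.period_spec i).2 j ⟨0, J.ν_pos i⟩)
  rw [norm_pow, norm_pow] at h
  exact (pow_left_inj₀ (norm_nonneg _) (norm_nonneg _) (J.period_pos i).ne').1 h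

lemma eig_pow_ne {i i' : Fin J.μ} (h : i ≠ i') (j : Fin (J.ν i)) (j' : Fin (J.ν i')) {n : ℕ}
    (hn : 0 < n) : J.eig i j ^ n ≠ J.eig i' j' ^ n := by
  intro he
  refine J.not_cycle i i' h j j' ⟨n, hn, ?_⟩
  intro a b
  fin_cases a <;> fin_cases b <;> simp [he]

/-! Growth of the powers of `A` on a generalized eigenspace. -/

/-- Weighting the `a`-th Jordan coordinate by `t ^ a` with `t = 1 / (r - |λ|)` makes the nilpotent
shift contribute at most `(r - |λ|) * N x`, so that `N (A x) ≤ r * N x`. Comparing `N` with the sup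
norm then gives the constant; the polynomial factors of the Jordan blocks are absorbed by `r > |λ|`.
-/
lemma exists_norm_proj_pow_le (i : Fin J.μ) {r : ℝ} (hr : ‖J.firstEig i‖ < r) :
    ∃ c : ℝ, 0 ≤ c ∧ ∀ n x, ‖(J.proj i).mulVec ((A ^ n).mulVec x)‖ ≤ c * r ^ n * ‖x‖ := by
  set lam := ‖J.firstEig i‖
  have hlam : 0 ≤ lam := norm_nonneg _
  set t : ℝ := 1 / (r - lam) with ht
  have htpos : 0 < t := one_div_pos.2 (by linarith)
  let N : (Fin m → ℂ) → ℝ := fun x =>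
    ∑ j : Fin (J.ν i), ∑ a ∈ Finset.range (J.size i j), t ^ a * ‖J.coord x ⟨i, j⟩ a‖
  have hN0 : ∀ x, 0 ≤ N x := fun x =>
    Finset.sum_nonneg fun j _ => Finset.sum_nonneg fun a _ => by positivity
  have hstep : ∀ x, N (A.mulVec x) ≤ r * N x := by
    intro x
    simp only [N, Finset.mul_sum (s := Finset.univ)]
    refine Finset.sum_le_sum fun j _ => ?_
    have h1 : ∑ a ∈ Finset.range (J.size i j), t ^ a * ‖J.coord x ⟨i, j⟩ (a + 1)‖ ≤
        (r - lam) * ∑ a ∈ Finset.range (J.size i j), t ^ a * ‖J.coord x ⟨i, j⟩ a‖ := by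
      have h2 : ∑ a ∈ Finset.range (J.size i j), t ^ a * ‖J.coord x ⟨i, j⟩ (a + 1)‖ =
          (r - lam) * ∑ a ∈ Finset.range (J.size i j),
            t ^ (a + 1) * ‖J.coord x ⟨i, j⟩ (a + 1)‖ := by
        rw [Finset.mul_sum]
        refine Finset.sum_congr rfl fun a _ => ?_
        have : (r - lam) * t = 1 := by
          rw [ht]; field_simp [show r - lam ≠ 0 by linarith]
        rw [pow_succ]; linear_combination (-(t ^ a * ‖J.coord x ⟨i, j⟩ (a + 1)‖)) * this
      rw [h2]
      refine mul_le_mul_of_nonneg_left ?_ (by linarith)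
      -- The shifted sum loses the term `a = 0` and gains the term `a = size`, which is zero.
      have h3 := Finset.sum_range_succ' (fun a => t ^ a * ‖J.coord x ⟨i, j⟩ a‖) (J.size i j)
      rw [Finset.sum_range_succ] at h3
      have h4 : J.coord x ⟨i, j⟩ (J.size i j) = 0 := J.coord_of_le le_rfl
      rw [h4] at h3
      simp only [norm_zero, mul_zero, add_zero, pow_zero, one_mul] at h3
      have := norm_nonneg (J.coord x ⟨i, j⟩ 0)
      linarith
    calc ∑ a ∈ Finset.range (J.size i j), t ^ a * ‖J.coord (A.mulVec x) ⟨i, j⟩ a‖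
        ≤ ∑ a ∈ Finset.range (J.size i j), (lam * (t ^ a * ‖J.coord x ⟨i, j⟩ a‖) +
            t ^ a * ‖J.coord x ⟨i, j⟩ (a + 1)‖) := by
          refine Finset.sum_le_sum fun a _ => ?_
          rw [coord_mulVec]
          have := norm_add_le (J.eig i j * J.coord x ⟨i, j⟩ a) (J.coord x ⟨i, j⟩ (a + 1))
          rw [norm_mul, J.norm_eig i j] at this
          have := mul_le_mul_of_nonneg_left this (pow_nonneg htpos.le a)
          calc _ ≤ _ := this
            _ = _ := by ring
      _ ≤ _ := by
          rw [Finset.sum_add_distrib, ← Finset.mul_sum]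
          linarith
  have hpow : ∀ n x, N ((A ^ n).mulVec x) ≤ r ^ n * N x := by
    intro n x
    induction n with
    | zero => simp
    | succ n ih =>
      rw [pow_succ', ← Matrix.mulVec_mulVec, pow_succ']
      have hr0 : 0 ≤ r := by linarith
      calc _ ≤ _ := hstep _
        _ ≤ r * (r ^ n * N x) := mul_le_mul_of_nonneg_left ih hr0
        _ = _ := by ring
  have hle : ∃ c₁ : ℝ, 0 ≤ c₁ ∧ ∀ x, N x ≤ c₁ * ‖x‖ := by
    have : ∀ k : J.Block, ∀ a, ∃ c : ℝ, 0 ≤ c ∧ ∀ x, ‖J.coord x k a‖ ≤ c * ‖x‖ := by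
      intro k a
      by_cases h : a < J.size k.1 k.2
      · refine ⟨∑ b, ‖J.Uinv ⟨k, ⟨a, h⟩⟩ b‖, by positivity, fun x => ?_⟩
        rw [coord, dif_pos h, Matrix.mulVec, dotProduct, Finset.sum_mul]
        refine (norm_sum_le _ _).trans (Finset.sum_le_sum fun b _ => ?_)
        rw [norm_mul]
        exact mul_le_mul_of_nonneg_left (norm_le_pi_norm x b) (norm_nonneg _)
      · exact ⟨0, le_rfl, fun x => by rw [J.coord_of_le (by omega)]; simp⟩
    choose c hc0 hc using this
    refine ⟨∑ j : Fin (J.ν i), ∑ a ∈ Finset.range (J.size i j), t ^ a * c ⟨i, j⟩ a,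
      Finset.sum_nonneg fun j _ => Finset.sum_nonneg fun a _ => mul_nonneg (by positivity) (hc0 _ _),
      fun x => ?_⟩
    simp only [N, Finset.sum_mul]
    refine Finset.sum_le_sum fun j _ => Finset.sum_le_sum fun a _ => ?_
    rw [mul_assoc]
    exact mul_le_mul_of_nonneg_left (hc _ _ _) (by positivity)
  have hge : ∃ c₂ : ℝ, 0 ≤ c₂ ∧ ∀ x, ‖(J.proj i).mulVec x‖ ≤ c₂ * N x := by
    refine ⟨∑ s, ∑ k : J.Block, ∑ a : Fin (J.size k.1 k.2), ‖J.U s ⟨k, a⟩‖ * (t ^ (a : ℕ))⁻¹,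
      by positivity, fun x => ?_⟩
    have hcoord : ∀ (k : J.Block) (a : Fin (J.size k.1 k.2)),
        ‖J.coord ((J.proj i).mulVec x) k a‖ ≤ (t ^ (a : ℕ))⁻¹ * N x := by
      intro k a
      rw [coord_proj]
      split_ifs with h
      · obtain ⟨i', j⟩ := k
        obtain rfl : i' = i := h
        rw [← div_eq_inv_mul, le_div_iff₀ (by positivity), mul_comm]
        have h1 := Finset.single_le_sum (f := fun a => t ^ a * ‖J.coord x ⟨i', j⟩ a‖)
          (fun a _ => by positivity) (Finset.mem_range.2 a.2)
        refine h1.trans ?_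
        exact Finset.single_le_sum (f := fun j => ∑ a ∈ Finset.range (J.size i' j),
          t ^ a * ‖J.coord x ⟨i', j⟩ a‖)
          (fun j _ => Finset.sum_nonneg fun a _ => by positivity) (Finset.mem_univ j)
      · rw [norm_zero]; exact mul_nonneg (by positivity) (hN0 x)
    rw [pi_norm_le_iff_of_nonneg (mul_nonneg (by positivity) (hN0 x))]
    intro s
    have h1 := J.mulVec_eq_sum_coord 1 ((J.proj i).mulVec x) s
    rw [Matrix.one_mulVec, Matrix.one_mul] at h1
    rw [h1]
    calc _ ≤ ∑ k : J.Block, ∑ a : Fin (J.size k.1 k.2),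
          ‖J.U s ⟨k, a⟩‖ * ((t ^ (a : ℕ))⁻¹ * N x) := by
          refine (norm_sum_le _ _).trans (Finset.sum_le_sum fun k _ => ?_)
          refine (norm_sum_le _ _).trans (Finset.sum_le_sum fun a _ => ?_)
          rw [norm_mul]
          exact mul_le_mul_of_nonneg_left (hcoord k a) (norm_nonneg _)
      _ = (∑ k : J.Block, ∑ a : Fin (J.size k.1 k.2), ‖J.U s ⟨k, a⟩‖ * (t ^ (a : ℕ))⁻¹) * N x := by
          simp only [Finset.sum_mul, mul_assoc]
      _ ≤ _ := by
          refine mul_le_mul_of_nonneg_right ?_ (hN0 x)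
          exact Finset.single_le_sum (f := fun s => ∑ k : J.Block, ∑ a : Fin (J.size k.1 k.2),
            ‖J.U s ⟨k, a⟩‖ * (t ^ (a : ℕ))⁻¹) (fun s _ => by positivity) (Finset.mem_univ s)
  obtain ⟨c₁, hc₁, h1⟩ := hle
  obtain ⟨c₂, hc₂, h2⟩ := hge
  refine ⟨c₂ * c₁, by positivity, fun n x => ?_⟩
  have hr0 : 0 ≤ r := by linarith
  calc _ ≤ c₂ * N ((A ^ n).mulVec x) := h2 _
    _ ≤ c₂ * (r ^ n * (c₁ * ‖x‖)) := mul_le_mul_of_nonneg_left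
        ((hpow n x).trans (mul_le_mul_of_nonneg_left (h1 x) (by positivity))) hc₂
    _ = _ := by ring

end JordanCycleForm

end IntermittentKalman

namespace IntermittentKalman

/-! ### Common differences in dense sets -/

/-- `W` contains a configuration obtained by taking `K` successive common differences. -/
def HasCube : ℕ → Finset ℕ → Prop
  | 0, W => W.Nonempty
  | K + 1, W => W.Nonempty ∧ ∃ d, 0 < d ∧ HasCube K (W.filter fun t => t + d ∈ W)

lemma HasCube.nonempty {K : ℕ} {W : Finset ℕ} (h : HasCube K W) : W.Nonempty := by
  cases K with
  | zero => exact h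
  | succ K => exact h.1

/-- Pigeonhole: the `|W|² - |W|` ordered pairs of distinct elements have fewer than `2 * T`
differences. -/
lemma exists_common_difference {T : ℕ} {W : Finset ℕ} (hW : W ⊆ Finset.range T)
    (hWne : W.Nonempty) {b : ℝ}
    (hb : 0 < b) (hb' : 2 * T * b ≤ (W.card : ℝ) * W.card - W.card) :
    ∃ d, 0 < d ∧ b ≤ ((W.filter fun t => t + d ∈ W).card : ℝ) := by
  -- The shift by `T` keeps natural subtraction from truncating. The value `T` encodes difference
  -- zero; the sign of the difference decides which member of a pair is its left end.
  have hmaps : ∀ x ∈ W.offDiag, x.1 + T - x.2 ∈ Finset.range (2 * T) := by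
    intro x hx
    obtain ⟨h1, h2, _⟩ := Finset.mem_offDiag.1 hx
    have := Finset.mem_range.1 (hW h1)
    have := Finset.mem_range.1 (hW h2)
    exact Finset.mem_range.2 (by omega)
  have hT : (Finset.range (2 * T)).Nonempty := by
    obtain ⟨t, ht⟩ := hWne
    have := Finset.mem_range.1 (hW ht)
    exact ⟨0, Finset.mem_range.2 (by omega)⟩
  obtain ⟨e, -, he⟩ := Finset.exists_le_card_fiber_of_nsmul_le_card_of_maps_to
    (M := ℝ) (b := b) hmaps hT (by
      rw [Finset.card_range, nsmul_eq_mul, Finset.offDiag_card, Nat.cast_sub (Nat.le_mul_self _)]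
      push_cast
      exact hb')
  have hfiber : ∀ x ∈ W.offDiag.filter fun x => x.1 + T - x.2 = e,
      x.1 ∈ W ∧ x.2 ∈ W ∧ x.1 ≠ x.2 ∧ x.1 + T - x.2 = e ∧ x.1 < T ∧ x.2 < T := by
    intro x hx
    obtain ⟨h1, h2⟩ := Finset.mem_filter.1 hx
    obtain ⟨h3, h4, h5⟩ := Finset.mem_offDiag.1 h1
    exact ⟨h3, h4, h5, h2, Finset.mem_range.1 (hW h3), Finset.mem_range.1 (hW h4)⟩
  have hene : e ≠ T := by
    rintro rfl
    obtain ⟨x, hx⟩ := Finset.card_pos.1 (show 0 < (W.offDiag.filter fun x => x.1 + e - x.2 = e).card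
      by exact_mod_cast hb.trans_le he)
    obtain ⟨_, _, h3, h4, _, _⟩ := hfiber x hx
    omega
  rcases lt_or_gt_of_ne hene with h | h
  · refine ⟨T - e, by omega, he.trans ?_⟩
    norm_cast
    refine Finset.card_le_card_of_injOn (fun x => x.1) (fun x hx => ?_) (fun x hx y hy hxy => ?_)
    · obtain ⟨h1, h2, h3, h4, h5, h6⟩ := hfiber x hx
      have : x.1 + (T - e) = x.2 := by omega
      exact Finset.mem_coe.2 (Finset.mem_filter.2 ⟨h1, by rw [this]; exact h2⟩)
    · obtain ⟨_, _, _, h4, h5, h6⟩ := hfiber x hx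
      obtain ⟨_, _, _, g4, g5, g6⟩ := hfiber y hy
      have hxy' : x.1 = y.1 := hxy
      exact Prod.ext hxy' (by omega)
  · refine ⟨e - T, by omega, he.trans ?_⟩
    norm_cast
    refine Finset.card_le_card_of_injOn (fun x => x.2) (fun x hx => ?_) (fun x hx y hy hxy => ?_)
    · obtain ⟨h1, h2, h3, h4, h5, h6⟩ := hfiber x hx
      have : x.2 + (e - T) = x.1 := by omega
      exact Finset.mem_coe.2 (Finset.mem_filter.2 ⟨h2, by rw [this]; exact h1⟩)
    · obtain ⟨_, _, _, h4, h5, h6⟩ := hfiber x hx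
      obtain ⟨_, _, _, g4, g5, g6⟩ := hfiber y hy
      have hxy' : x.2 = y.2 := hxy
      exact Prod.ext (by omega) hxy'

/-- Iterated differencing: from density `δ`, some `d` leaves density at least `δ² / 4` in `W ∩ (W -
d)`, as soon as `δ * T ≥ 2` ensures `|W|² - |W| ≥ |W|² / 2`. -/
lemma hasCube_of_dense (K : ℕ) : ∀ δ : ℝ, 0 < δ → ∃ T₀ : ℕ, ∀ T, T₀ ≤ T → ∀ W : Finset ℕ,
    W ⊆ Finset.range T → δ * T ≤ W.card → HasCube K W := by
  induction K with
  | zero =>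
    intro δ hδ
    refine ⟨1, fun T hT W _ hc => ?_⟩
    have : (0 : ℝ) < W.card := lt_of_lt_of_le (mul_pos hδ (by exact_mod_cast hT)) hc
    exact Finset.card_pos.1 (by exact_mod_cast this)
  | succ K ih =>
    intro δ hδ
    obtain ⟨T₁, hT₁⟩ := ih (δ ^ 2 / 4) (by positivity)
    obtain ⟨T₂, hT₂⟩ := exists_nat_gt (2 / δ)
    refine ⟨max (max T₁ T₂) 1, fun T hT W hW hc => ?_⟩
    have h1 : T₁ ≤ T := by omega
    have h2 : T₂ ≤ T := by omega
    have h3 : (0 : ℝ) < T := by exact_mod_cast (show 0 < T by omega)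
    have h4 : 2 ≤ δ * T := by
      have : (T₂ : ℝ) ≤ T := by exact_mod_cast h2
      rw [div_lt_iff₀ hδ] at hT₂
      nlinarith
    have hWne : W.Nonempty :=
      Finset.card_pos.1 (by exact_mod_cast (show (0 : ℝ) < W.card by linarith))
    refine ⟨hWne, ?_⟩
    obtain ⟨d, hd, hcard⟩ := exists_common_difference hW hWne (b := δ ^ 2 / 4 * T) (by positivity) (by
      have h5 : (W.card : ℝ) * W.card / 2 ≤ (W.card : ℝ) * W.card - W.card := by nlinarith
      have h6 : (δ * T) * (δ * T) ≤ (W.card : ℝ) * W.card :=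
        mul_le_mul hc hc (by positivity) (by positivity)
      nlinarith)
    exact ⟨d, hd, hT₁ T h1 _ ((Finset.filter_subset _ _).trans hW) hcard⟩

/-! ### Invisible vectors and common differences -/

namespace JordanCycleForm

variable {m q : ℕ} {A : Matrix (Fin m) (Fin m) ℂ} (J : JordanCycleForm A)
  (C : Matrix (Fin q) (Fin m) ℂ)

/-- The residues in `Q` determine the eigenvector part of the `i`-th cycle. -/
def IsRich (i : Fin J.μ) (Q : Finset ℕ) : Prop :=
  ∀ u : Fin (J.ν i) → ℂ, (∀ r ∈ Q, (J.cycleC C i * J.cycleA i ^ r).mulVec u = 0) → u = 0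

variable {C}

lemma exists_top_coord {x : Fin m → ℂ} {k : J.Block} (h : ∃ a, J.coord x k a ≠ 0) :
    ∃ a, J.coord x k a ≠ 0 ∧ ∀ b, a < b → J.coord x k b = 0 := by
  classical
  obtain ⟨a₀, h₀⟩ := h
  have hne : ((Finset.range (J.size k.1 k.2)).filter fun a => J.coord x k a ≠ 0).Nonempty :=
    ⟨a₀, by
      rw [Finset.mem_filter, Finset.mem_range]
      exact ⟨by by_contra hlt; exact h₀ (J.coord_of_le (by omega)), h₀⟩⟩
  refine ⟨_, (Finset.mem_filter.1 (Finset.max'_mem _ hne)).2, fun b hb => ?_⟩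
  by_contra hb0
  have : b ∈ (Finset.range (J.size k.1 k.2)).filter fun a => J.coord x k a ≠ 0 := by
    rw [Finset.mem_filter, Finset.mem_range]
    exact ⟨by by_contra hlt; exact hb0 (J.coord_of_le (by omega)), hb0⟩
  exact absurd (Finset.le_max' _ _ this) (by omega)

/-- On a vector built from first Jordan vectors of one cycle, `C A^n` acts through `C_i A_i^n`. -/
lemma mulVec_pow_eq_cycle (i : Fin J.μ) {x : Fin m → ℂ}
    (hx : ∀ k a, k.1 ≠ i ∨ a ≠ 0 → J.coord x k a = 0) (n : ℕ) :
    C.mulVec ((A ^ n).mulVec x) =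
      (J.cycleC C i * J.cycleA i ^ n).mulVec fun j => J.coord x ⟨i, j⟩ 0 := by
  ext s
  rw [J.mulVec_eq_sum_coord, Fintype.sum_sigma, Finset.sum_eq_single i]
  · simp only [Matrix.mulVec, dotProduct]
    refine Finset.sum_congr rfl fun j _ => ?_
    rw [Finset.sum_eq_single (⟨0, J.size_pos i j⟩ : Fin _)]
    · rw [J.coord_pow_top (k := ⟨i, j⟩) (a := 0) (fun b hb => hx _ _ (Or.inr hb.ne'))]
      rw [cycleA, Matrix.diagonal_pow, Matrix.mul_diagonal]
      simp [cycleC, mul_assoc]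
    · intro a _ ha
      have ha0 : (a : ℕ) ≠ 0 := fun e => ha (Fin.ext e)
      rw [J.coord_pow_eq_zero (k := ⟨i, j⟩) (a := 1) (fun b hb => hx _ _ (Or.inr (by omega))) n a
        (by omega), mul_zero]
    · simp
  · intro i' _ hi'
    refine Finset.sum_eq_zero fun j _ => Finset.sum_eq_zero fun a _ => ?_
    rw [J.coord_pow_eq_zero (k := ⟨i', j⟩) (a := 0) (fun b _ => hx _ _ (Or.inl hi')) n a
        (by omega), mul_zero]
  · simp

/-- `A_i ^ n` is scalar when the period divides `n`, so up to a factor only the residue of a time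
matters for what it reveals. -/
lemma cycle_mulVec_period (i : Fin J.μ) {n : ℕ} (hn : J.period i ∣ n) (r : ℕ)
    (u : Fin (J.ν i) → ℂ) :
    (J.cycleC C i * J.cycleA i ^ (n + r)).mulVec u =
      J.firstEig i ^ n • (J.cycleC C i * J.cycleA i ^ r).mulVec u := by
  have : J.cycleA i ^ n = J.firstEig i ^ n • (1 : Matrix _ _ ℂ) := by
    rw [cycleA, Matrix.diagonal_pow, ← Matrix.diagonal_one, ← Matrix.diagonal_smul]
    congr 1
    ext j
    simpa [firstEig] using J.eig_pow_eq i hn j ⟨0, J.ν_pos i⟩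
  rw [pow_add, this, Matrix.smul_mul, Matrix.one_mul, Matrix.mul_smul, Matrix.smul_mulVec]

/-- The vectors that are invisible at the times `P t + r`, `t ∈ W`, `r ∈ Q`. -/
def Invisible (C : Matrix (Fin q) (Fin m) ℂ) (P : ℕ) (Q W : Finset ℕ) (x : Fin m → ℂ) : Prop :=
  ∀ t ∈ W, ∀ r ∈ Q, C.mulVec ((A ^ (P * t + r)).mulVec x) = 0

/-- The outputs of `A ^ (P * d) x` at superblock `t` are those of `x` at `t + d`. With `c = λ ^ (P *
d)` the new vector loses the top coordinate in a Jordan block with eigenvalue `λ`. -/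
lemma Invisible.difference {P : ℕ} {Q W : Finset ℕ} {x : Fin m → ℂ}
    (h : Invisible (A := A) C P Q W x) (d : ℕ) (c : ℂ) :
    Invisible (A := A) C P Q (W.filter fun t => t + d ∈ W) ((A ^ (P * d)).mulVec x - c • x) := by
  intro t ht r hr
  obtain ⟨h1, h2⟩ := Finset.mem_filter.1 ht
  rw [Matrix.mulVec_sub, Matrix.mulVec_sub, Matrix.mulVec_smul, Matrix.mulVec_smul, h t h1 r hr,
    Matrix.mulVec_mulVec x (A ^ (P * t + r)), ← pow_add,
    show P * t + r + P * d = P * (t + d) + r by ring, h _ h2 r hr]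
  simp

/-- Only first Jordan vectors of the cycle are present here, so a single rich superblock decides,
after cancelling the nonzero factor `λ ^ (P * t)`. -/
lemma proj_eq_zero_of_rich {i : Fin J.μ} (hlam : J.firstEig i ≠ 0) {P : ℕ}
    (hdvd : J.period i ∣ P) {Q W : Finset ℕ} (hQ : J.IsRich C i Q) (hW : W.Nonempty)
    {x : Fin m → ℂ} (hx : ∀ k a, k.1 ≠ i ∨ a ≠ 0 → J.coord x k a = 0)
    (hN : Invisible (A := A) C P Q W x) : (J.proj i).mulVec x = 0 := by
  obtain ⟨t, ht⟩ := hW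
  have hu := hQ (fun j => J.coord x ⟨i, j⟩ 0) fun r hr => by
    have h1 := hN t ht r hr
    rw [J.mulVec_pow_eq_cycle i hx, J.cycle_mulVec_period i (hdvd.mul_right t)] at h1
    exact (smul_eq_zero.1 h1).resolve_left (pow_ne_zero _ hlam)
  rw [proj_mulVec_eq_zero_iff]
  intro j a
  by_cases ha : a = 0
  · subst ha; exact congrFun hu j
  · exact hx _ _ (Or.inr ha)

/-- Induction on `∑ h`, a bound for the number of nonzero Jordan coordinates. Put `D = P * d`. For
each block `k` with `h k > 0`, the induction hypothesis for `(A ^ D - λ_k ^ D) x` says that `A ^ D`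
acts on the `i`-th component of `x` as the scalar `λ_k ^ D`. If `k` lies in another cycle, that
scalar differs from every `λ_{i,j} ^ D`, so the component is zero. If there is no such `k`, then `x`
lies in cycle `i`, and scalar action leaves only first Jordan vectors, which is the situation of
`proj_eq_zero_of_rich`. -/
lemma proj_eq_zero_of_hasCube {i : Fin J.μ} (hlam : J.firstEig i ≠ 0) {P : ℕ} (hP : 0 < P)
    (hdvd : J.period i ∣ P) {Q : Finset ℕ} (hQ : J.IsRich C i Q) (K : ℕ) :
    ∀ (W : Finset ℕ) (h : J.Block → ℕ) (x : Fin m → ℂ), HasCube K W → ∑ k, h k ≤ K →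
      (∀ k a, h k ≤ a → J.coord x k a = 0) → Invisible (A := A) C P Q W x →
      (J.proj i).mulVec x = 0 := by
  classical
  have hlamj : ∀ j, J.eig i j ≠ 0 := fun j => by
    rw [← norm_ne_zero_iff, J.norm_eig]; exact norm_ne_zero_iff.2 hlam
  induction K with
  | zero =>
    intro W h x _ hsum hx _
    rw [proj_mulVec_eq_zero_iff]
    intro j a
    have := Finset.single_le_sum (f := h) (fun _ _ => Nat.zero_le _) (Finset.mem_univ ⟨i, j⟩)
    exact hx _ _ (by omega)
  | succ K ih =>
    intro W h x hcube hsum hx hN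
    obtain ⟨hne, d, hd, hK⟩ := hcube
    have hD : 0 < P * d := Nat.mul_pos hP hd
    have hred : ∀ k, 0 < h k →
        (J.proj i).mulVec ((A ^ (P * d)).mulVec x - J.eig k.1 k.2 ^ (P * d) • x) = 0 := by
      intro k hk
      refine ih _ (Function.update h k (h k - 1)) _ hK ?_ ?_ (hN.difference d _)
      · rw [Finset.sum_update_of_mem (Finset.mem_univ k)]
        have := Finset.add_sum_erase Finset.univ h (Finset.mem_univ k)
        rw [Finset.sdiff_singleton_eq_erase]
        omega
      · intro k' a ha
        rw [coord_sub, coord_smul]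
        by_cases hk' : k' = k
        · subst hk'
          rw [Function.update_self] at ha
          rw [J.coord_pow_top fun b hb => hx _ _ (by omega), sub_self]
        · rw [Function.update_of_ne hk'] at ha
          rw [J.coord_pow_eq_zero (fun b hb => hx _ _ hb) _ a ha, hx _ _ ha]
          simp
    have hstep : ∀ c : ℂ, (J.proj i).mulVec ((A ^ (P * d)).mulVec x - c • x) = 0 → ∀ j a,
        J.coord ((A ^ (P * d)).mulVec x) ⟨i, j⟩ a = c * J.coord x ⟨i, j⟩ a := by
      intro c hc j a
      have := (J.proj_mulVec_eq_zero_iff i _).1 hc j a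
      rwa [coord_sub, coord_smul, sub_eq_zero] at this
    by_cases h1 : ∃ k : J.Block, k.1 ≠ i ∧ 0 < h k
    · obtain ⟨k, hki, hk⟩ := h1
      have h2 := hstep _ (hred k hk)
      rw [proj_mulVec_eq_zero_iff]
      by_contra hcon
      push Not at hcon
      obtain ⟨j, hj⟩ := hcon
      obtain ⟨a, ha, hb⟩ := J.exists_top_coord hj
      have h3 := h2 j a
      rw [J.coord_pow_top hb] at h3
      exact J.eig_pow_ne (Ne.symm hki) j k.2 hD (mul_right_cancel₀ ha h3)
    · push Not at h1
      refine J.proj_eq_zero_of_rich hlam hdvd hQ hne (fun k a hka => ?_) hN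
      by_cases hki : k.1 = i
      swap
      · exact hx _ _ (by have := h1 k hki; omega)
      obtain ⟨i', j⟩ := k
      obtain rfl : i' = i := hki
      have ha : a ≠ 0 := hka.resolve_left fun hn => hn rfl
      by_cases hh : 0 < h ⟨i', j⟩
      swap
      · exact hx _ _ (by omega)
      have h2 := hstep _ (hred ⟨i', j⟩ hh) j
      by_contra hcon
      obtain ⟨b, hb0, hb⟩ := J.exists_top_coord ⟨a, hcon⟩
      have hb1 : b ≠ 0 := by
        rintro rfl
        exact hcon (hb a (Nat.pos_of_ne_zero ha))
      obtain ⟨b, rfl⟩ := Nat.exists_eq_succ_of_ne_zero hb1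
      -- The coordinate below the top picks up `D * λ ^ (D - 1)` times the top one, which a scalar
      -- action forbids.
      have h3 := h2 b
      rw [J.coord_pow_subtop (k := ⟨i', j⟩) (a := b) hb] at h3
      have h4 : ((P * d : ℕ) : ℂ) * J.eig i' j ^ (P * d - 1) * J.coord x ⟨i', j⟩ (b + 1) = 0 := by
        simpa using h3
      refine mul_ne_zero (mul_ne_zero ?_ (pow_ne_zero _ (hlamj j))) hb0 h4
      exact_mod_cast hD.ne'

/-- If a positive proportion of the superblocks `[P t, P t + P)`, `t < T`, is rich, then the
received outputs determine the component in the `i`-th cycle. -/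
lemma exists_proj_eq_zero_of_many_rich {i : Fin J.μ} (hlam : J.firstEig i ≠ 0) {P : ℕ}
    (hP : 0 < P) (hdvd : J.period i ∣ P) {N : ℕ} (hN : 0 < N) :
    ∃ T₀ : ℕ, ∀ T, T₀ ≤ T → ∀ Q : ℕ → Finset ℕ, (∀ t, Q t ⊆ Finset.range P) →
      ∀ G ⊆ Finset.range T, (∀ t ∈ G, J.IsRich C i (Q t)) → T ≤ N * G.card →
      ∀ x, (∀ t < T, ∀ r ∈ Q t, C.mulVec ((A ^ (P * t + r)).mulVec x) = 0) →
        (J.proj i).mulVec x = 0 := by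
  classical
  -- One dimension of the cube for each Jordan coordinate; the density is what remains when a
  -- fraction `1 / N` of the superblocks is distributed over the `2 ^ P` reception patterns.
  obtain ⟨T₀, hT₀⟩ := hasCube_of_dense (∑ k : J.Block, J.size k.1 k.2) (1 / (N * 2 ^ P))
    (by positivity)
  refine ⟨max T₀ 1, fun T hT Q hQ G hG hrich hcard x hx => ?_⟩
  have hGne : G.Nonempty := by
    rw [← Finset.card_pos]; by_contra h0
    have : G.card = 0 := by omega
    rw [this] at hcard; omega
  have hmaps : ∀ t ∈ G, Q t ∈ (Finset.range P).powerset := fun t _ =>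
    Finset.mem_powerset.2 (hQ t)
  obtain ⟨Q₀, hQ₀, hfib⟩ := Finset.exists_le_card_fiber_of_nsmul_le_card_of_maps_to
    (M := ℝ) (b := G.card / 2 ^ P) hmaps ⟨∅, by simp⟩ (by
      rw [Finset.card_powerset, Finset.card_range, nsmul_eq_mul]
      push_cast
      rw [mul_div_cancel₀ _ (by positivity)])
  set W := G.filter fun t => Q t = Q₀ with hW
  have hcube := hT₀ T (by omega) W ((Finset.filter_subset _ _).trans hG) (by
    refine le_trans ?_ hfib
    rw [le_div_iff₀ (by positivity)]
    have : (T : ℝ) ≤ N * G.card := by exact_mod_cast hcard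
    have hN' : (0 : ℝ) < N := by exact_mod_cast hN
    field_simp
    linarith)
  obtain ⟨t₀, ht₀⟩ := hcube.nonempty
  have hrich₀ : J.IsRich C i Q₀ := by
    obtain ⟨h1, h2⟩ := Finset.mem_filter.1 ht₀
    rw [← h2]; exact hrich _ h1
  refine J.proj_eq_zero_of_hasCube hlam hP hdvd hrich₀ _ W (fun k => J.size k.1 k.2) x hcube le_rfl
    (fun k a ha => J.coord_of_le ha) ?_
  intro t ht r hr
  obtain ⟨h1, h2⟩ := Finset.mem_filter.1 ht
  exact hx t (Finset.mem_range.1 (hG h1)) r (by rw [h2]; exact hr)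

end JordanCycleForm

end IntermittentKalman

/-! ### Minimal erasures and the length of a block -/

namespace IntermittentKalman

lemma rank_lt_iff_exists_mulVec_eq_zero {ι : Type*} [Fintype ι] {n : ℕ}
    (M : Matrix ι (Fin n) ℂ) : M.rank < n ↔ ∃ u, u ≠ 0 ∧ M.mulVec u = 0 := by
  have h := LinearMap.finrank_range_add_finrank_ker M.mulVecLin
  rw [Module.finrank_fin_fun] at h
  have h2 : M.rank < n ↔ LinearMap.ker M.mulVecLin ≠ ⊥ := by
    rw [← Submodule.one_le_finrank_iff, Matrix.rank]
    omega
  rw [h2, Submodule.ne_bot_iff]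
  constructor
  · rintro ⟨u, hu, hu0⟩; exact ⟨u, hu0, by simpa using hu⟩
  · rintro ⟨u, hu0, hu⟩; exact ⟨u, by simpa using hu, hu0⟩

lemma eq_and_eq_of_mul_add_eq {c x y u v : ℕ} (hu : u < c) (hv : v < c)
    (h : c * x + u = c * y + v) : x = y ∧ u = v := by
  have hc : 0 < c := by omega
  have e1 := congrArg (· / c) h
  have e2 := congrArg (· % c) h
  simp only [Nat.mul_add_div hc, Nat.div_eq_of_lt hu, Nat.div_eq_of_lt hv, Nat.mul_add_mod,
    Nat.mod_eq_of_lt hu, Nat.mod_eq_of_lt hv, add_zero] at e1 e2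
  exact ⟨e1, e2⟩

namespace JordanCycleForm

variable {m q : ℕ} {A : Matrix (Fin m) (Fin m) ℂ} (J : JordanCycleForm A)
  {C : Matrix (Fin q) (Fin m) ℂ}

lemma gramian_mulVec_eq_zero_iff (i : Fin J.μ) (S : Finset ℕ) (u : Fin (J.ν i) → ℂ) :
    (J.gramian C i S).mulVec u = 0 ↔
      ∀ s ∈ S, (J.cycleC C i * J.cycleA i ^ s).mulVec u = 0 := by
  constructor
  · intro h s hs
    ext a
    exact congrFun h (⟨s, hs⟩, a)
  · intro h
    ext ⟨⟨s, hs⟩, a⟩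
    exact congrFun (h s hs) a

lemma minErasures_le {i : Fin J.μ} {S : Finset ℕ} (hS : S ⊆ Finset.range (J.period i))
    {u : Fin (J.ν i) → ℂ} (hu : u ≠ 0)
    (h : ∀ s ∈ Finset.range (J.period i) \ S, (J.cycleC C i * J.cycleA i ^ s).mulVec u = 0) :
    J.minErasures C i ≤ S.card :=
  Nat.sInf_le ⟨S, hS, rfl, (rank_lt_iff_exists_mulVec_eq_zero _).2
    ⟨u, hu, (J.gramian_mulVec_eq_zero_iff i _ u).2 h⟩⟩

lemma exists_card_eq_minErasures (C : Matrix (Fin q) (Fin m) ℂ) (i : Fin J.μ) :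
    ∃ S ⊆ Finset.range (J.period i), S.card = J.minErasures C i ∧ ∃ u, u ≠ 0 ∧
      ∀ s ∈ Finset.range (J.period i) \ S, (J.cycleC C i * J.cycleA i ^ s).mulVec u = 0 := by
  have hne : {c | ∃ S' ⊆ Finset.range (J.period i), S'.card = c ∧
      (J.gramian C i (Finset.range (J.period i) \ S')).rank < J.ν i}.Nonempty := by
    -- Erasing all residues leaves an empty stack of rank zero, so the infimum is attained.
    refine ⟨_, Finset.range (J.period i), subset_rfl, rfl, ?_⟩
    rw [rank_lt_iff_exists_mulVec_eq_zero]
    have := J.ν_pos i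
    refine ⟨fun _ => 1, fun h => one_ne_zero (congrFun h ⟨0, this⟩), ?_⟩
    rw [gramian_mulVec_eq_zero_iff]
    simp
  obtain ⟨S, hS, hc, hr⟩ := Nat.sInf_mem hne
  obtain ⟨u, hu, hu0⟩ := (rank_lt_iff_exists_mulVec_eq_zero _).1 hr
  exact ⟨S, hS, hc, u, hu, (J.gramian_mulVec_eq_zero_iff i _ u).1 hu0⟩

/-- The outputs received at the times in `R` determine the component in the `i`-th cycle. -/
def Determines (C : Matrix (Fin q) (Fin m) ℂ) (i : Fin J.μ) (R : Finset ℕ) : Prop :=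
  ∀ x, (∀ k ∈ R, C.mulVec ((A ^ k).mulVec x) = 0) → (J.proj i).mulVec x = 0

/-- A superblock that is not rich misses, for at least `l_i` residues, all times with that
residue. -/
lemma exists_erased_residues {i : Fin J.μ} (hlam : J.firstEig i ≠ 0) {Q : Finset ℕ}
    (hQ : ¬ J.IsRich C i Q) : ∃ S ⊆ Finset.range (J.period i), J.minErasures C i ≤ S.card ∧
      ∀ s ∈ S, ∀ b, J.period i * b + s ∉ Q := by
  classical
  simp only [IsRich, not_forall] at hQ
  obtain ⟨u, hu, hu0⟩ := hQ
  -- The erased residues are those that would reveal the unseen vector `u`; receiving one of them in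
  -- any period would contradict the choice of `u`.
  refine ⟨(Finset.range (J.period i)).filter fun s =>
    (J.cycleC C i * J.cycleA i ^ s).mulVec u ≠ 0, Finset.filter_subset _ _,
    J.minErasures_le (Finset.filter_subset _ _) hu0 fun s hs => ?_, fun s hs b hb => ?_⟩
  · by_contra hne
    exact (Finset.mem_sdiff.1 hs).2 (Finset.mem_filter.2 ⟨(Finset.mem_sdiff.1 hs).1, hne⟩)
  · have h1 := hu _ hb
    rw [J.cycle_mulVec_period i (dvd_mul_right _ b)] at h1
    exact (Finset.mem_filter.1 hs).2 ((smul_eq_zero.1 h1).resolve_left (pow_ne_zero _ hlam))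

/-- With `a = pe ^ l * r ^ (2 * p) < 1` the product is the `T`-th power of `(2 ^ p) ^ (N + 1) * (a ^
N * r ^ (2 * p)) ^ M`. First `N` compensates the growth `r ^ (2 * p)` over the superblocks that may
be rich, then `M` beats the number of patterns `(2 ^ p) ^ (N + 1)`. -/
lemma exists_block_parameters {p l : ℕ} {pe r : ℝ} (hpe : 0 ≤ pe) (hr : 1 ≤ r)
    (h : pe ^ l * r ^ (2 * p) < 1) : ∃ N M : ℕ, 0 < M ∧
      ∀ T, 0 < T → ((2 ^ p) ^ ((N + 1) * T) : ℝ) * pe ^ (M * l * (N * T)) *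
        r ^ (2 * (p * M * ((N + 1) * T))) < 1 := by
  set a := pe ^ l * r ^ (2 * p) with ha
  have ha0 : 0 ≤ a := by positivity
  have h1 : Filter.Tendsto (fun N : ℕ => a ^ N * r ^ (2 * p)) Filter.atTop
      (nhds (0 * r ^ (2 * p))) := (tendsto_pow_atTop_nhds_zero_of_lt_one ha0 h).mul_const _
  rw [zero_mul] at h1
  obtain ⟨N, hN⟩ := (h1.eventually (gt_mem_nhds one_pos)).exists
  set b := a ^ N * r ^ (2 * p) with hb
  have hb0 : 0 ≤ b := by positivity
  have h2 : Filter.Tendsto (fun M : ℕ => ((2 : ℝ) ^ p) ^ (N + 1) * b ^ M) Filter.atTop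
      (nhds (((2 : ℝ) ^ p) ^ (N + 1) * 0)) :=
    (tendsto_pow_atTop_nhds_zero_of_lt_one hb0 hN).const_mul _
  rw [mul_zero] at h2
  obtain ⟨M, hM, hM0⟩ := ((h2.eventually (gt_mem_nhds one_pos)).and
    (Filter.eventually_gt_atTop 0)).exists
  refine ⟨N, M, hM0, fun T hT => ?_⟩
  have : ((2 ^ p) ^ ((N + 1) * T) : ℝ) * pe ^ (M * l * (N * T)) *
      r ^ (2 * (p * M * ((N + 1) * T))) = (((2 : ℝ) ^ p) ^ (N + 1) * b ^ M) ^ T := by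
    rw [hb, ha]; ring
  rw [this]
  exact pow_lt_one₀ (by positivity) hM hT.ne'

/-- The set of the times `p M t + p b + s` with `t < T`, `s ∈ σ t`, `b < M`. -/
def erasureSet (p M T : ℕ) (σ : Fin T → Finset ℕ) : Finset ℕ :=
  ((Finset.univ.sigma σ) ×ˢ Finset.range M).image fun x => p * M * x.1.1 + (p * x.2 + x.1.2)

lemma mem_erasureSet {p M T : ℕ} {σ : Fin T → Finset ℕ} {k : ℕ} :
    k ∈ erasureSet p M T σ ↔ ∃ t, ∃ s ∈ σ t, ∃ b < M, p * M * t + (p * b + s) = k := by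
  simp only [erasureSet, Finset.mem_image, Finset.mem_product, Finset.mem_sigma, Finset.mem_univ,
    true_and, Finset.mem_range]
  constructor
  · rintro ⟨⟨⟨t, s⟩, b⟩, ⟨h1, h2⟩, h3⟩; exact ⟨t, s, h1, b, h2, h3⟩
  · rintro ⟨t, s, h1, b, h2, h3⟩; exact ⟨⟨⟨t, s⟩, b⟩, ⟨h1, h2⟩, h3⟩

lemma add_lt_mul_of_lt {p M b s : ℕ} (hb : b < M) (hs : s < p) : p * b + s < p * M :=
  calc p * b + s < p * b + p := by omega
    _ = p * (b + 1) := by ring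
    _ ≤ p * M := Nat.mul_le_mul_left _ hb

lemma erasureSet_subset {p M T : ℕ} {σ : Fin T → Finset ℕ}
    (hσ : ∀ t, σ t ⊆ Finset.range p) : erasureSet p M T σ ⊆ Finset.range (p * M * T) := by
  intro k hk
  obtain ⟨t, s, hs, b, hb, rfl⟩ := mem_erasureSet.1 hk
  exact Finset.mem_range.2
    (add_lt_mul_of_lt t.2 (add_lt_mul_of_lt hb (Finset.mem_range.1 (hσ t hs))))

lemma card_erasureSet {p M T : ℕ} {σ : Fin T → Finset ℕ}
    (hσ : ∀ t, σ t ⊆ Finset.range p) : (erasureSet p M T σ).card = (∑ t, (σ t).card) * M := by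
  rw [erasureSet, Finset.card_image_of_injOn, Finset.card_product, Finset.card_sigma,
    Finset.card_range]
  rintro ⟨⟨t, s⟩, b⟩ h ⟨⟨t', s'⟩, b'⟩ h' he
  simp only [Finset.coe_product, Set.mem_prod, Finset.mem_coe, Finset.mem_sigma, Finset.mem_univ,
    true_and, Finset.mem_range] at h h'
  have hs := Finset.mem_range.1 (hσ t h.1)
  have hs' := Finset.mem_range.1 (hσ t' h'.1)
  have h1 := add_lt_mul_of_lt h.2 hs
  have h2 := add_lt_mul_of_lt h'.2 hs'
  obtain ⟨e1, e2⟩ := eq_and_eq_of_mul_add_eq h1 h2 he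
  obtain ⟨e3, e4⟩ := eq_and_eq_of_mul_add_eq hs hs' e2
  obtain rfl : t = t' := Fin.ext e1
  subst e3 e4
  rfl

/-- For a suitable block length `L`, a reception pattern of the block that does not determine the
`i`-th cycle misses one of a small number of large sets. -/
lemma exists_block_length {i : Fin J.μ} (hlam : J.firstEig i ≠ 0) {pe r : ℝ} (hpe : 0 ≤ pe)
    (hr : 1 ≤ r) (h : pe ^ J.minErasures C i * r ^ (2 * J.period i) < 1) :
    ∃ (L : ℕ) (𝓔 : Finset (Finset ℕ)) (e : ℕ), 0 < L ∧
      (∀ E ∈ 𝓔, E ⊆ Finset.range L ∧ e ≤ E.card) ∧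
      (𝓔.card : ℝ) * pe ^ e * r ^ (2 * L) < 1 ∧
      ∀ R ⊆ Finset.range L, (∀ E ∈ 𝓔, ¬ Disjoint E R) → J.Determines C i R := by
  classical
  set p := J.period i with hp
  set l := J.minErasures C i with hl
  have hp0 : 0 < p := J.period_pos i
  obtain ⟨N, M, hM, hNM⟩ := exists_block_parameters hpe hr h
  obtain ⟨T₀, hT₀⟩ := J.exists_proj_eq_zero_of_many_rich (C := C) hlam (Nat.mul_pos hp0 hM)
    (dvd_mul_right p M) (N := N + 1) (by omega)
  set T' := T₀ + 1 with hT'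
  set T := (N + 1) * T' with hT
  have hTpos : 0 < T := Nat.mul_pos (by omega) (by omega)
  -- A member of `𝓔` prescribes for each superblock the residues lost in all of its `M` periods.
  -- This leaves at most `(2 ^ p) ^ T` sets; `N * T'` superblocks losing `l` residues each account
  -- for the size required.
  set 𝓔 := ((Fintype.piFinset fun _ : Fin T => (Finset.range p).powerset).image
    (erasureSet p M T)).filter fun E => M * l * (N * T') ≤ E.card with h𝓔
  refine ⟨p * M * T, 𝓔, M * l * (N * T'), Nat.mul_pos (Nat.mul_pos hp0 hM) hTpos, ?_, ?_, ?_⟩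
  · intro E hE
    obtain ⟨h1, h2⟩ := Finset.mem_filter.1 hE
    obtain ⟨σ, hσ, rfl⟩ := Finset.mem_image.1 h1
    exact ⟨erasureSet_subset fun t => Finset.mem_powerset.1 (Fintype.mem_piFinset.1 hσ t), h2⟩
  · refine lt_of_le_of_lt ?_ (hNM T' (by omega))
    have hc : 𝓔.card ≤ (2 ^ p) ^ T := by
      refine (Finset.card_filter_le _ _).trans (Finset.card_image_le.trans ?_)
      rw [Fintype.card_piFinset_const, Finset.card_powerset, Finset.card_range]
    have hc' : (𝓔.card : ℝ) ≤ (2 ^ p) ^ T := by exact_mod_cast hc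
    gcongr
  · intro R hR hE x hx
    set Q : ℕ → Finset ℕ := fun t => (Finset.range (p * M)).filter fun k => p * M * t + k ∈ R with hQ
    set G := (Finset.range T).filter fun t => J.IsRich C i (Q t) with hG
    refine hT₀ T ?_ Q (fun t => Finset.filter_subset _ _) G (Finset.filter_subset _ _)
      (fun t ht => (Finset.mem_filter.1 ht).2) ?_ x fun t _ k hk => hx _ (Finset.mem_filter.1 hk).2
    · calc T₀ ≤ T' := by omega
        _ ≤ T := Nat.le_mul_of_pos_left _ (by omega)
    -- Otherwise fewer than `T'` of the `(N + 1) * T'` superblocks are rich, and each of the others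
    -- loses at least `l` residues.
    by_contra hcard
    have hGc : G.card < T' := by
      by_contra hge
      exact hcard (Nat.mul_le_mul_left _ (by omega))
    have hσ : ∀ t : Fin T, ∃ S ⊆ Finset.range p,
        ((t : ℕ) ∉ G → l ≤ S.card) ∧ ∀ s ∈ S, ∀ b, p * b + s ∉ Q t := by
      intro t
      by_cases ht : J.IsRich C i (Q t)
      · exact ⟨∅, by simp, fun h => absurd (Finset.mem_filter.2 ⟨Finset.mem_range.2 t.2, ht⟩) h,
          by simp⟩
      · obtain ⟨S, h1, h2, h3⟩ := J.exists_erased_residues hlam ht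
        exact ⟨S, h1, fun _ => h2, h3⟩
    choose σ hσ1 hσ2 hσ3 using hσ
    refine hE (erasureSet p M T σ) (Finset.mem_filter.2 ⟨Finset.mem_image.2 ⟨σ,
      Fintype.mem_piFinset.2 fun t => Finset.mem_powerset.2 (hσ1 t), rfl⟩, ?_⟩) ?_
    · rw [card_erasureSet hσ1]
      have h1 : l * (N * T') ≤ ∑ t, (σ t).card := by
        have hsum : ∑ t ∈ Finset.range T, (if t ∈ G then 0 else l) ≤ ∑ t, (σ t).card := by
          rw [← Fin.sum_univ_eq_sum_range (fun t => if t ∈ G then 0 else l) T]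
          refine Finset.sum_le_sum fun t _ => ?_
          split_ifs with ht
          · exact Nat.zero_le _
          · exact hσ2 t ht
        refine le_trans ?_ hsum
        rw [Finset.sum_ite, Finset.sum_const_zero, zero_add, Finset.sum_const, smul_eq_mul,
          mul_comm]
        refine Nat.mul_le_mul_right _ ?_
        have h2 := Finset.card_sdiff_add_card_eq_card
          (show G ⊆ Finset.range T from Finset.filter_subset _ _)
        rw [Finset.card_range] at h2
        have h3 : (Finset.range T).filter (fun t => t ∉ G) = Finset.range T \ G := by
          ext t; simp
        rw [h3]
        have h4 : T = N * T' + T' := by rw [hT]; ring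
        omega
      calc M * l * (N * T') = l * (N * T') * M := by ring
        _ ≤ _ := Nat.mul_le_mul_right _ h1
    · rw [Finset.disjoint_left]
      intro k hk hkR
      obtain ⟨t, s, hs, b, hb, rfl⟩ := mem_erasureSet.1 hk
      exact hσ3 t s hs b (Finset.mem_filter.2 ⟨Finset.mem_range.2
        (add_lt_mul_of_lt hb (Finset.mem_range.1 (hσ1 t hs))), hkR⟩)

end JordanCycleForm

end IntermittentKalman

namespace IntermittentKalman

/-! ### The primitive random variables -/

/-- The labels of the Gaussian primitive random variables. -/
def noiseSources : Set Source := {s | ∀ k, s ≠ Source.channel k}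

section

variable {Ω : Type*} {m g q : ℕ} (x₀ : Ω → Fin m → ℂ) (w : ℕ → Ω → Fin g → ℂ)
  (v : ℕ → Ω → Fin q → ℂ) (β : ℕ → Ω → Bool)

/-- The σ-algebra generated by the Gaussian primitive random variables. -/
@[reducible] noncomputable def noiseSigma : MeasurableSpace Ω :=
  ⨆ s ∈ noiseSources, sourceSigma x₀ w v β s

/-- The σ-algebra generated by the channel variables. -/
@[reducible] noncomputable def channelSigma : MeasurableSpace Ω :=
  ⨆ s ∈ Set.range Source.channel, sourceSigma x₀ w v β s

lemma sourceSigma_le_noiseSigma {s : Source} (hs : s ∈ noiseSources) :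
    sourceSigma x₀ w v β s ≤ noiseSigma x₀ w v β :=
  le_iSup₂ (f := fun s (_ : s ∈ noiseSources) => sourceSigma x₀ w v β s) s hs

lemma measurable_init_noiseSigma : Measurable[noiseSigma x₀ w v β] x₀ :=
  (comap_measurable x₀).mono
    (sourceSigma_le_noiseSigma x₀ w v β (s := .init) (by simp [noiseSources])) le_rfl

lemma measurable_disturbance_noiseSigma (n : ℕ) : Measurable[noiseSigma x₀ w v β] (w n) :=
  (comap_measurable (w n)).mono
    (sourceSigma_le_noiseSigma x₀ w v β (s := .disturbance n) (by simp [noiseSources])) le_rfl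

lemma measurable_noise_noiseSigma (n : ℕ) : Measurable[noiseSigma x₀ w v β] (v n) :=
  (comap_measurable (v n)).mono
    (sourceSigma_le_noiseSigma x₀ w v β (s := .noise n) (by simp [noiseSources])) le_rfl

lemma measurable_channel_channelSigma (n : ℕ) : Measurable[channelSigma x₀ w v β] (β n) :=
  (comap_measurable (β n)).mono
    (le_iSup₂ (f := fun s (_ : s ∈ Set.range Source.channel) => sourceSigma x₀ w v β s)
      (Source.channel n) ⟨n, rfl⟩) le_rfl

end

lemma measurable_mulVec {r s : ℕ} (M : Matrix (Fin r) (Fin s) ℂ) :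
    Measurable fun x : Fin s → ℂ => M.mulVec x :=
  (Continuous.matrix_mulVec continuous_const continuous_id).measurable

lemma measurable_state {Ω : Type*} [MeasurableSpace Ω] {m g : ℕ} {A : Matrix (Fin m) (Fin m) ℂ}
    {B : Matrix (Fin m) (Fin g) ℂ} {x₀ : Ω → Fin m → ℂ} {w : ℕ → Ω → Fin g → ℂ}
    (hx₀ : Measurable x₀) (hw : ∀ n, Measurable (w n)) (n : ℕ) :
    Measurable (state A B x₀ w n) := by
  induction n with
  | zero => exact hx₀
  | succ n ih => exact ((measurable_mulVec A).comp ih).add ((measurable_mulVec B).comp (hw n))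

lemma measurable_state_noiseSigma {Ω : Type*} {m g q : ℕ} (A : Matrix (Fin m) (Fin m) ℂ)
    (B : Matrix (Fin m) (Fin g) ℂ) (x₀ : Ω → Fin m → ℂ) (w : ℕ → Ω → Fin g → ℂ)
    (v : ℕ → Ω → Fin q → ℂ) (β : ℕ → Ω → Bool) (n : ℕ) :
    Measurable[noiseSigma x₀ w v β] (state A B x₀ w n) :=
  @measurable_state Ω (noiseSigma x₀ w v β) m g A B x₀ w
    (measurable_init_noiseSigma x₀ w v β) (measurable_disturbance_noiseSigma x₀ w v β) n

lemma lintegral_enorm_sq_eq {Ω E : Type*} [MeasurableSpace Ω] {P : Measure Ω}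
    [NormedAddCommGroup E] (f : Ω → E) : ∫⁻ ω, ‖f ω‖ₑ ^ 2 ∂P = eLpNorm f 2 P ^ 2 := by
  have := eLpNorm_nnreal_pow_eq_lintegral (f := f) (μ := P) (p := 2) (by norm_num)
  simpa using this.symm

/-- Only the diagonal of the matrix inequality is used; bounding the sup norm by the sum over the
coordinates costs the factor `k`. -/
lemma eLpNorm_le_of_posSemidef {Ω : Type*} [MeasurableSpace Ω] {P : Measure Ω} {k : ℕ}
    {X : Ω → Fin k → ℂ} (hX : IsCenteredGaussian P X) {σ : ℝ} (hσ : 0 < σ)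
    (h : ((σ ^ 2 : ℂ) • (1 : Matrix (Fin k) (Fin k) ℂ) - secondMoment P X).PosSemidef) :
    eLpNorm X 2 P ≤ ENNReal.ofReal (k * σ) := by
  have hcoord : ∀ a, eLpNorm (fun ω => X ω a) 2 P ≤ ENNReal.ofReal σ := by
    intro a
    have hmem : MemLp (fun ω => X ω a) 2 P :=
      (hX.gaussian.map_fun (ContinuousLinearMap.proj (R := ℝ) a)).memLp_two
    have h1 := h.diag_nonneg (i := a)
    simp only [Matrix.sub_apply, Matrix.smul_apply, Matrix.one_apply_eq, secondMoment,
      Matrix.of_apply] at h1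
    have h2 : ∀ ω, X ω a * star (X ω a) = ((‖X ω a‖ ^ 2 : ℝ) : ℂ) := fun ω => by
      rw [RCLike.star_def, Complex.mul_conj, Complex.normSq_eq_norm_sq]
    simp only [h2] at h1
    rw [integral_complex_ofReal] at h1
    have h3 : ∫ ω, ‖X ω a‖ ^ 2 ∂P ≤ σ ^ 2 := by
      have : (0 : ℂ) ≤ ((σ ^ 2 - ∫ ω, ‖X ω a‖ ^ 2 ∂P : ℝ) : ℂ) := by
        simpa using h1
      have := Complex.zero_le_real.1 this
      linarith
    rw [hmem.eLpNorm_eq_integral_rpow_norm (by norm_num) (by norm_num)]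
    refine ENNReal.ofReal_le_ofReal ?_
    simp only [ENNReal.toReal_ofNat, Real.rpow_ofNat]
    calc _ ≤ (σ ^ 2) ^ ((2 : ℝ)⁻¹) :=
          Real.rpow_le_rpow (integral_nonneg fun ω => by positivity) h3 (by norm_num)
      _ = σ := by
          rw [← Real.rpow_natCast, ← Real.rpow_mul hσ.le]; norm_num
  have hsum : eLpNorm X 2 P ≤ eLpNorm (∑ a, fun ω => ‖X ω a‖) 2 P := by
    refine eLpNorm_mono_real fun ω => ?_
    rw [Finset.sum_apply]
    exact (pi_norm_le_iff_of_nonneg (Finset.sum_nonneg fun _ _ => norm_nonneg _)).2 fun a =>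
      Finset.single_le_sum (f := fun a => ‖X ω a‖) (fun _ _ => norm_nonneg _) (Finset.mem_univ a)
  refine hsum.trans ((eLpNorm_sum_le (fun a _ => ?_) (by norm_num)).trans ?_)
  · exact (((measurable_pi_apply a).comp hX.measurable).norm).aestronglyMeasurable
  · calc _ ≤ ∑ _a : Fin k, ENNReal.ofReal σ :=
          Finset.sum_le_sum fun a _ => by rw [eLpNorm_norm]; exact hcoord a
      _ = _ := by
          rw [Finset.sum_const, Finset.card_univ, Fintype.card_fin, nsmul_eq_mul,
            ENNReal.ofReal_mul (by positivity), ENNReal.ofReal_natCast]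

namespace IsIntermittentSystem

variable {Ω : Type*} [MeasurableSpace Ω] {P : Measure Ω} {m g q : ℕ}
  {A : Matrix (Fin m) (Fin m) ℂ} {B : Matrix (Fin m) (Fin g) ℂ} {C : Matrix (Fin q) (Fin m) ℂ}
  {σ σ' pe : ℝ} {x₀ : Ω → Fin m → ℂ} {w : ℕ → Ω → Fin g → ℂ} {v : ℕ → Ω → Fin q → ℂ}
  {β : ℕ → Ω → Bool}

lemma sourceSigma_le (h : IsIntermittentSystem P A B C σ σ' pe x₀ w v β) (s : Source) :
    sourceSigma x₀ w v β s ≤ ‹MeasurableSpace Ω› := by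
  cases s with
  | init => exact h.gaussian_init.measurable.comap_le
  | disturbance n => exact (h.gaussian_disturbance n).measurable.comap_le
  | noise n => exact (h.gaussian_noise n).measurable.comap_le
  | channel n => exact (h.measurable_channel n).comap_le

lemma noiseSigma_le (h : IsIntermittentSystem P A B C σ σ' pe x₀ w v β) :
    noiseSigma x₀ w v β ≤ ‹MeasurableSpace Ω› :=
  iSup₂_le fun s _ => h.sourceSigma_le s

lemma channelSigma_le (h : IsIntermittentSystem P A B C σ σ' pe x₀ w v β) :
    channelSigma x₀ w v β ≤ ‹MeasurableSpace Ω› :=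
  iSup₂_le fun s _ => h.sourceSigma_le s

lemma indep_noise_channel (h : IsIntermittentSystem P A B C σ σ' pe x₀ w v β) :
    Indep (noiseSigma x₀ w v β) (channelSigma x₀ w v β) P := by
  refine indep_iSup_of_disjoint h.sourceSigma_le h.indep ?_
  rw [Set.disjoint_right]
  rintro s ⟨k, rfl⟩ hs
  exact hs k rfl

lemma measure_erased (h : IsIntermittentSystem P A B C σ σ' pe x₀ w v β) (E : Finset ℕ) :
    P {ω | ∀ k ∈ E, β k ω = false} = ENNReal.ofReal pe ^ E.card := by
  classical
  have hinj : Function.Injective Source.channel := fun a b hab => by injection hab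
  have h1 := h.indep.meas_biInter (S := E.map ⟨Source.channel, hinj⟩)
    (s := fun s => match s with
      | .channel k => {ω | β k ω = false}
      | _ => Set.univ) (by
      intro s hs
      obtain ⟨k, _, rfl⟩ := Finset.mem_map.1 hs
      exact ⟨{false}, measurableSet_singleton _, rfl⟩)
  rw [Finset.prod_map] at h1
  simp only [Function.Embedding.coeFn_mk, h.erasure, Finset.prod_const] at h1
  rw [← h1]
  congr 1
  ext ω
  simp

lemma measurable_state (h : IsIntermittentSystem P A B C σ σ' pe x₀ w v β) (n : ℕ) :
    Measurable (state A B x₀ w n) :=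
  IntermittentKalman.measurable_state h.gaussian_init.measurable
    (fun n => (h.gaussian_disturbance n).measurable) n

end IsIntermittentSystem

end IntermittentKalman

/-! ### Probabilities of bad blocks and moments of the states -/

namespace IntermittentKalman

lemma exists_norm_mulVec_le {r s : ℕ} (M : Matrix (Fin r) (Fin s) ℂ) :
    ∃ c : ℝ, 0 ≤ c ∧ ∀ x, ‖M.mulVec x‖ ≤ c * ‖x‖ :=
  ⟨‖(Matrix.mulVecLin M).toContinuousLinearMap‖, norm_nonneg _,
    fun x => (Matrix.mulVecLin M).toContinuousLinearMap.le_opNorm x⟩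

/-- Invert `f` on its range and extend to `W`; the choice of preimage does not matter because of the
inclusion of kernels. -/
lemma exists_linearMap_comp_eq {K V V' W : Type*} [Field K] [AddCommGroup V] [Module K V]
    [AddCommGroup V'] [Module K V'] [AddCommGroup W] [Module K W] (f : V →ₗ[K] W) (g : V →ₗ[K] V')
    (h : LinearMap.ker f ≤ LinearMap.ker g) : ∃ k : W →ₗ[K] V', ∀ x, k (f x) = g x := by
  obtain ⟨s, hs⟩ := f.rangeRestrict.exists_rightInverse_of_surjective f.range_rangeRestrict
  obtain ⟨k, hk⟩ := LinearMap.exists_extend (g ∘ₗ s)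
  refine ⟨k, fun x => ?_⟩
  have h1 : k (f x) = g (s (f.rangeRestrict x)) := LinearMap.congr_fun hk (f.rangeRestrict x)
  have h2 : f (s (f.rangeRestrict x)) = f x :=
    congrArg Subtype.val (LinearMap.congr_fun hs (f.rangeRestrict x))
  rw [h1, ← sub_eq_zero, ← map_sub]
  exact h (by rw [LinearMap.mem_ker, map_sub, h2, sub_self])

/-- The part of the state at time `t + D` that is due to the disturbances after time `t`. -/
lemma state_sub_pow_succ {Ω : Type*} {m g : ℕ} {A : Matrix (Fin m) (Fin m) ℂ}
    {B : Matrix (Fin m) (Fin g) ℂ} {x₀ : Ω → Fin m → ℂ} {w : ℕ → Ω → Fin g → ℂ} (t D : ℕ) (ω : Ω) :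
    state A B x₀ w (t + (D + 1)) ω - (A ^ (D + 1)).mulVec (state A B x₀ w t ω) =
      A.mulVec (state A B x₀ w (t + D) ω - (A ^ D).mulVec (state A B x₀ w t ω)) +
        B.mulVec (w (t + D) ω) := by
  rw [Matrix.mulVec_sub, Matrix.mulVec_mulVec, ← pow_succ', ← add_assoc]
  simp only [state]
  abel

namespace IsIntermittentSystem

variable {Ω : Type*} [MeasurableSpace Ω] {P : Measure Ω} {m g q : ℕ}
  {A : Matrix (Fin m) (Fin m) ℂ} {B : Matrix (Fin m) (Fin g) ℂ} {C : Matrix (Fin q) (Fin m) ℂ}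
  {σ σ' pe : ℝ} {x₀ : Ω → Fin m → ℂ} {w : ℕ → Ω → Fin g → ℂ} {v : ℕ → Ω → Fin q → ℂ}
  {β : ℕ → Ω → Bool}

/-- If each pattern of a family of bad block patterns misses one of the sets in `𝓔`, then the
probability that the last `j` blocks before time `n` are bad decays geometrically in `j`. -/
lemma measure_blocks_bad_le (h : IsIntermittentSystem P A B C σ σ' pe x₀ w v β) {L e : ℕ}
    {𝓔 : Finset (Finset ℕ)} (hE : ∀ E ∈ 𝓔, E ⊆ Finset.range L ∧ e ≤ E.card) {n j : ℕ}
    (hj : j * L ≤ n + 1) :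
    P {ω | ∀ i < j, ∃ E ∈ 𝓔, ∀ k ∈ E, β (n + 1 - (i + 1) * L + k) ω = false} ≤
      ENNReal.ofReal (((𝓔.card : ℝ) * pe ^ e) ^ j) := by
  classical
  -- Union bound over the choice `Φ` of a missed set in each block. The blocks are disjoint, so
  -- every choice prescribes at least `e * j` erasures.
  have hsub : {ω | ∀ i < j, ∃ E ∈ 𝓔, ∀ k ∈ E, β (n + 1 - (i + 1) * L + k) ω = false} ⊆
      ⋃ Φ ∈ Fintype.piFinset (fun _ : Fin j => 𝓔),
        {ω | ∀ k ∈ (Finset.univ.sigma Φ).image fun x => n + 1 - (x.1 + 1) * L + x.2,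
          β k ω = false} := by
    intro ω hω
    choose! E hE1 hE2 using hω
    simp only [Set.mem_iUnion]
    refine ⟨fun i => E i, Fintype.mem_piFinset.2 fun i => hE1 i i.2, fun k hk => ?_⟩
    obtain ⟨⟨i, s⟩, hs, rfl⟩ := Finset.mem_image.1 hk
    exact hE2 i i.2 s (Finset.mem_sigma.1 hs).2
  have hpe0 := h.pe_nonneg
  have hone : ∀ Φ ∈ Fintype.piFinset (fun _ : Fin j => 𝓔),
      P {ω | ∀ k ∈ (Finset.univ.sigma Φ).image fun x => n + 1 - (x.1 + 1) * L + x.2,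
          β k ω = false} ≤ ENNReal.ofReal ((pe ^ e) ^ j) := by
    intro Φ hΦ
    have hΦ' := Fintype.mem_piFinset.1 hΦ
    rw [h.measure_erased, ← ENNReal.ofReal_pow hpe0]
    refine ENNReal.ofReal_le_ofReal ?_
    rw [← pow_mul]
    refine pow_le_pow_of_le_one hpe0 h.pe_le_one ?_
    rw [Finset.card_image_of_injOn, Finset.card_sigma]
    · calc e * j = ∑ _i : Fin j, e := by simp [mul_comm]
        _ ≤ _ := Finset.sum_le_sum fun i _ => (hE _ (hΦ' i)).2
    · rintro ⟨i, s⟩ hs ⟨i', s'⟩ hs' he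
      have h1 := Finset.mem_range.1 ((hE _ (hΦ' i)).1 (Finset.mem_sigma.1 hs).2)
      have h2 := Finset.mem_range.1 ((hE _ (hΦ' i')).1 (Finset.mem_sigma.1 hs').2)
      have h3 : (i + 1) * L ≤ j * L := Nat.mul_le_mul_right _ i.2
      have h4 : (i' + 1) * L ≤ j * L := Nat.mul_le_mul_right _ i'.2
      have h5 : ((i : ℕ) + 1) * L = L * i + L := by ring
      have h6 : ((i' : ℕ) + 1) * L = L * i' + L := by ring
      simp only at he h1 h2
      -- Counted backwards from `n`, the time with offset `s` in block `i` is `L * i + (L - 1 - s)`,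
      -- a division with remainder by `L`.
      obtain ⟨e1, e2⟩ := eq_and_eq_of_mul_add_eq (c := L) (x := i) (y := i') (u := L - 1 - s)
        (v := L - 1 - s') (by omega) (by omega) (by omega)
      obtain rfl : i = i' := Fin.ext e1
      obtain rfl : s = s' := by omega
      rfl
  calc _ ≤ _ := measure_mono hsub
    _ ≤ ∑ Φ ∈ Fintype.piFinset (fun _ : Fin j => 𝓔), _ := measure_biUnion_finset_le _ _
    _ ≤ ∑ Φ ∈ Fintype.piFinset (fun _ : Fin j => 𝓔), ENNReal.ofReal ((pe ^ e) ^ j) :=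
        Finset.sum_le_sum hone
    _ = _ := by
        rw [Finset.sum_const, Fintype.card_piFinset_const, nsmul_eq_mul, mul_pow,
          ENNReal.ofReal_mul (by positivity)]
        congr 1
        rw [← Nat.cast_pow, ENNReal.ofReal_natCast]

lemma exists_eLpNorm_disturbance_le (h : IsIntermittentSystem P A B C σ σ' pe x₀ w v β)
    (hσ : 0 < σ) : ∃ b : ℝ, 0 ≤ b ∧
      ∀ n, eLpNorm (fun ω => B.mulVec (w n ω)) 2 P ≤ ENNReal.ofReal b := by
  obtain ⟨c, hc, hcB⟩ := exists_norm_mulVec_le B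
  refine ⟨c * (g * σ), by positivity, fun n => ?_⟩
  rw [ENNReal.ofReal_mul hc]
  exact (eLpNorm_le_mul_eLpNorm_of_ae_le_mul (Filter.Eventually.of_forall fun ω => hcB _) 2).trans
    (mul_le_mul_right (eLpNorm_le_of_posSemidef (h.gaussian_disturbance n) hσ
      (h.upper_disturbance n)) _)

lemma measurable_state_sub (h : IsIntermittentSystem P A B C σ σ' pe x₀ w v β) (t D : ℕ) :
    Measurable fun ω => state A B x₀ w (t + D) ω - (A ^ D).mulVec (state A B x₀ w t ω) :=
  (h.measurable_state _).sub ((measurable_mulVec _).comp (h.measurable_state _))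

/-- The bound may depend on `D` but not on `t`; it serves for the innovations inside one block,
where `D < L`. -/
lemma exists_eLpNorm_state_sub_le (h : IsIntermittentSystem P A B C σ σ' pe x₀ w v β)
    (hσ : 0 < σ) (D : ℕ) : ∃ b : ℝ, 0 ≤ b ∧ ∀ t,
      eLpNorm (fun ω => state A B x₀ w (t + D) ω - (A ^ D).mulVec (state A B x₀ w t ω)) 2 P ≤
        ENNReal.ofReal b := by
  obtain ⟨b₀, hb₀, hB⟩ := h.exists_eLpNorm_disturbance_le hσ
  obtain ⟨c, hc, hcA⟩ := exists_norm_mulVec_le A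
  induction D with
  | zero => exact ⟨0, le_rfl, fun t => by simp⟩
  | succ D ih =>
    obtain ⟨b, hb, ih⟩ := ih
    refine ⟨c * b + b₀, by positivity, fun t => ?_⟩
    simp only [state_sub_pow_succ]
    rw [ENNReal.ofReal_add (by positivity) hb₀, ENNReal.ofReal_mul hc]
    refine (eLpNorm_add_le ?_ ?_ (by norm_num)).trans (add_le_add ?_ (hB _))
    · exact ((measurable_mulVec A).comp (h.measurable_state_sub t D)).aestronglyMeasurable
    · exact ((measurable_mulVec B).comp (h.gaussian_disturbance _).measurable).aestronglyMeasurable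
    · exact (eLpNorm_le_mul_eLpNorm_of_ae_le_mul
        (Filter.Eventually.of_forall fun ω => hcA _) 2).trans (mul_le_mul_right (ih t) _)

/-- The extra power `k` is for the induction: peeling off the latest disturbance leaves the earlier
ones multiplied by one more factor `A`. -/
lemma eLpNorm_proj_state_sub_le (h : IsIntermittentSystem P A B C σ σ' pe x₀ w v β)
    (J : JordanCycleForm A) (i : Fin J.μ) {b c r : ℝ} (hc : 0 ≤ c) (hr : 0 ≤ r) (hb : 0 ≤ b)
    (hB : ∀ n, eLpNorm (fun ω => B.mulVec (w n ω)) 2 P ≤ ENNReal.ofReal b)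
    (hcr : ∀ n x, ‖(J.proj i).mulVec ((A ^ n).mulVec x)‖ ≤ c * r ^ n * ‖x‖) (t D : ℕ) :
    ∀ k, eLpNorm (fun ω => (J.proj i).mulVec ((A ^ k).mulVec
        (state A B x₀ w (t + D) ω - (A ^ D).mulVec (state A B x₀ w t ω)))) 2 P ≤
      ENNReal.ofReal (c * b * ∑ s ∈ Finset.range D, r ^ (k + s)) := by
  induction D with
  | zero => intro k; simp
  | succ D ih =>
    intro k
    simp only [state_sub_pow_succ, Matrix.mulVec_add]
    rw [Finset.sum_range_succ', mul_add, ENNReal.ofReal_add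
      (mul_nonneg (by positivity) (Finset.sum_nonneg fun _ _ => by positivity)) (by positivity)]
    refine (eLpNorm_add_le ?_ ?_ (by norm_num)).trans (add_le_add ?_ ?_)
    · exact ((measurable_mulVec _).comp ((measurable_mulVec _).comp ((measurable_mulVec A).comp
        (h.measurable_state_sub t D)))).aestronglyMeasurable
    · exact ((measurable_mulVec _).comp ((measurable_mulVec _).comp ((measurable_mulVec B).comp
        (h.gaussian_disturbance _).measurable))).aestronglyMeasurable
    · have := ih (k + 1)
      simp only [pow_succ A k, ← Matrix.mulVec_mulVec] at this
      simpa only [add_assoc, add_comm 1] using this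
    · rw [show c * b * r ^ (k + 0) = c * r ^ k * b by ring, ENNReal.ofReal_mul (by positivity)]
      exact (eLpNorm_le_mul_eLpNorm_of_ae_le_mul
        (Filter.Eventually.of_forall fun ω => hcr k _) 2).trans (mul_le_mul_right (hB _) _)

lemma eLpNorm_proj_state_le (h : IsIntermittentSystem P A B C σ σ' pe x₀ w v β) (hσ : 0 < σ)
    (J : JordanCycleForm A) (i : Fin J.μ) {b c r : ℝ} (hc : 0 ≤ c) (hr : 0 ≤ r) (hb : 0 ≤ b)
    (hB : ∀ n, eLpNorm (fun ω => B.mulVec (w n ω)) 2 P ≤ ENNReal.ofReal b)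
    (hcr : ∀ n x, ‖(J.proj i).mulVec ((A ^ n).mulVec x)‖ ≤ c * r ^ n * ‖x‖) (n : ℕ) :
    eLpNorm (fun ω => (J.proj i).mulVec (state A B x₀ w n ω)) 2 P ≤
      ENNReal.ofReal (c * b * ∑ s ∈ Finset.range n, r ^ s + c * r ^ n * (m * σ)) := by
  have h1 := h.eLpNorm_proj_state_sub_le J i hc hr hb hB hcr 0 n 0
  have hdec : (fun ω => (J.proj i).mulVec (state A B x₀ w n ω)) =
      (fun ω => (J.proj i).mulVec ((A ^ 0).mulVec
        (state A B x₀ w (0 + n) ω - (A ^ n).mulVec (state A B x₀ w 0 ω)))) +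
      fun ω => (J.proj i).mulVec ((A ^ n).mulVec (x₀ ω)) := by
    ext1 ω
    simp [state, Matrix.mulVec_sub]
  rw [hdec, ENNReal.ofReal_add
    (mul_nonneg (by positivity) (Finset.sum_nonneg fun _ _ => by positivity)) (by positivity)]
  refine (eLpNorm_add_le ?_ ?_ (by norm_num)).trans (add_le_add (by simpa using h1) ?_)
  · exact ((measurable_mulVec _).comp ((measurable_mulVec _).comp
      (h.measurable_state_sub 0 n))).aestronglyMeasurable
  · exact ((measurable_mulVec _).comp ((measurable_mulVec _).comp
      h.gaussian_init.measurable)).aestronglyMeasurable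
  · rw [ENNReal.ofReal_mul (by positivity)]
    exact (eLpNorm_le_mul_eLpNorm_of_ae_le_mul
        (Filter.Eventually.of_forall fun ω => hcr n _) 2).trans
        (mul_le_mul_right (eLpNorm_le_of_posSemidef h.gaussian_init hσ h.upper_init) _)

/-- The component of a stable cycle has bounded second moments. -/
lemma exists_bound_of_stable (h : IsIntermittentSystem P A B C σ σ' pe x₀ w v β) (hσ : 0 < σ)
    (J : JordanCycleForm A) (i : Fin J.μ) (hlam : ‖J.firstEig i‖ < 1) : ∃ M : ℝ,
      ∀ n, ∫⁻ ω, ‖(J.proj i).mulVec (state A B x₀ w n ω)‖ₑ ^ 2 ∂P ≤ ENNReal.ofReal M := by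
  obtain ⟨r, hr, hr1⟩ := exists_between hlam
  have hr0 : 0 ≤ r := (norm_nonneg _).trans hr.le
  obtain ⟨c, hc, hcr⟩ := J.exists_norm_proj_pow_le i hr
  obtain ⟨b, hb, hB⟩ := h.exists_eLpNorm_disturbance_le hσ
  refine ⟨(c * b * (1 / (1 - r)) + c * (m * σ)) ^ 2, fun n => ?_⟩
  have h1r : 0 < 1 - r := by linarith
  rw [lintegral_enorm_sq_eq, ENNReal.ofReal_pow (by positivity)]
  gcongr
  refine (h.eLpNorm_proj_state_le hσ J i hc hr0 hb hB hcr n).trans (ENNReal.ofReal_le_ofReal ?_)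
  have h2 : ∑ s ∈ Finset.range n, r ^ s ≤ 1 / (1 - r) := by
    rw [le_div_iff₀ h1r, ← neg_sub r 1, mul_neg, geom_sum_mul]
    have := pow_nonneg hr0 n
    linarith
  have h3 : c * r ^ n * (m * σ) ≤ c * (m * σ) := by
    have := pow_le_one₀ hr0 hr1.le (n := n)
    calc c * r ^ n * (m * σ) ≤ c * 1 * (m * σ) := by gcongr
      _ = _ := by ring
  have := mul_le_mul_of_nonneg_left h2 (show 0 ≤ c * b by positivity)
  linarith

end IsIntermittentSystem

end IntermittentKalman

/-! ### The block estimator -/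

namespace IntermittentKalman

/-- Extension of a finite sequence by a constant. -/
def extendBy {α : Type*} {n : ℕ} (d : α) (y : Fin n → α) (k : ℕ) : α :=
  if h : k < n then y ⟨k, h⟩ else d

/-- The times of the block `[t, t + L)` at which a packet is received, counted from `t`. -/
def received (b : ℕ → Bool) (t L : ℕ) : Finset ℕ :=
  (Finset.range L).filter fun k => b (t + k) = true

/-- An estimator sees `y` but not `β`, so the reception pattern is read off as the set of times with
nonzero output. There are finitely many patterns, and measurability for each of them is enough. -/
lemma measurable_of_pattern {n q m : ℕ}
    (F : (Fin (n + 1) → Bool) → (Fin (n + 1) → Fin q → ℂ) → Fin m → ℂ)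
    (hF : ∀ b, Measurable (F b)) :
    Measurable fun y : Fin (n + 1) → Fin q → ℂ => F (fun k => if y k = 0 then false else true) y := by
  have h1 : Measurable fun z : (Fin (n + 1) → Bool) × (Fin (n + 1) → Fin q → ℂ) => F z.1 z.2 :=
    measurable_from_prod_countable_right hF
  refine h1.comp (Measurable.prodMk (measurable_pi_lambda _ fun k => ?_) measurable_id)
  exact Measurable.ite (measurableSet_eq_fun (measurable_pi_apply k) measurable_const)
    measurable_const measurable_const

namespace JordanCycleForm

variable {m q : ℕ} {A : Matrix (Fin m) (Fin m) ℂ} (J : JordanCycleForm A)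

lemma proj_proj (i : Fin J.μ) (x : Fin m → ℂ) :
    (J.proj i).mulVec ((J.proj i).mulVec x) = (J.proj i).mulVec x := by
  refine J.ext_coord fun k a => ?_
  simp only [coord_proj]
  split_ifs <;> rfl

/-- A bounded family of linear maps reconstructing the `i`-th component of the state at the
beginning of a block from the outputs received in the block. -/
lemma exists_reconstruction (C : Matrix (Fin q) (Fin m) ℂ) (i : Fin J.μ) (L : ℕ) :
    ∃ (K : Finset ℕ → (Fin L → Fin q → ℂ) → Fin m → ℂ) (κ : ℝ), 0 ≤ κ ∧
      (∀ R, Measurable (K R)) ∧ (∀ R y z, K R (y + z) = K R y + K R z) ∧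
      (∀ R y, (J.proj i).mulVec (K R y) = K R y) ∧
      (∀ R ⊆ Finset.range L, ∀ y, ‖K R y‖ ≤ κ * ‖y‖) ∧
      ∀ R ⊆ Finset.range L, J.Determines C i R → ∀ x,
        K R (fun k => if (k : ℕ) ∈ R then C.mulVec ((A ^ (k : ℕ)).mulVec x) else 0) =
          (J.proj i).mulVec x := by
  classical
  have hex : ∀ R : Finset ℕ, ∃ K : (Fin L → Fin q → ℂ) →ₗ[ℂ] (Fin m → ℂ),
      (∀ y, (J.proj i).mulVec (K y) = K y) ∧ (R ⊆ Finset.range L → J.Determines C i R → ∀ x,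
        K (fun k => if (k : ℕ) ∈ R then C.mulVec ((A ^ (k : ℕ)).mulVec x) else 0) =
          (J.proj i).mulVec x) := by
    intro R
    by_cases hR : R ⊆ Finset.range L ∧ J.Determines C i R
    swap
    · exact ⟨0, fun y => by simp, fun h1 h2 => absurd ⟨h1, h2⟩ hR⟩
    let f : (Fin m → ℂ) →ₗ[ℂ] (Fin L → Fin q → ℂ) := LinearMap.pi fun k =>
      if (k : ℕ) ∈ R then C.mulVecLin ∘ₗ (A ^ (k : ℕ)).mulVecLin else 0
    have hf : ∀ x, f x = fun k : Fin L =>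
        if (k : ℕ) ∈ R then C.mulVec ((A ^ (k : ℕ)).mulVec x) else 0 := by
      intro x
      ext1 k
      simp only [f, LinearMap.pi_apply]
      split_ifs <;> simp
    -- That `R` determines the component means `ker f ≤ ker (proj i)`, so the projection factors
    -- through the received outputs.
    obtain ⟨K, hK⟩ := exists_linearMap_comp_eq f (J.proj i).mulVecLin (by
      intro x hx
      refine hR.2 x fun k hk => ?_
      have h1 := congrFun (hf x) ⟨k, Finset.mem_range.1 (hR.1 hk)⟩
      rw [LinearMap.mem_ker.1 hx] at h1
      simpa [hk] using h1.symm)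
    -- Projecting once more keeps the reconstruction of noisy outputs in the `i`-th component, where
    -- powers of `A` grow at the rate of that cycle.
    refine ⟨(J.proj i).mulVecLin ∘ₗ K, fun y => ?_, fun _ _ x => ?_⟩
    · simp only [LinearMap.comp_apply, Matrix.mulVecLin_apply, proj_proj]
    · rw [← hf, LinearMap.comp_apply, hK, Matrix.mulVecLin_apply, Matrix.mulVecLin_apply, proj_proj]
  choose K hK1 hK2 using hex
  -- There are finitely many patterns in a block, so the sum of the operator norms is a bound that
  -- serves all of them.
  refine ⟨fun R y => K R y, ∑ R ∈ (Finset.range L).powerset, ‖(K R).toContinuousLinearMap‖,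
    Finset.sum_nonneg fun _ _ => norm_nonneg _,
    fun R => (K R).toContinuousLinearMap.continuous.measurable, fun R y z => map_add _ _ _, hK1,
    fun R hR y => ?_, hK2⟩
  refine ((K R).toContinuousLinearMap.le_opNorm y).trans ?_
  exact mul_le_mul_of_nonneg_right (Finset.single_le_sum
    (f := fun R => ‖(K R).toContinuousLinearMap‖) (fun _ _ => norm_nonneg _)
    (Finset.mem_powerset.2 hR)) (norm_nonneg _)

open Classical in
/-- The estimator of the `i`-th component of the state at time `n` from the most recent block of
length `L` that determines this component. -/
noncomputable def blockEstimator (C : Matrix (Fin q) (Fin m) ℂ) (i : Fin J.μ) (L n : ℕ)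
    (K : Finset ℕ → (Fin L → Fin q → ℂ) → Fin m → ℂ) (b : ℕ → Bool) (y : ℕ → Fin q → ℂ) :
    Fin m → ℂ :=
  if h : ∃ j, (j + 1) * L ≤ n + 1 ∧
      J.Determines C i (received b (n + 1 - (j + 1) * L) L) then
    (A ^ ((Nat.find h + 1) * L - 1)).mulVec
      (K (received b (n + 1 - (Nat.find h + 1) * L) L)
        fun k => y (n + 1 - (Nat.find h + 1) * L + k))
  else 0

lemma measurable_blockEstimator (C : Matrix (Fin q) (Fin m) ℂ) (i : Fin J.μ) (L n : ℕ)
    {K : Finset ℕ → (Fin L → Fin q → ℂ) → Fin m → ℂ} (hK : ∀ R, Measurable (K R)) :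
    Measurable fun y : Fin (n + 1) → Fin q → ℂ => J.blockEstimator C i L n K
      (extendBy false fun k => if y k = 0 then false else true) (extendBy 0 y) := by
  refine measurable_of_pattern (fun b y => J.blockEstimator C i L n K (extendBy false b)
    (extendBy 0 y)) fun b => ?_
  unfold blockEstimator
  split_ifs with h
  · refine (measurable_mulVec _).comp ((hK _).comp (measurable_pi_lambda _ fun k => ?_))
    unfold extendBy
    split_ifs with h2
    · exact measurable_pi_apply _
    · exact measurable_const
  · exact measurable_const

variable {Ω : Type*} {g : ℕ} {B : Matrix (Fin m) (Fin g) ℂ} {C : Matrix (Fin q) (Fin m) ℂ}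
  {x₀ : Ω → Fin m → ℂ} {w : ℕ → Ω → Fin g → ℂ} {v : ℕ → Ω → Fin q → ℂ} {β : ℕ → Ω → Bool}

/-- The difference between an output and its prediction from the state at time `t`. -/
def innovation (A : Matrix (Fin m) (Fin m) ℂ) (B : Matrix (Fin m) (Fin g) ℂ)
    (C : Matrix (Fin q) (Fin m) ℂ) (x₀ : Ω → Fin m → ℂ) (w : ℕ → Ω → Fin g → ℂ)
    (v : ℕ → Ω → Fin q → ℂ) (t k : ℕ) (ω : Ω) : Fin q → ℂ :=
  v (t + k) ω + C.mulVec (state A B x₀ w (t + k) ω - (A ^ k).mulVec (state A B x₀ w t ω))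

/-- Error of the reconstruction from a block that determines the `i`-th component. -/
lemma norm_proj_sub_reconstruction_le {i : Fin J.μ} {L : ℕ}
    {K : Finset ℕ → (Fin L → Fin q → ℂ) → Fin m → ℂ} {κ c r : ℝ} (hκ : 0 ≤ κ) (hc : 0 ≤ c)
    (hr : 0 ≤ r) (hcr : ∀ n x, ‖(J.proj i).mulVec ((A ^ n).mulVec x)‖ ≤ c * r ^ n * ‖x‖)
    (hadd : ∀ R y z, K R (y + z) = K R y + K R z)
    (hproj : ∀ R y, (J.proj i).mulVec (K R y) = K R y)
    (hbound : ∀ R ⊆ Finset.range L, ∀ y, ‖K R y‖ ≤ κ * ‖y‖)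
    (hrec : ∀ R ⊆ Finset.range L, J.Determines C i R → ∀ x,
        K R (fun k => if (k : ℕ) ∈ R then C.mulVec ((A ^ (k : ℕ)).mulVec x) else 0) =
          (J.proj i).mulVec x)
    (t D : ℕ) (ω : Ω) (hdet : J.Determines C i (received (fun k => β k ω) t L)) :
    ‖(J.proj i).mulVec (state A B x₀ w (t + D) ω) - (A ^ D).mulVec
        (K (received (fun k => β k ω) t L)
          fun k => observation C (state A B x₀ w) v β (t + k) ω)‖ ≤
      ‖(J.proj i).mulVec (state A B x₀ w (t + D) ω - (A ^ D).mulVec (state A B x₀ w t ω))‖ +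
        c * r ^ D * (κ * ∑ k ∈ Finset.range L, ‖innovation A B C x₀ w v t k ω‖) := by
  set R := received (fun k => β k ω) t L with hR
  have hRL : R ⊆ Finset.range L := Finset.filter_subset _ _
  set z : Fin L → Fin q → ℂ := fun k =>
    if (k : ℕ) ∈ R then innovation A B C x₀ w v t k ω else 0 with hz
  have hsplit : (fun k : Fin L => observation C (state A B x₀ w) v β (t + k) ω) =
      (fun k : Fin L => if (k : ℕ) ∈ R then
        C.mulVec ((A ^ (k : ℕ)).mulVec (state A B x₀ w t ω)) else 0) + z := by
    ext1 k
    have hmem : (k : ℕ) ∈ R ↔ β (t + k) ω = true := by simp [hR, received]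
    simp only [Pi.add_apply, hz, observation, innovation]
    by_cases hk : (k : ℕ) ∈ R
    · rw [if_pos hk, if_pos hk, if_pos (hmem.1 hk), Matrix.mulVec_sub]; abel
    · rw [if_neg hk, if_neg hk, if_neg (fun h => hk (hmem.2 h)), add_zero]
  have hznorm : ‖z‖ ≤ ∑ k ∈ Finset.range L, ‖innovation A B C x₀ w v t k ω‖ := by
    refine (pi_norm_le_iff_of_nonneg (Finset.sum_nonneg fun _ _ => norm_nonneg _)).2 fun k => ?_
    have h1 := Finset.single_le_sum (f := fun k => ‖innovation A B C x₀ w v t k ω‖)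
      (fun _ _ => norm_nonneg _) (Finset.mem_range.2 k.2)
    simp only [hz]
    split_ifs
    · exact h1
    · rw [norm_zero]; exact Finset.sum_nonneg fun _ _ => norm_nonneg _
  -- The reconstruction is exact on noiseless outputs; what remains is the drift since time `t` and
  -- the propagated image of the innovations.
  have hid : (J.proj i).mulVec (state A B x₀ w (t + D) ω) - (A ^ D).mulVec
        (K R fun k => observation C (state A B x₀ w) v β (t + k) ω) =
      (J.proj i).mulVec (state A B x₀ w (t + D) ω - (A ^ D).mulVec (state A B x₀ w t ω)) -
        (J.proj i).mulVec ((A ^ D).mulVec (K R z)) := by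
    rw [hsplit, hadd, hrec R hRL hdet, Matrix.mulVec_add, Matrix.mulVec_sub, proj_pow_mulVec,
      proj_pow_mulVec, hproj]
    abel
  rw [hid]
  refine (norm_sub_le _ _).trans (add_le_add le_rfl ((hcr D _).trans ?_))
  refine mul_le_mul_of_nonneg_left ((hbound R hRL z).trans ?_) (by positivity)
  exact mul_le_mul_of_nonneg_left hznorm hκ

end JordanCycleForm

end IntermittentKalman

/-! ### Mean square error of the block estimator -/

namespace IntermittentKalman

lemma measurableSet_blocks_bad {Ω : Type*} [MeasurableSpace Ω] {β : ℕ → Ω → Bool}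
    (hβ : ∀ n, Measurable (β n)) (𝓔 : Finset (Finset ℕ)) (L n j : ℕ) :
    MeasurableSet {ω | ∀ i < j, ∃ E ∈ 𝓔, ∀ k ∈ E, β (n + 1 - (i + 1) * L + k) ω = false} := by
  have : {ω | ∀ i < j, ∃ E ∈ 𝓔, ∀ k ∈ E, β (n + 1 - (i + 1) * L + k) ω = false} =
      ⋂ i ∈ Finset.range j, ⋃ E ∈ 𝓔, ⋂ k ∈ E, β (n + 1 - (i + 1) * L + k) ⁻¹' {false} := by
    ext ω; simp
  rw [this]
  exact Finset.measurableSet_biInter _ fun i _ => Finset.measurableSet_biUnion _ fun E _ =>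
    Finset.measurableSet_biInter _ fun k _ => hβ _ (measurableSet_singleton _)

namespace JordanCycleForm

variable {m g q : ℕ} {A : Matrix (Fin m) (Fin m) ℂ} (J : JordanCycleForm A)

/-- The bound on the reconstruction error. -/
noncomputable def errorBound {Ω : Type*} (B : Matrix (Fin m) (Fin g) ℂ)
    (C : Matrix (Fin q) (Fin m) ℂ) (x₀ : Ω → Fin m → ℂ) (w : ℕ → Ω → Fin g → ℂ)
    (v : ℕ → Ω → Fin q → ℂ) (i : Fin J.μ) (L : ℕ) (a : ℝ) (t D : ℕ) (ω : Ω) : ℝ :=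
  ‖(J.proj i).mulVec (state A B x₀ w (t + D) ω - (A ^ D).mulVec (state A B x₀ w t ω))‖ +
    a * ∑ k ∈ Finset.range L, ‖innovation A B C x₀ w v t k ω‖

lemma measurable_innovation {Ω : Type*} [MeasurableSpace Ω] {B : Matrix (Fin m) (Fin g) ℂ}
    {C : Matrix (Fin q) (Fin m) ℂ} {x₀ : Ω → Fin m → ℂ} {w : ℕ → Ω → Fin g → ℂ}
    {v : ℕ → Ω → Fin q → ℂ} (hx₀ : Measurable x₀) (hw : ∀ n, Measurable (w n))
    (hv : ∀ n, Measurable (v n)) (t k : ℕ) : Measurable (innovation A B C x₀ w v t k) :=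
  (hv _).add ((measurable_mulVec C).comp ((measurable_state hx₀ hw _).sub
    ((measurable_mulVec _).comp (measurable_state hx₀ hw _))))

lemma measurable_errorBound {Ω : Type*} [MeasurableSpace Ω] {B : Matrix (Fin m) (Fin g) ℂ}
    {C : Matrix (Fin q) (Fin m) ℂ} {x₀ : Ω → Fin m → ℂ} {w : ℕ → Ω → Fin g → ℂ}
    {v : ℕ → Ω → Fin q → ℂ} (hx₀ : Measurable x₀) (hw : ∀ n, Measurable (w n))
    (hv : ∀ n, Measurable (v n)) (i : Fin J.μ) (L : ℕ) (a : ℝ) (t D : ℕ) :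
    Measurable (J.errorBound B C x₀ w v i L a t D) := by
  refine (((measurable_mulVec _).comp ((measurable_state hx₀ hw _).sub
    ((measurable_mulVec _).comp (measurable_state hx₀ hw _)))).norm).add
    (Measurable.const_mul (Finset.measurable_sum _ fun k _ => ?_) a)
  exact (measurable_innovation hx₀ hw hv t k).norm

end JordanCycleForm

namespace IsIntermittentSystem

variable {Ω : Type*} [MeasurableSpace Ω] {P : Measure Ω} {m g q : ℕ}
  {A : Matrix (Fin m) (Fin m) ℂ} {B : Matrix (Fin m) (Fin g) ℂ} {C : Matrix (Fin q) (Fin m) ℂ}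
  {σ σ' pe : ℝ} {x₀ : Ω → Fin m → ℂ} {w : ℕ → Ω → Fin g → ℂ} {v : ℕ → Ω → Fin q → ℂ}
  {β : ℕ → Ω → Bool}

/-- Independence of the Gaussian variables from the channel factorizes the expectation. It is for
this purpose that reconstruction errors are dominated by `errorBound`, which does not involve `β`.
-/
lemma lintegral_indicator_enorm_sq (h : IsIntermittentSystem P A B C σ σ' pe x₀ w v β)
    {E : Type*} [NormedAddCommGroup E] [MeasurableSpace E] [BorelSpace E] {X : Ω → E}
    (hX : Measurable[noiseSigma x₀ w v β] X) {G : Set Ω}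
    (hG : MeasurableSet[channelSigma x₀ w v β] G) :
    ∫⁻ ω, G.indicator (fun ω => ‖X ω‖ₑ ^ 2) ω ∂P = eLpNorm X 2 P ^ 2 * P G := by
  have h1 := lintegral_mul_eq_lintegral_mul_lintegral_of_independent_measurableSpace
    (f := fun ω => ‖X ω‖ₑ ^ 2) (g := G.indicator fun _ => 1) h.noiseSigma_le h.channelSigma_le
    h.indep_noise_channel ((measurable_enorm.comp hX).pow_const 2) (measurable_const.indicator hG)
  rw [lintegral_enorm_sq_eq, lintegral_indicator_const (h.channelSigma_le _ hG), one_mul] at h1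
  rw [← h1]
  refine lintegral_congr fun ω => ?_
  by_cases hω : ω ∈ G <;> simp [hω]

/-- Both terms are of order `r ^ D`, uniformly in `t`: the disturbances of `D` steps form a
geometric sum of ratio `r > 1`, and the innovations of a block have bounded second moments and carry
the factor `r ^ D`. -/
lemma exists_eLpNorm_errorBound_le (h : IsIntermittentSystem P A B C σ σ' pe x₀ w v β)
    (hσ : 0 < σ) (J : JordanCycleForm A) (i : Fin J.μ) {c r κ : ℝ} (hc : 0 ≤ c) (hr : 1 < r)
    (hκ : 0 ≤ κ) (hcr : ∀ n x, ‖(J.proj i).mulVec ((A ^ n).mulVec x)‖ ≤ c * r ^ n * ‖x‖) (L : ℕ) :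
    ∃ b : ℝ, 0 ≤ b ∧ ∀ t D,
      eLpNorm (J.errorBound B C x₀ w v i L (c * r ^ D * κ) t D) 2 P ≤
        ENNReal.ofReal (b * r ^ D) := by
  obtain ⟨b₀, hb₀, hB⟩ := h.exists_eLpNorm_disturbance_le hσ
  obtain ⟨cC, hcC, hC⟩ := exists_norm_mulVec_le C
  choose d hd0 hd using h.exists_eLpNorm_state_sub_le hσ
  have hx₀ := h.gaussian_init.measurable
  have hw := fun n => (h.gaussian_disturbance n).measurable
  have hv := fun n => (h.gaussian_noise n).measurable
  have hr0 : 0 < r - 1 := by linarith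
  have hinn : ∀ t k, eLpNorm (JordanCycleForm.innovation A B C x₀ w v t k) 2 P ≤
      ENNReal.ofReal (q * σ + cC * d k) := by
    intro t k
    rw [ENNReal.ofReal_add (by positivity) (mul_nonneg hcC (hd0 k)), ENNReal.ofReal_mul hcC]
    refine (eLpNorm_add_le (hv _).aestronglyMeasurable ?_ (by norm_num)).trans
      (add_le_add (eLpNorm_le_of_posSemidef (h.gaussian_noise _) hσ (h.upper_noise _)) ?_)
    · exact ((measurable_mulVec C).comp (h.measurable_state_sub t k)).aestronglyMeasurable
    · exact (eLpNorm_le_mul_eLpNorm_of_ae_le_mul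
        (Filter.Eventually.of_forall fun ω => hC _) 2).trans (mul_le_mul_right (hd k t) _)
  have hs0 : 0 ≤ ∑ k ∈ Finset.range L, (q * σ + cC * d k) :=
    Finset.sum_nonneg fun k _ => add_nonneg (by positivity) (mul_nonneg hcC (hd0 k))
  refine ⟨c * b₀ * (1 / (r - 1)) + c * κ * ∑ k ∈ Finset.range L, (q * σ + cC * d k),
    by positivity, fun t D => ?_⟩
  have hrD : 0 ≤ r ^ D := by positivity
  rw [add_mul, ENNReal.ofReal_add (by positivity) (by positivity)]
  have hm1 : Measurable fun ω => (J.proj i).mulVec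
      (state A B x₀ w (t + D) ω - (A ^ D).mulVec (state A B x₀ w t ω)) :=
    (measurable_mulVec _).comp (h.measurable_state_sub t D)
  have hm2 : ∀ k, Measurable fun ω => ‖JordanCycleForm.innovation A B C x₀ w v t k ω‖ :=
    fun k => (JordanCycleForm.measurable_innovation hx₀ hw hv t k).norm
  refine (eLpNorm_add_le hm1.norm.aestronglyMeasurable
    ((Finset.measurable_sum _ fun k _ => hm2 k).const_mul _).aestronglyMeasurable
    (by norm_num)).trans (add_le_add ?_ ?_)
  · rw [eLpNorm_norm]
    have h1 := h.eLpNorm_proj_state_sub_le J i hc (by linarith) hb₀ hB hcr t D 0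
    simp only [pow_zero, Matrix.one_mulVec, zero_add] at h1
    refine h1.trans (ENNReal.ofReal_le_ofReal ?_)
    have h2 : ∑ s ∈ Finset.range D, r ^ s ≤ 1 / (r - 1) * r ^ D := by
      rw [one_div, ← div_eq_inv_mul, le_div_iff₀ hr0, geom_sum_mul]
      linarith
    calc _ ≤ c * b₀ * (1 / (r - 1) * r ^ D) := by gcongr
      _ = _ := by ring
  · have h1 : (fun ω => c * r ^ D * κ *
        ∑ k ∈ Finset.range L, ‖JordanCycleForm.innovation A B C x₀ w v t k ω‖) =
        (c * r ^ D * κ) • ∑ k ∈ Finset.range L,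
          fun ω => ‖JordanCycleForm.innovation A B C x₀ w v t k ω‖ := by
      ext ω; simp
    rw [h1, eLpNorm_const_smul, show c * κ * (∑ k ∈ Finset.range L, (q * σ + cC * d k)) * r ^ D =
      c * r ^ D * κ * ∑ k ∈ Finset.range L, (q * σ + cC * d k) by ring,
      ENNReal.ofReal_mul (by positivity), Real.enorm_of_nonneg (by positivity)]
    refine mul_le_mul_right ((eLpNorm_sum_le (fun k _ => (hm2 k).aestronglyMeasurable)
      (by norm_num)).trans ?_) _
    rw [ENNReal.ofReal_sum_of_nonneg
      fun k _ => add_nonneg (by positivity) (mul_nonneg hcC (hd0 k))]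
    exact Finset.sum_le_sum fun k _ => by rw [eLpNorm_norm]; exact hinn t k

/-- The component of an unstable cycle can be estimated with bounded mean square error. -/
lemma exists_bound_of_unstable (h : IsIntermittentSystem P A B C σ σ' pe x₀ w v β) (hσ : 0 < σ)
    (hobs : ∀ᵐ ω ∂P, ∀ k, C.mulVec (state A B x₀ w k ω) + v k ω ≠ 0)
    (J : JordanCycleForm A) (i : Fin J.μ) (hlam : 1 ≤ ‖J.firstEig i‖)
    (hcond : pe ^ J.minErasures C i * ‖J.firstEig i‖ ^ (2 * J.period i) < 1) :
    ∃ M : ℝ, ∀ n, ∃ f : (Fin (n + 1) → Fin q → ℂ) → Fin m → ℂ, Measurable f ∧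
      ∫⁻ ω, ‖(J.proj i).mulVec (state A B x₀ w n ω) -
        f (fun k => observation C (state A B x₀ w) v β k ω)‖ₑ ^ 2 ∂P ≤ ENNReal.ofReal M := by
  classical
  have hpe := h.pe_nonneg
  -- The strict inequality leaves room for a rate `r` above `|λ|`, which makes up for nontrivial
  -- Jordan blocks.
  obtain ⟨r, hr1, hr2⟩ : ∃ r : ℝ, ‖J.firstEig i‖ < r ∧
      pe ^ J.minErasures C i * r ^ (2 * J.period i) < 1 := by
    have hcont : Continuous fun r : ℝ => pe ^ J.minErasures C i * r ^ (2 * J.period i) := by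
      fun_prop
    have h1 := hcont.continuousAt.eventually (gt_mem_nhds hcond)
    exact ((Filter.Eventually.filter_mono nhdsWithin_le_nhds h1).and
      (self_mem_nhdsWithin (s := Set.Ioi ‖J.firstEig i‖))).exists.imp fun r hr => ⟨hr.2, hr.1⟩
  have hr : 1 < r := by linarith
  have hr0 : 0 ≤ r := by linarith
  obtain ⟨L, 𝓔, e, hL, hE, hρ, hdet⟩ := J.exists_block_length (C := C)
    (by rw [← norm_pos_iff]; linarith) hpe hr.le hr2
  obtain ⟨c, hc, hcr⟩ := J.exists_norm_proj_pow_le i hr1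
  obtain ⟨K, κ, hκ, hKm, hKadd, hKproj, hKbound, hKrec⟩ := J.exists_reconstruction C i L
  obtain ⟨b, hb, hbZ⟩ := h.exists_eLpNorm_errorBound_le hσ J i hc hr hκ hcr L
  obtain ⟨b₀, hb₀, hB⟩ := h.exists_eLpNorm_disturbance_le hσ
  set π₀ := (𝓔.card : ℝ) * pe ^ e with hπ
  have hπ0 : 0 ≤ π₀ := by positivity
  set ρ := π₀ * r ^ (2 * L) with hρdef
  have hρ0 : 0 ≤ ρ := by positivity
  set b' := c * b₀ * (1 / (r - 1)) + c * (m * σ) with hb'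
  have hr1' : 0 < r - 1 := by linarith
  have hb'0 : 0 ≤ b' := by positivity
  have hx₀ := measurable_init_noiseSigma x₀ w v β
  have hw := measurable_disturbance_noiseSigma x₀ w v β
  have hv := measurable_noise_noiseSigma x₀ w v β
  refine ⟨b ^ 2 * r ^ (2 * L) * (1 / (1 - ρ)) + b' ^ 2 * r ^ (2 * L), fun n =>
    ⟨_, J.measurable_blockEstimator C i L n hKm, ?_⟩⟩
  -- On `G j` the latest `j` blocks are bad. That the next one is good is not recorded, since an
  -- upper bound does not need it.
  set G : ℕ → Set Ω := fun j =>
    {ω | ∀ i < j, ∃ E ∈ 𝓔, ∀ k ∈ E, β (n + 1 - (i + 1) * L + k) ω = false} with hG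
  set Z : ℕ → Ω → ℝ := fun j => J.errorBound B C x₀ w v i L
    (c * r ^ ((j + 1) * L - 1) * κ) (n + 1 - (j + 1) * L) ((j + 1) * L - 1) with hZ
  set N := (n + 1) / L with hN
  have hGm : ∀ j, MeasurableSet[channelSigma x₀ w v β] (G j) := fun j =>
    @measurableSet_blocks_bad Ω (channelSigma x₀ w v β) β
      (measurable_channel_channelSigma x₀ w v β) 𝓔 L n j
  have hZm : ∀ j, Measurable[noiseSigma x₀ w v β] (Z j) := fun j =>
    @JordanCycleForm.measurable_errorBound m g q A J Ω (noiseSigma x₀ w v β) B C x₀ w v hx₀ hw hv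
      i L _ _ _
  have hXm : Measurable[noiseSigma x₀ w v β]
      fun ω => (J.proj i).mulVec (state A B x₀ w n ω) :=
    (measurable_mulVec _).comp (measurable_state_noiseSigma A B x₀ w v β n)
  -- Either the latest good block has some index `j < N`, and then `G j` occurs and the error is at
  -- most `Z j`; or all `N` complete blocks are bad, the estimate is `0`, and the error is the
  -- component itself.
  have hpoint : ∀ᵐ ω ∂P, ‖(J.proj i).mulVec (state A B x₀ w n ω) - J.blockEstimator C i L n K
      (extendBy false fun k : Fin (n + 1) =>
        if observation C (state A B x₀ w) v β k ω = 0 then false else true)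
      (extendBy 0 fun k : Fin (n + 1) => observation C (state A B x₀ w) v β k ω)‖ₑ ^ 2 ≤
      ∑ j ∈ Finset.range N, (G j).indicator (fun ω => ‖Z j ω‖ₑ ^ 2) ω +
        (G N).indicator (fun ω => ‖(J.proj i).mulVec (state A B x₀ w n ω)‖ₑ ^ 2) ω := by
    filter_upwards [hobs] with ω hω
    have hpat : ∀ k : ℕ, (if observation C (state A B x₀ w) v β k ω = 0 then false else true) =
        β k ω := by
      intro k
      unfold observation
      cases hβ : β k ω <;> simp [hω k]
    simp only [hpat]
    have hrecv : ∀ j, (j + 1) * L ≤ n + 1 →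
        received (extendBy false fun k : Fin (n + 1) => β k ω) (n + 1 - (j + 1) * L) L =
          received (fun k => β k ω) (n + 1 - (j + 1) * L) L := by
      intro j hj
      have hLj : L ≤ (j + 1) * L := Nat.le_mul_of_pos_left _ (by omega)
      refine Finset.filter_congr fun k hk => ?_
      have := Finset.mem_range.1 hk
      rw [extendBy, dif_pos (by omega)]
    have hbad : ∀ j, ¬ J.Determines C i (received (fun k => β k ω) (n + 1 - (j + 1) * L) L) →
        ∃ E ∈ 𝓔, ∀ k ∈ E, β (n + 1 - (j + 1) * L + k) ω = false := by
      intro j hj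
      by_contra hcon
      push Not at hcon
      refine hj (hdet _ (Finset.filter_subset _ _) fun E hEE hdisj => ?_)
      obtain ⟨k, hk, hk2⟩ := hcon E hEE
      refine Finset.disjoint_left.1 hdisj hk (Finset.mem_filter.2 ⟨(hE E hEE).1 hk, ?_⟩)
      simpa using hk2
    unfold JordanCycleForm.blockEstimator
    split_ifs with hex
    · obtain ⟨hj1, hj2⟩ := Nat.find_spec hex
      have hmin := fun k (hk : k < Nat.find hex) => Nat.find_min hex hk
      set j := Nat.find hex with hj
      have hLj : L ≤ (j + 1) * L := Nat.le_mul_of_pos_left _ (by omega)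
      have hjN : j < N := by
        exact (Nat.le_div_iff_mul_le hL).2 hj1
      rw [hrecv j hj1] at hj2 ⊢
      have hωG : ω ∈ G j := by
        intro i' hi'
        have hle : (i' + 1) * L ≤ n + 1 := (Nat.mul_le_mul_right L (by omega)).trans hj1
        refine hbad i' fun hd => hmin i' hi' ⟨hle, ?_⟩
        rwa [hrecv i' hle]
      refine le_trans ?_ (le_add_of_nonneg_right zero_le)
      refine le_trans ?_ (Finset.single_le_sum
        (f := fun j => (G j).indicator (fun ω => ‖Z j ω‖ₑ ^ 2) ω)
        (fun _ _ => zero_le) (Finset.mem_range.2 hjN))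
      simp only [Set.indicator_of_mem hωG]
      have h1 := J.norm_proj_sub_reconstruction_le (B := B) (x₀ := x₀) (w := w) (v := v) hκ hc hr0
        hcr hKadd hKproj hKbound hKrec (n + 1 - (j + 1) * L) ((j + 1) * L - 1) ω hj2
      have ht : n + 1 - (j + 1) * L + ((j + 1) * L - 1) = n := by omega
      have hext : (fun k : Fin L => extendBy 0
          (fun k : Fin (n + 1) => observation C (state A B x₀ w) v β k ω)
            (n + 1 - (j + 1) * L + k)) =
          fun k : Fin L => observation C (state A B x₀ w) v β (n + 1 - (j + 1) * L + k) ω := by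
        ext1 k
        rw [extendBy, dif_pos (by omega)]
      rw [hext]
      have h2 : ‖(J.proj i).mulVec (state A B x₀ w n ω) - (A ^ ((j + 1) * L - 1)).mulVec
          (K (received (fun k => β k ω) (n + 1 - (j + 1) * L) L) fun k =>
            observation C (state A B x₀ w) v β (n + 1 - (j + 1) * L + k) ω)‖ ≤ Z j ω := by
        rw [← mul_assoc] at h1
        simp only [hZ, JordanCycleForm.errorBound]
        rw [ht] at h1 ⊢
        exact h1
      gcongr
      rw [← enorm_norm, Real.enorm_of_nonneg (norm_nonneg _),
        Real.enorm_of_nonneg ((norm_nonneg _).trans h2)]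
      exact ENNReal.ofReal_le_ofReal h2
    · have hωG : ω ∈ G N := by
        intro i' hi'
        have hle : (i' + 1) * L ≤ n + 1 :=
          (Nat.mul_le_mul_right L hi').trans (Nat.div_mul_le_self _ _)
        refine hbad i' fun hd => hex ⟨i', hle, ?_⟩
        rwa [hrecv i' hle]
      rw [Set.indicator_of_mem hωG, sub_zero]
      exact le_add_of_nonneg_left zero_le
  refine (lintegral_mono_ae hpoint).trans ?_
  have hZm' : ∀ j ∈ Finset.range N,
      Measurable fun ω => (G j).indicator (fun ω => ‖Z j ω‖ₑ ^ 2) ω := fun j _ =>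
    ((measurable_enorm.comp ((hZm j).mono h.noiseSigma_le le_rfl)).pow_const 2).indicator
      (h.channelSigma_le _ (hGm j))
  rw [lintegral_add_left (Finset.measurable_sum _ hZm'), lintegral_finsetSum _ hZm']
  have h1ρ : 0 < 1 - ρ := by linarith
  rw [ENNReal.ofReal_add (by positivity) (by positivity)]
  refine add_le_add ?_ ?_
  · have hj : ∀ j ∈ Finset.range N, ∫⁻ ω, (G j).indicator (fun ω => ‖Z j ω‖ₑ ^ 2) ω ∂P ≤
        ENNReal.ofReal (b ^ 2 * r ^ (2 * L) * ρ ^ j) := by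
      intro j hj
      have hjL : j * L ≤ n + 1 :=
        (Nat.mul_le_mul_right L (Finset.mem_range.1 hj).le).trans (Nat.div_mul_le_self _ _)
      rw [h.lintegral_indicator_enorm_sq (hZm j) (hGm j)]
      refine (mul_le_mul' (pow_le_pow_left₀ zero_le (hbZ _ _) 2)
        (h.measure_blocks_bad_le hE hjL)).trans ?_
      rw [← ENNReal.ofReal_pow (by positivity), ← ENNReal.ofReal_mul (by positivity)]
      refine ENNReal.ofReal_le_ofReal ?_
      have : r ^ ((j + 1) * L - 1) ≤ r ^ ((j + 1) * L) := pow_le_pow_right₀ hr.le (by omega)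
      -- The growth `r ^ (2 * L)` over each bad block is paired with its probability bound `π₀`,
      -- giving `ρ ^ j`; one factor `r ^ (2 * L)`, for the good block itself, is left over.
      calc (b * r ^ ((j + 1) * L - 1)) ^ 2 * π₀ ^ j
          ≤ (b * r ^ ((j + 1) * L)) ^ 2 * π₀ ^ j := by gcongr
        _ = _ := by rw [hρdef]; ring
    refine (Finset.sum_le_sum hj).trans ?_
    rw [← ENNReal.ofReal_sum_of_nonneg fun _ _ => by positivity, ← Finset.mul_sum]
    refine ENNReal.ofReal_le_ofReal ?_
    have : ∑ j ∈ Finset.range N, ρ ^ j ≤ 1 / (1 - ρ) := by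
      rw [le_div_iff₀ h1ρ, ← neg_sub ρ 1, mul_neg, geom_sum_mul]
      have := pow_nonneg hρ0 N
      linarith
    gcongr
  · rw [h.lintegral_indicator_enorm_sq hXm (hGm N)]
    have hX := h.eLpNorm_proj_state_le hσ J i hc hr0 hb₀ hB hcr n
    have hX' : eLpNorm (fun ω => (J.proj i).mulVec (state A B x₀ w n ω)) 2 P ≤
        ENNReal.ofReal (b' * r ^ n) := by
      refine hX.trans (ENNReal.ofReal_le_ofReal ?_)
      have h2 : ∑ s ∈ Finset.range n, r ^ s ≤ 1 / (r - 1) * r ^ n := by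
        rw [one_div, ← div_eq_inv_mul, le_div_iff₀ hr1', geom_sum_mul]
        linarith
      calc _ ≤ c * b₀ * (1 / (r - 1) * r ^ n) + c * r ^ n * (m * σ) := by gcongr
        _ = _ := by rw [hb']; ring
    refine (mul_le_mul' (pow_le_pow_left₀ zero_le hX' 2)
      (h.measure_blocks_bad_le hE (Nat.div_mul_le_self _ _))).trans ?_
    rw [← ENNReal.ofReal_pow (by positivity), ← ENNReal.ofReal_mul (by positivity)]
    refine ENNReal.ofReal_le_ofReal ?_
    -- The times before the `N` complete blocks number fewer than `L` and cost another factor `r ^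
    -- (2 * L)`.
    have hn : n ≤ (N + 1) * L := by
      have h1 := Nat.div_add_mod (n + 1) L
      have h2 := Nat.mod_lt (n + 1) hL
      have h3 : (N + 1) * L = L * ((n + 1) / L) + L := by rw [hN]; ring
      omega
    calc (b' * r ^ n) ^ 2 * π₀ ^ N ≤ (b' * r ^ ((N + 1) * L)) ^ 2 * π₀ ^ N := by
          gcongr
          exact hr.le
      _ = b' ^ 2 * r ^ (2 * L) * ρ ^ N := by rw [hρdef]; ring
      _ ≤ b' ^ 2 * r ^ (2 * L) * 1 := by
          gcongr
          exact pow_le_one₀ hρ0 hρ.le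
      _ = _ := mul_one _

end IsIntermittentSystem

end IntermittentKalman

/-! ### Erasures read off from the outputs, and sufficiency -/

namespace IntermittentKalman

lemma measurable_observation {Ω : Type*} [MeasurableSpace Ω] {m q : ℕ}
    {C : Matrix (Fin q) (Fin m) ℂ} {x : ℕ → Ω → Fin m → ℂ} {v : ℕ → Ω → Fin q → ℂ}
    {β : ℕ → Ω → Bool} (hx : ∀ n, Measurable (x n)) (hv : ∀ n, Measurable (v n))
    (hβ : ∀ n, Measurable (β n)) (n : ℕ) : Measurable (observation C x v β n) :=
  Measurable.ite ((hβ n) (measurableSet_singleton true))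
    (((measurable_mulVec C).comp (hx n)).add (hv n)) measurable_const

lemma IsCenteredGaussian.integral_clm_eq_zero {Ω E : Type*} [MeasurableSpace Ω]
    [NormedAddCommGroup E] [NormedSpace ℝ E] [CompleteSpace E] {P : Measure Ω} {k : ℕ}
    {X : Ω → Fin k → ℂ} (hX : IsCenteredGaussian P X) (a : (Fin k → ℂ) →L[ℝ] E) :
    ∫ ω, a (X ω) ∂P = 0 := by
  have hi : Integrable X P := hX.gaussian.integrable
  have h0 : ∫ ω, X ω ∂P = 0 := by
    ext i
    exact (eval_integral (fun i => (hX.gaussian.map_fun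
      (ContinuousLinearMap.proj (R := ℝ) i)).integrable) i).trans (hX.mean_zero i)
  rw [ContinuousLinearMap.integral_comp_comm a hi, h0, map_zero]

/-- A coordinate of a nondegenerate Gaussian vector has no atoms. -/
lemma IsCenteredGaussian.measure_eval_eq_zero {Ω : Type*} [MeasurableSpace Ω] {P : Measure Ω}
    [IsProbabilityMeasure P] {k : ℕ} {X : Ω → Fin k → ℂ} (hX : IsCenteredGaussian P X) {σ' : ℝ}
    (hσ' : 0 < σ')
    (h : (secondMoment P X - (σ' ^ 2 : ℂ) • (1 : Matrix (Fin k) (Fin k) ℂ)).PosSemidef)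
    (a : Fin k) (z : ℂ) : P {ω | X ω a = z} = 0 := by
  have key : ∀ L : ℂ →L[ℝ] ℝ, 0 < ∫ ω, L (X ω a) ^ 2 ∂P → P {ω | X ω a = z} = 0 := by
    intro L hL
    have hg : HasGaussianLaw (fun ω => L (X ω a)) P :=
      hX.gaussian.map_fun (L ∘L ContinuousLinearMap.proj (R := ℝ) a)
    have h0 : ∫ ω, L (X ω a) ∂P = 0 :=
      hX.integral_clm_eq_zero (L ∘L ContinuousLinearMap.proj (R := ℝ) a)
    have hv : Var[fun ω => L (X ω a); P] = ∫ ω, L (X ω a) ^ 2 ∂P :=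
      variance_of_integral_eq_zero hg.aemeasurable h0
    have hac : P.map (fun ω => L (X ω a)) ≪ volume := by
      rw [hg.map_eq_gaussianReal]
      refine gaussianReal_absolutelyContinuous _ ?_
      rw [hv]
      exact (Real.toNNReal_pos.2 hL).ne'
    have h1 := hac (Real.volume_singleton (a := L z))
    have hmeas : Measurable fun ω => L (X ω a) :=
      L.continuous.measurable.comp ((measurable_pi_apply a).comp hX.measurable)
    rw [Measure.map_apply hmeas (measurableSet_singleton _)] at h1
    refine measure_mono_null (fun ω hω => ?_) h1
    have hω' : X ω a = z := hω
    simp [hω']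
  have h1 := h.diag_nonneg (i := a)
  simp only [Matrix.sub_apply, Matrix.smul_apply, Matrix.one_apply_eq, secondMoment,
    Matrix.of_apply] at h1
  have h2 : ∀ ω, X ω a * star (X ω a) = ((‖X ω a‖ ^ 2 : ℝ) : ℂ) := fun ω => by
    rw [RCLike.star_def, Complex.mul_conj, Complex.normSq_eq_norm_sq]
  simp only [h2] at h1
  rw [integral_complex_ofReal] at h1
  have h3 : σ' ^ 2 ≤ ∫ ω, ‖X ω a‖ ^ 2 ∂P := by
    have : (0 : ℂ) ≤ ((∫ ω, ‖X ω a‖ ^ 2 ∂P - σ' ^ 2 : ℝ) : ℂ) := by simpa using h1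
    have := Complex.zero_le_real.1 this
    linarith
  have hint : ∀ L : ℂ →L[ℝ] ℝ, Integrable (fun ω => L (X ω a) ^ 2) P := fun L =>
    (hX.gaussian.map_fun (L ∘L ContinuousLinearMap.proj (R := ℝ) a)).memLp_two.integrable_sq
  have h4 : ∫ ω, ‖X ω a‖ ^ 2 ∂P =
      ∫ ω, Complex.reCLM (X ω a) ^ 2 ∂P + ∫ ω, Complex.imCLM (X ω a) ^ 2 ∂P := by
    rw [← integral_add (hint _) (hint _)]
    refine integral_congr_ae (Filter.Eventually.of_forall fun ω => ?_)
    simp only [← Complex.normSq_eq_norm_sq, Complex.normSq_apply, Complex.reCLM_apply,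
      Complex.imCLM_apply]
    ring
  have h5 : 0 < σ' ^ 2 := by positivity
  -- The real or the imaginary part has positive variance, and an atomless law for one of them is
  -- enough.
  rcases lt_or_ge 0 (∫ ω, Complex.reCLM (X ω a) ^ 2 ∂P) with h6 | h6
  · exact key _ h6
  · exact key Complex.imCLM (by linarith)

namespace IsIntermittentSystem

variable {Ω : Type*} [MeasurableSpace Ω] {P : Measure Ω} [IsProbabilityMeasure P] {m g q : ℕ}
  {A : Matrix (Fin m) (Fin m) ℂ} {B : Matrix (Fin m) (Fin g) ℂ} {C : Matrix (Fin q) (Fin m) ℂ}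
  {σ σ' pe : ℝ} {x₀ : Ω → Fin m → ℂ} {w : ℕ → Ω → Fin g → ℂ} {v : ℕ → Ω → Fin q → ℂ}
  {β : ℕ → Ω → Bool}

omit [IsProbabilityMeasure P] in
lemma indepFun_state_noise (h : IsIntermittentSystem P A B C σ σ' pe x₀ w v β) (n k : ℕ) :
    IndepFun (state A B x₀ w n) (v k) P := by
  set S : Set Source := {s | s = .init ∨ ∃ j, s = .disturbance j} with hS
  have hle : ∀ s ∈ S, sourceSigma x₀ w v β s ≤ ⨆ s ∈ S, sourceSigma x₀ w v β s := fun s hs =>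
    le_iSup₂ (f := fun s (_ : s ∈ S) => sourceSigma x₀ w v β s) s hs
  have hind : Indep (⨆ s ∈ S, sourceSigma x₀ w v β s)
      (⨆ s ∈ ({.noise k} : Set Source), sourceSigma x₀ w v β s) P := by
    refine indep_iSup_of_disjoint h.sourceSigma_le h.indep ?_
    rw [Set.disjoint_singleton_right]
    rintro (h | ⟨j, h⟩) <;> cases h
  have hm : Measurable[⨆ s ∈ S, sourceSigma x₀ w v β s] (state A B x₀ w n) :=
    @IntermittentKalman.measurable_state Ω (⨆ s ∈ S, sourceSigma x₀ w v β s) m g A B x₀ w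
      ((comap_measurable x₀).mono (hle .init (Or.inl rfl)) le_rfl)
      (fun j => (comap_measurable (w j)).mono (hle (.disturbance j) (Or.inr ⟨j, rfl⟩)) le_rfl) n
  rw [IndepFun_iff_Indep]
  refine indep_of_indep_of_le_left (indep_of_indep_of_le_right hind ?_) hm.comap_le
  exact le_iSup₂ (f := fun s (_ : s ∈ ({.noise k} : Set Source)) => sourceSigma x₀ w v β s)
    (.noise k) rfl

/-- A received packet is almost surely nonzero. -/
lemma ae_output_ne_zero (h : IsIntermittentSystem P A B C σ σ' pe x₀ w v β) (hσ' : 0 < σ')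
    (hq : 0 < q) : ∀ᵐ ω ∂P, ∀ k, C.mulVec (state A B x₀ w k ω) + v k ω ≠ 0 := by
  rw [ae_all_iff]
  intro k
  set V : Ω → ℂ := fun ω => v k ω ⟨0, hq⟩ with hV
  set Z : Ω → ℂ := fun ω => C.mulVec (state A B x₀ w k ω) ⟨0, hq⟩ with hZ
  have hVm : Measurable V := (measurable_pi_apply _).comp (h.gaussian_noise k).measurable
  have hZm : Measurable Z :=
    (measurable_pi_apply _).comp ((measurable_mulVec C).comp (h.measurable_state k))
  have hind : IndepFun Z V P := (h.indepFun_state_noise k k).comp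
    ((measurable_pi_apply _).comp (measurable_mulVec C)) (measurable_pi_apply _)
  have hmap := (indepFun_iff_map_prod_eq_prod_map_map hZm.aemeasurable hVm.aemeasurable).1 hind
  have hset : MeasurableSet {p : ℂ × ℂ | p.1 + p.2 = 0} :=
    measurableSet_eq_fun (measurable_fst.add measurable_snd) measurable_const
  -- Fubini: for each value of the state term, only one value of the independent noise gives a zero
  -- output.
  have hnull : (P.map fun ω => (Z ω, V ω)) {p : ℂ × ℂ | p.1 + p.2 = 0} = 0 := by
    rw [hmap, Measure.measure_prod_null hset]
    refine Filter.Eventually.of_forall fun z => ?_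
    have hs : MeasurableSet (Prod.mk z ⁻¹' {p : ℂ × ℂ | p.1 + p.2 = 0}) :=
      measurable_prodMk_left hset
    change P.map V _ = 0
    rw [Measure.map_apply hVm hs]
    refine measure_mono_null (fun ω hω => ?_)
      ((h.gaussian_noise k).measure_eval_eq_zero hσ' (h.lower_noise k) ⟨0, hq⟩ (-z))
    have : z + V ω = 0 := hω
    exact eq_neg_of_add_eq_zero_right this
  rw [Measure.map_apply (hZm.prodMk hVm) hset] at hnull
  rw [ae_iff]
  refine measure_mono_null (fun ω hω => ?_) hnull
  simp only [ne_eq, not_not, Set.mem_ofPred_eq] at hω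
  exact congrFun hω ⟨0, hq⟩

/-- The components are estimated separately and the estimates added; `sum_proj` recombines the
errors. -/
theorem isIntermittentObservable (h : IsIntermittentSystem P A B C σ σ' pe x₀ w v β)
    (hσ : 0 < σ) (hσ' : 0 < σ') (J : JordanCycleForm A)
    (hcond : ∀ i, 1 ≤ ‖J.firstEig i‖ →
      pe ^ J.minErasures C i * ‖J.firstEig i‖ ^ (2 * J.period i) < 1) :
    IsIntermittentObservable P A B C x₀ w v β := by
  have hcyc : ∀ i, ∃ M : ℝ, ∀ n, ∃ f : (Fin (n + 1) → Fin q → ℂ) → Fin m → ℂ, Measurable f ∧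
      ∫⁻ ω, ‖(J.proj i).mulVec (state A B x₀ w n ω) -
        f (fun k => observation C (state A B x₀ w) v β k ω)‖ₑ ^ 2 ∂P ≤ ENNReal.ofReal M := by
    intro i
    rcases lt_or_ge ‖J.firstEig i‖ 1 with hlam | hlam
    · obtain ⟨M, hM⟩ := h.exists_bound_of_stable hσ J i hlam
      exact ⟨M, fun n => ⟨0, measurable_zero, by simpa using hM n⟩⟩
    · have hq : 0 < q := by
        -- Without output coordinates a received packet cannot be told from an erased one. But then
        -- nothing need be erased to hide the cycle, so `l = 0`, and the condition fails for `|λ| ≥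
        -- 1`.
        rcases Nat.eq_zero_or_pos q with rfl | hq
        · have h0 : J.minErasures C i ≤ (∅ : Finset ℕ).card :=
            J.minErasures_le (Finset.empty_subset _) (u := fun _ => 1)
              (fun h => one_ne_zero (congrFun h ⟨0, J.ν_pos i⟩)) fun s _ => Subsingleton.elim _ _
          have h1 := hcond i hlam
          rw [Nat.le_zero.1 h0, pow_zero, one_mul] at h1
          exact absurd h1 (not_lt.2 (one_le_pow₀ hlam))
        · exact hq
      exact h.exists_bound_of_unstable hσ (h.ae_output_ne_zero hσ' hq) J i hlam (hcond i hlam)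
  choose M f hfm hf using hcyc
  refine ⟨fun n y => ∑ i, f i n y, fun n => Finset.measurable_sum _ fun i _ => hfm i n, ?_⟩
  have hb : ∀ n, ∫⁻ ω, ∑ a, ‖state A B x₀ w n ω a -
      (∑ i, f i n (fun k => observation C (state A B x₀ w) v β k ω)) a‖ₑ ^ 2 ∂P ≤
      m * (∑ i, ENNReal.ofReal √(M i)) ^ 2 := by
    intro n
    set e : Fin J.μ → Ω → Fin m → ℂ := fun i ω => (J.proj i).mulVec (state A B x₀ w n ω) -
        f i n (fun k => observation C (state A B x₀ w) v β k ω) with he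
    have hem : ∀ i, Measurable (e i) := fun i =>
      ((measurable_mulVec _).comp (h.measurable_state n)).sub ((hfm i n).comp
        (measurable_pi_lambda _ fun k => measurable_observation h.measurable_state
          (fun n => (h.gaussian_noise n).measurable) h.measurable_channel k))
    have heq : ∀ ω a, state A B x₀ w n ω a -
        (∑ i, f i n (fun k => observation C (state A B x₀ w) v β k ω)) a = (∑ i, e i) ω a := by
      intro ω a
      have h1 : ∑ i, (J.proj i).mulVec (state A B x₀ w n ω) = state A B x₀ w n ω := by
        rw [← Matrix.sum_mulVec, J.sum_proj, Matrix.one_mulVec]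
      have h2 : (∑ i, e i) ω = state A B x₀ w n ω -
          ∑ i, f i n (fun k => observation C (state A B x₀ w) v β k ω) := by
        rw [Finset.sum_apply]
        simp only [he]
        rw [Finset.sum_sub_distrib, h1]
      rw [h2]
      rfl
    simp only [heq]
    calc ∫⁻ ω, ∑ a, ‖(∑ i, e i) ω a‖ₑ ^ 2 ∂P ≤ ∫⁻ ω, m * ‖(∑ i, e i) ω‖ₑ ^ 2 ∂P := by
          refine lintegral_mono fun ω => ?_
          calc _ ≤ ∑ _a : Fin m, ‖(∑ i, e i) ω‖ₑ ^ 2 := by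
                refine Finset.sum_le_sum fun a _ => pow_le_pow_left₀ zero_le ?_ 2
                rw [← enorm_norm, ← enorm_norm (_ : Fin m → ℂ),
                  Real.enorm_of_nonneg (norm_nonneg _), Real.enorm_of_nonneg (norm_nonneg _)]
                exact ENNReal.ofReal_le_ofReal (norm_le_pi_norm _ a)
            _ = _ := by simp
      _ = m * eLpNorm (∑ i, e i) 2 P ^ 2 := by
          rw [lintegral_const_mul' _ _ (ENNReal.natCast_ne_top m), lintegral_enorm_sq_eq]
      _ ≤ _ := by
          gcongr
          refine (eLpNorm_sum_le (fun i _ => (hem i).aestronglyMeasurable) (by norm_num)).trans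
            (Finset.sum_le_sum fun i _ => ?_)
          have h2 := hf i n
          rw [lintegral_enorm_sq_eq] at h2
          rw [← ENNReal.pow_le_pow_left_iff two_ne_zero]
          refine h2.trans ?_
          rw [← ENNReal.ofReal_pow (Real.sqrt_nonneg _), Real.sq_sqrt']
          exact ENNReal.ofReal_le_ofReal (le_max_left _ _)
  refine lt_of_le_of_lt (iSup_le hb) ?_
  exact ENNReal.mul_lt_top (ENNReal.natCast_lt_top m)
    (ENNReal.pow_lt_top (ENNReal.sum_lt_top.2 fun _ _ => ENNReal.ofReal_lt_top))

end IsIntermittentSystem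

end IntermittentKalman

namespace IntermittentKalman

/-! ### Linear functionals of the noise with prescribed correlation -/

/-- The real-linear functional `x ↦ Re (a† x)`. -/
noncomputable def rePairing {k : ℕ} (a : Fin k → ℂ) : (Fin k → ℂ) →L[ℝ] ℝ :=
  ∑ i, Complex.reCLM ∘L (((star (a i)) • ContinuousLinearMap.proj (R := ℂ) i).restrictScalars ℝ)

lemma rePairing_apply {k : ℕ} (a x : Fin k → ℂ) :
    rePairing a x = (∑ i, star (a i) * x i).re := by
  simp [rePairing]

/-- Either `X` is proper, or both `X` and the vector `d` are real. -/
def IsProperOrReal {Ω : Type*} [MeasurableSpace Ω] (P : Measure Ω) {k : ℕ} (X : Ω → Fin k → ℂ)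
    (d : Fin k → ℂ) : Prop :=
  IsProper P X ∨ (IsRealValued P X ∧ ∀ i, (d i).im = 0)

/-- For a nondegenerate Gaussian vector `X` there is a linear functional of `X` whose correlation
with `X` is a given vector. -/
lemma IsCenteredGaussian.exists_functional {Ω : Type*} [MeasurableSpace Ω] {P : Measure Ω}
    [IsProbabilityMeasure P] {k : ℕ} {X : Ω → Fin k → ℂ} (hX : IsCenteredGaussian P X) {σ' : ℝ}
    (hσ' : 0 < σ')
    (h : (secondMoment P X - (σ' ^ 2 : ℂ) • (1 : Matrix (Fin k) (Fin k) ℂ)).PosSemidef)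
    (d : Fin k → ℂ) (hd : IsProperOrReal P X d) :
    ∃ a : (Fin k → ℂ) →L[ℝ] ℝ, (∀ j, ∫ ω, (a (X ω) : ℂ) * X ω j ∂P = d j) ∧
      ∫ ω, a (X ω) ^ 2 ∂P ≤ 2 / σ' ^ 2 * ∑ j, ‖d j‖ ^ 2 := by
  have hσ2 : (0 : ℂ) < (σ' ^ 2 : ℂ) := by
    have : (0 : ℂ) < ((σ' ^ 2 : ℝ) : ℂ) := Complex.zero_lt_real.2 (by positivity)
    simpa using this
  have hpos : (secondMoment P X).PosDef := by
    have := Matrix.PosDef.posSemidef_add h (Matrix.PosDef.one.smul hσ2)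
    simpa using this
  set S := secondMoment P X with hS
  -- The functional will be a real multiple of `Re (a† X)`, where `a` solves `S a = d`.
  obtain ⟨a, ha⟩ : ∃ a, S.mulVec a = d :=
    ⟨S⁻¹.mulVec d, by rw [Matrix.mulVec_mulVec, Matrix.mul_nonsing_inv _
      ((Matrix.isUnit_iff_isUnit_det _).1 hpos.isUnit), Matrix.one_mulVec]⟩
  have hmem : ∀ i, MemLp (fun ω => X ω i) 2 P := fun i =>
    (hX.gaussian.map_fun (ContinuousLinearMap.proj (R := ℝ) i)).memLp_two
  have hi1 : ∀ i j, Integrable (fun ω => X ω i * X ω j) P := fun i j =>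
    (hmem i).integrable_mul (hmem j)
  have hi2 : ∀ i j, Integrable (fun ω => X ω i * star (X ω j)) P := fun i j =>
    (hmem i).integrable_mul (hmem j).star
  have hcorr : ∀ j, ∫ ω, (rePairing a (X ω) : ℂ) * X ω j ∂P =
      (∑ i, star (a i) * ∫ ω, X ω i * X ω j ∂P + d j) / 2 := by
    intro j
    have h1 : ∀ ω, (rePairing a (X ω) : ℂ) * X ω j =
        (∑ i, star (a i) * (X ω i * X ω j) + ∑ i, a i * (X ω j * star (X ω i))) / 2 := by
      intro ω
      rw [rePairing_apply, Complex.re_eq_add_conj, map_sum, div_mul_eq_mul_div, add_mul,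
        Finset.sum_mul, Finset.sum_mul]
      congr 2
      · exact Finset.sum_congr rfl fun i _ => by ring
      · refine Finset.sum_congr rfl fun i _ => ?_
        simp only [RCLike.star_def, map_mul, Complex.conj_conj]
        ring
    simp only [h1]
    rw [integral_div, integral_add (integrable_finsetSum _ fun i _ => (hi1 i j).const_mul _)
      (integrable_finsetSum _ fun i _ => (hi2 j i).const_mul _),
      integral_finsetSum _ fun i _ => (hi1 i j).const_mul _,
      integral_finsetSum _ fun i _ => (hi2 j i).const_mul _]
    simp only [integral_const_mul]
    congr 2
    rw [← ha]
    simp only [Matrix.mulVec, dotProduct, hS, secondMoment, Matrix.of_apply]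
    exact Finset.sum_congr rfl fun i _ => mul_comm _ _
  -- In `hcorr` the pseudo-covariance term is `0` if `X` is proper, and the conjugate of `d j`, thus
  -- `d j`, in the real case. The multiple is `2` or `1` accordingly.
  obtain ⟨c, hc1, hc2, hc⟩ : ∃ c : ℝ, 0 ≤ c ∧ c ≤ 2 ∧
      ∀ j, (c : ℂ) * ∫ ω, (rePairing a (X ω) : ℂ) * X ω j ∂P = d j := by
    rcases hd with hd | ⟨hreal, hd⟩
    · refine ⟨2, by norm_num, le_rfl, fun j => ?_⟩
      have h0 : ∀ i, ∫ ω, X ω i * X ω j ∂P = 0 := fun i => hd i j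
      rw [hcorr]
      simp only [h0, mul_zero, Finset.sum_const_zero, zero_add]
      push_cast
      ring
    · refine ⟨1, by norm_num, by norm_num, fun j => ?_⟩
      have h1 : ∑ i, star (a i) * ∫ ω, X ω i * X ω j ∂P = star (d j) := by
        rw [← ha]
        simp only [Matrix.mulVec, dotProduct, hS, secondMoment, Matrix.of_apply, star_sum, star_mul']
        refine Finset.sum_congr rfl fun i _ => ?_
        rw [mul_comm]
        congr 1
        rw [RCLike.star_def, ← integral_conj]
        refine integral_congr_ae ?_
        filter_upwards [hreal] with ω hω
        simp only [map_mul, Complex.conj_conj]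
        rw [Complex.conj_eq_iff_im.2 (hω j), mul_comm]
      rw [hcorr, h1, RCLike.star_def, Complex.conj_eq_iff_im.2 (hd j)]
      push_cast
      ring
  refine ⟨c • rePairing a, fun j => ?_, ?_⟩
  · rw [← hc j, ← integral_const_mul]
    simp [mul_assoc]
  -- The two estimates `σ'² |a|² ≤ Re (a† d)` and `Re (a† d) ≤ σ'² |a|² / 2 + |d|² / (2 σ'²)`
  -- combine to `Re (a† d) ≤ |d|² / σ'²`; the variance is `c` times the left side.
  · have hquad : σ' ^ 2 * ∑ i, ‖a i‖ ^ 2 ≤ (∑ i, star (a i) * d i).re := by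
      have h1 := h.dotProduct_mulVec_nonneg a
      rw [Matrix.sub_mulVec, ha, Matrix.smul_mulVec, Matrix.one_mulVec] at h1
      have h2 := (Complex.le_def.1 h1).1
      simp only [dotProduct, Pi.sub_apply, Pi.smul_apply, Pi.star_apply, smul_eq_mul, mul_sub,
        Finset.sum_sub_distrib, Complex.sub_re, Complex.zero_re] at h2
      have h3 : ∑ i, star (a i) * ((σ' : ℂ) ^ 2 * a i) = ((σ' ^ 2 * ∑ i, ‖a i‖ ^ 2 : ℝ) : ℂ) := by
        push_cast
        rw [Finset.mul_sum]
        refine Finset.sum_congr rfl fun i _ => ?_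
        rw [RCLike.star_def, ← Complex.conj_mul']
        ring
      rw [h3, Complex.ofReal_re] at h2
      linarith
    have hcs : (∑ i, star (a i) * d i).re ≤
        (σ' ^ 2 * ∑ i, ‖a i‖ ^ 2) / 2 + (∑ i, ‖d i‖ ^ 2) / (2 * σ' ^ 2) := by
      rw [Complex.re_sum, Finset.mul_sum, Finset.sum_div, Finset.sum_div, ← Finset.sum_add_distrib]
      refine Finset.sum_le_sum fun i _ => (Complex.re_le_norm _).trans ?_
      rw [norm_mul, norm_star]
      have h1 : 0 ≤ (σ' * ‖a i‖ - ‖d i‖ / σ') ^ 2 := sq_nonneg _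
      have h2 : (σ' * ‖a i‖ - ‖d i‖ / σ') ^ 2 =
          σ' ^ 2 * ‖a i‖ ^ 2 + ‖d i‖ ^ 2 / σ' ^ 2 - 2 * (‖a i‖ * ‖d i‖) := by
        field_simp
        ring
      have h3 : ‖d i‖ ^ 2 / (2 * σ' ^ 2) = ‖d i‖ ^ 2 / σ' ^ 2 / 2 := by
        field_simp
      linarith
    have hval : ∫ ω, (c • rePairing a) (X ω) ^ 2 ∂P = c * (∑ i, star (a i) * d i).re := by
      have hreal : ((∫ ω, (c • rePairing a) (X ω) ^ 2 ∂P : ℝ) : ℂ) =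
          ((c * (∫ ω, ∑ i, star (a i) * ((c : ℂ) * ((rePairing a (X ω) : ℂ) * X ω i)) ∂P).re : ℝ)
            : ℂ) := by
        congr 1
        have hre : (∫ ω, ∑ i, star (a i) * ((c : ℂ) * ((rePairing a (X ω) : ℂ) * X ω i)) ∂P).re =
            ∫ ω, (∑ i, star (a i) * ((c : ℂ) * ((rePairing a (X ω) : ℂ) * X ω i))).re ∂P := by
          refine (integral_re (𝕜 := ℂ) ?_).symm
          refine integrable_finsetSum _ fun i _ => Integrable.const_mul (Integrable.const_mul ?_ _) _
          have hr : MemLp (fun ω => (rePairing a (X ω) : ℂ)) 2 P :=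
            (hX.gaussian.map_fun (Complex.ofRealCLM ∘L rePairing a)).memLp_two
          exact hr.integrable_mul (hmem i)
        rw [hre, ← integral_const_mul]
        refine integral_congr_ae (Filter.Eventually.of_forall fun ω => ?_)
        simp only [smul_apply, smul_eq_mul]
        have h1 : ∑ i, star (a i) * ((c : ℂ) * ((rePairing a (X ω) : ℂ) * X ω i)) =
            ((c * rePairing a (X ω) : ℝ) : ℂ) * ∑ i, star (a i) * X ω i := by
          rw [Finset.mul_sum]
          refine Finset.sum_congr rfl fun i _ => ?_
          push_cast; ring
        rw [h1, Complex.re_ofReal_mul, ← rePairing_apply]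
        ring
      have := Complex.ofReal_injective hreal
      rw [this]
      congr 2
      rw [integral_finsetSum]
      · refine Finset.sum_congr rfl fun i _ => ?_
        rw [integral_const_mul, integral_const_mul, hc]
      · intro i _
        refine Integrable.const_mul (Integrable.const_mul ?_ _) _
        have hr : MemLp (fun ω => (rePairing a (X ω) : ℂ)) 2 P :=
          (hX.gaussian.map_fun (Complex.ofRealCLM ∘L rePairing a)).memLp_two
        exact hr.integrable_mul (hmem i)
    rw [hval]
    have h3 : (∑ i, ‖d i‖ ^ 2) / (2 * σ' ^ 2) = (∑ i, ‖d i‖ ^ 2) / σ' ^ 2 / 2 := by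
      field_simp
    have hle : (∑ i, star (a i) * d i).re ≤ (∑ i, ‖d i‖ ^ 2) / σ' ^ 2 := by linarith
    have hnn : 0 ≤ (∑ i, ‖d i‖ ^ 2) / σ' ^ 2 := by positivity
    calc c * (∑ i, star (a i) * d i).re ≤ c * ((∑ i, ‖d i‖ ^ 2) / σ' ^ 2) := by gcongr
      _ ≤ 2 * ((∑ i, ‖d i‖ ^ 2) / σ' ^ 2) := by gcongr
      _ = _ := by ring

end IntermittentKalman

namespace IntermittentKalman

/-! ### Joint Gaussianity of the primitive random variables -/

/-- A common space of values for the Gaussian primitive random variables. -/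
abbrev Carrier (m g q : ℕ) : Type := (Fin m → ℂ) × (Fin g → ℂ) × (Fin q → ℂ)

instance borelSpace_carrier (m g q : ℕ) : BorelSpace (Carrier m g q) := Prod.borelSpace

instance secondCountable_carrier (m g q : ℕ) : SecondCountableTopology (Carrier m g q) :=
  inferInstance

/-- The embedding of the initial states. -/
noncomputable def initCLM (m g q : ℕ) : (Fin m → ℂ) →L[ℝ] Carrier m g q := ContinuousLinearMap.inl ℝ _ _

/-- The embedding of the disturbances. -/
noncomputable def disturbanceCLM (m g q : ℕ) : (Fin g → ℂ) →L[ℝ] Carrier m g q :=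
  ContinuousLinearMap.comp (ContinuousLinearMap.inr ℝ _ _) (ContinuousLinearMap.inl ℝ _ _)

/-- The embedding of the observation noises. -/
noncomputable def noiseCLM (m g q : ℕ) : (Fin q → ℂ) →L[ℝ] Carrier m g q :=
  ContinuousLinearMap.comp (ContinuousLinearMap.inr ℝ _ _) (ContinuousLinearMap.inr ℝ _ _)

/-- The primitive random variables with values in a common space. -/
def padded {Ω : Type*} {m g q : ℕ} (x₀ : Ω → Fin m → ℂ) (w : ℕ → Ω → Fin g → ℂ)
    (v : ℕ → Ω → Fin q → ℂ) : Source → Ω → Carrier m g q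
  | .init, ω => (x₀ ω, 0, 0)
  | .disturbance n, ω => (0, w n ω, 0)
  | .noise n, ω => (0, 0, v n ω)
  | .channel _, _ => 0

/-- A family of inputs and output noises as a family of values of the primitive variables. -/
def target {m g q : ℕ} (u : ℕ → Fin g → ℂ) (e : ℕ → Fin q → ℂ) : Source → Carrier m g q
  | .init => 0
  | .disturbance n => (0, u n, 0)
  | .noise n => (0, 0, e n)
  | .channel _ => 0

open Classical in
/-- The Gaussian primitive variables up to time `n`. -/
noncomputable def horizon (n : ℕ) : Finset Source :=
  insert .init ((Finset.range n).image .disturbance ∪ (Finset.range n).image .noise)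

lemma sum_horizon {M : Type*} [AddCommMonoid M] (f : Source → M) (n : ℕ) :
    ∑ s ∈ horizon n, f s = f .init +
      (∑ t ∈ Finset.range n, f (.disturbance t) + ∑ t ∈ Finset.range n, f (.noise t)) := by
  classical
  rw [horizon, Finset.sum_insert (by simp), Finset.sum_union, Finset.sum_image, Finset.sum_image]
  · intro a _ b _ h; injection h
  · intro a _ b _ h; injection h
  · rw [Finset.disjoint_left]
    intro s hs hs'
    obtain ⟨a, _, rfl⟩ := Finset.mem_image.1 hs
    obtain ⟨b, _, hb⟩ := Finset.mem_image.1 hs'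
    cases hb

lemma init_mem_horizon (n : ℕ) : Source.init ∈ horizon n := by simp [horizon]

lemma disturbance_mem_horizon {k n : ℕ} (h : k < n) : Source.disturbance k ∈ horizon n := by
  simp [horizon, h]

lemma noise_mem_horizon {k n : ℕ} (h : k < n) : Source.noise k ∈ horizon n := by
  simp [horizon, h]

/-- `Y` is a real-linear function of the primitive variables in `S`. -/
def IsNoiseLinear {Ω E : Type*} [NormedAddCommGroup E] [NormedSpace ℝ E] {m g q : ℕ}
    (x₀ : Ω → Fin m → ℂ) (w : ℕ → Ω → Fin g → ℂ) (v : ℕ → Ω → Fin q → ℂ) (S : Finset Source)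
    (Y : Ω → E) : Prop :=
  ∃ T : (S → Carrier m g q) →L[ℝ] E, ∀ ω, Y ω = T fun s => padded x₀ w v s ω

namespace IsNoiseLinear

variable {Ω E F : Type*} [NormedAddCommGroup E] [NormedSpace ℝ E] [NormedAddCommGroup F]
  [NormedSpace ℝ F] {m g q : ℕ} {x₀ : Ω → Fin m → ℂ} {w : ℕ → Ω → Fin g → ℂ}
  {v : ℕ → Ω → Fin q → ℂ} {S : Finset Source}

lemma clm {Y : Ω → E} (h : IsNoiseLinear x₀ w v S Y) (L : E →L[ℝ] F) :
    IsNoiseLinear x₀ w v S fun ω => L (Y ω) := by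
  obtain ⟨T, hT⟩ := h
  exact ⟨L ∘L T, fun ω => congrArg L (hT ω)⟩

lemma add {Y Z : Ω → E} (hY : IsNoiseLinear x₀ w v S Y) (hZ : IsNoiseLinear x₀ w v S Z) :
    IsNoiseLinear x₀ w v S fun ω => Y ω + Z ω := by
  obtain ⟨T, hT⟩ := hY
  obtain ⟨T', hT'⟩ := hZ
  exact ⟨T + T', fun ω => congrArg₂ (· + ·) (hT ω) (hT' ω)⟩

lemma prodMk {Y : Ω → E} {Z : Ω → F} (hY : IsNoiseLinear x₀ w v S Y)
    (hZ : IsNoiseLinear x₀ w v S Z) : IsNoiseLinear x₀ w v S fun ω => (Y ω, Z ω) := by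
  obtain ⟨T, hT⟩ := hY
  obtain ⟨T', hT'⟩ := hZ
  exact ⟨T.prod T', fun ω => Prod.ext (hT ω) (hT' ω)⟩

lemma pi {ι : Type*} [Fintype ι] {Y : ι → Ω → E} (hY : ∀ i, IsNoiseLinear x₀ w v S (Y i)) :
    IsNoiseLinear x₀ w v S fun ω i => Y i ω := by
  choose T hT using hY
  exact ⟨ContinuousLinearMap.pi T, fun ω => by ext1 i; exact hT i ω⟩

lemma zero : IsNoiseLinear x₀ w v S fun _ => (0 : E) := ⟨0, fun _ => rfl⟩

lemma sum {ι : Type*} (s : Finset ι) {Y : ι → Ω → E}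
    (hY : ∀ i ∈ s, IsNoiseLinear x₀ w v S (Y i)) :
    IsNoiseLinear x₀ w v S fun ω => ∑ i ∈ s, Y i ω := by
  classical
  induction s using Finset.induction_on with
  | empty => simpa using zero
  | insert a s ha ih =>
    simp only [Finset.sum_insert ha]
    exact (hY a (Finset.mem_insert_self _ _)).add
      (ih fun i hi => hY i (Finset.mem_insert_of_mem hi))

lemma padded {s : Source} (hs : s ∈ S) : IsNoiseLinear x₀ w v S (padded x₀ w v s) :=
  ⟨ContinuousLinearMap.proj (⟨s, hs⟩ : S), fun _ => rfl⟩

end IsNoiseLinear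

/-- The matrix `M` as a real-linear continuous map. -/
noncomputable def mulVecCLM {r s : ℕ} (M : Matrix (Fin r) (Fin s) ℂ) :
    (Fin s → ℂ) →L[ℝ] (Fin r → ℂ) :=
  (Matrix.mulVecLin M).toContinuousLinearMap.restrictScalars ℝ

section

variable {Ω : Type*} {m g q : ℕ} {A : Matrix (Fin m) (Fin m) ℂ} {B : Matrix (Fin m) (Fin g) ℂ}
  {x₀ : Ω → Fin m → ℂ} {w : ℕ → Ω → Fin g → ℂ} {v : ℕ → Ω → Fin q → ℂ}

lemma isNoiseLinear_disturbance {k n : ℕ} (h : k < n) : IsNoiseLinear x₀ w v (horizon n) (w k) :=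
  (IsNoiseLinear.padded (disturbance_mem_horizon h)).clm
    (ContinuousLinearMap.fst ℝ _ _ ∘L ContinuousLinearMap.snd ℝ _ _)

lemma isNoiseLinear_noise {k n : ℕ} (h : k < n) : IsNoiseLinear x₀ w v (horizon n) (v k) :=
  (IsNoiseLinear.padded (noise_mem_horizon h)).clm
    (ContinuousLinearMap.snd ℝ _ _ ∘L ContinuousLinearMap.snd ℝ _ _)

lemma isNoiseLinear_state {k n : ℕ} (h : k ≤ n) :
    IsNoiseLinear x₀ w v (horizon n) (state A B x₀ w k) := by
  induction k with
  | zero => exact (IsNoiseLinear.padded (init_mem_horizon n)).clm (ContinuousLinearMap.fst ℝ _ _)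
  | succ k ih =>
    exact ((ih (by omega)).clm (mulVecCLM A)).add
      ((isNoiseLinear_disturbance (by omega)).clm (mulVecCLM B))

end

/-- The state reached from `0` with the inputs `u`. -/
def response {m g : ℕ} (A : Matrix (Fin m) (Fin m) ℂ) (B : Matrix (Fin m) (Fin g) ℂ)
    (u : ℕ → Fin g → ℂ) : ℕ → Fin m → ℂ
  | 0 => 0
  | n + 1 => A.mulVec (response A B u n) + B.mulVec (u n)

/-- The sum of the squares of all coordinates. -/
noncomputable def sqSum {m g q : ℕ} (z : Carrier m g q) : ℝ :=
  ∑ i, ‖z.1 i‖ ^ 2 + (∑ i, ‖z.2.1 i‖ ^ 2 + ∑ i, ‖z.2.2 i‖ ^ 2)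

namespace IsIntermittentSystem

variable {Ω : Type*} [MeasurableSpace Ω] {P : Measure Ω} [IsProbabilityMeasure P] {m g q : ℕ}
  {A : Matrix (Fin m) (Fin m) ℂ} {B : Matrix (Fin m) (Fin g) ℂ} {C : Matrix (Fin q) (Fin m) ℂ}
  {σ σ' pe : ℝ} {x₀ : Ω → Fin m → ℂ} {w : ℕ → Ω → Fin g → ℂ} {v : ℕ → Ω → Fin q → ℂ}
  {β : ℕ → Ω → Bool}

omit [IsProbabilityMeasure P] in
lemma hasGaussianLaw_padded (h : IsIntermittentSystem P A B C σ σ' pe x₀ w v β) (s : Source) :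
    HasGaussianLaw (padded x₀ w v s) P := by
  cases s with
  | init => exact h.gaussian_init.gaussian.map_fun (initCLM m g q)
  | disturbance n => exact (h.gaussian_disturbance n).gaussian.map_fun (disturbanceCLM m g q)
  | noise n => exact (h.gaussian_noise n).gaussian.map_fun (noiseCLM m g q)
  | channel n => exact h.gaussian_init.gaussian.map_fun (0 : (Fin m → ℂ) →L[ℝ] Carrier m g q)

omit [IsProbabilityMeasure P] in
lemma integral_padded (h : IsIntermittentSystem P A B C σ σ' pe x₀ w v β) (s : Source) :
    ∫ ω, padded x₀ w v s ω ∂P = 0 := by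
  cases s with
  | init => exact h.gaussian_init.integral_clm_eq_zero (initCLM m g q)
  | disturbance n => exact (h.gaussian_disturbance n).integral_clm_eq_zero (disturbanceCLM m g q)
  | noise n => exact (h.gaussian_noise n).integral_clm_eq_zero (noiseCLM m g q)
  | channel n => simp [padded]

omit [MeasurableSpace Ω] in
lemma measurable_padded_sourceSigma (s : Source) :
    Measurable[sourceSigma x₀ w v β s] (padded x₀ w v s) := by
  cases s with
  | init => exact (initCLM m g q).continuous.measurable.comp (comap_measurable x₀)
  | disturbance n =>
    exact (disturbanceCLM m g q).continuous.measurable.comp (comap_measurable (w n))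
  | noise n => exact (noiseCLM m g q).continuous.measurable.comp (comap_measurable (v n))
  | channel n => exact measurable_const

omit [IsProbabilityMeasure P] in
lemma iIndepFun_padded (h : IsIntermittentSystem P A B C σ σ' pe x₀ w v β) :
    iIndepFun (padded x₀ w v) P :=
  iIndep_of_iIndep_of_le h.indep fun s => (measurable_padded_sourceSigma s).comap_le

omit [MeasurableSpace Ω] in
lemma measurable_padded_noiseSigma (s : Source) :
    Measurable[noiseSigma x₀ w v β] (padded x₀ w v s) := by
  by_cases hs : s ∈ noiseSources
  · exact (measurable_padded_sourceSigma (β := β) s).mono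
      (sourceSigma_le_noiseSigma x₀ w v β hs) le_rfl
  · simp only [noiseSources, Set.mem_ofPred_eq, ne_eq, not_forall, not_not] at hs
    obtain ⟨k, rfl⟩ := hs
    exact measurable_const

variable {E : Type*} [NormedAddCommGroup E] [NormedSpace ℝ E] [MeasurableSpace E] [BorelSpace E]

omit [MeasurableSpace Ω] in
lemma measurable_of_isNoiseLinear {S : Finset Source} {Y : Ω → E}
    (hY : IsNoiseLinear x₀ w v S Y) : Measurable[noiseSigma x₀ w v β] Y := by
  obtain ⟨T, hT⟩ := hY
  have : Y = T ∘ fun ω (s : S) => padded x₀ w v s ω := by ext1 ω; exact hT ω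
  rw [this]
  exact T.continuous.measurable.comp
    (@measurable_pi_lambda Ω S _ (noiseSigma x₀ w v β) _ _ fun s =>
      measurable_padded_noiseSigma (s : Source))

omit [IsProbabilityMeasure P] in
lemma hasGaussianLaw_of_isNoiseLinear (h : IsIntermittentSystem P A B C σ σ' pe x₀ w v β)
    {S : Finset Source} {Y : Ω → E} (hY : IsNoiseLinear x₀ w v S Y) : HasGaussianLaw Y P := by
  obtain ⟨T, hT⟩ := hY
  have h1 : iIndepFun (fun s : S => padded x₀ w v s) P :=
    h.iIndepFun_padded.precomp Subtype.val_injective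
  have h2 := (iIndepFun.hasGaussianLaw (X := fun s : S => padded x₀ w v s)
    (fun s => h.hasGaussianLaw_padded s) h1).map_fun T
  exact h2.congr (Filter.Eventually.of_forall fun ω => (hT ω).symm)

omit [IsProbabilityMeasure P] [MeasurableSpace E] [BorelSpace E] in
lemma integral_of_isNoiseLinear [CompleteSpace E]
    (h : IsIntermittentSystem P A B C σ σ' pe x₀ w v β)
    {S : Finset Source} {Y : Ω → E} (hY : IsNoiseLinear x₀ w v S Y) : ∫ ω, Y ω ∂P = 0 := by
  obtain ⟨T, hT⟩ := hY
  have h1 : iIndepFun (fun s : S => padded x₀ w v s) P :=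
    h.iIndepFun_padded.precomp Subtype.val_injective
  have h2 := iIndepFun.hasGaussianLaw (X := fun s : S => padded x₀ w v s)
    (fun s => h.hasGaussianLaw_padded s) h1
  simp only [hT]
  rw [ContinuousLinearMap.integral_comp_comm T h2.integrable]
  have h3 : ∫ ω, (fun s : S => padded x₀ w v s ω) ∂P = 0 := by
    ext1 s
    exact (eval_integral (fun s : S => (h.hasGaussianLaw_padded (s : Source)).integrable) s).trans
      (h.integral_padded s)
  rw [h3, map_zero]

/-- A linear functional of the noise is independent of the linear functions of the noise with
which it is uncorrelated. -/
lemma indepFun_of_integral_smul_eq_zero [CompleteSpace E] [SecondCountableTopology E]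
    (h : IsIntermittentSystem P A B C σ σ' pe x₀ w v β) {S : Finset Source} {ζ : Ω → ℝ} {Y : Ω → E}
    (hζ : IsNoiseLinear x₀ w v S ζ) (hY : IsNoiseLinear x₀ w v S Y)
    (h0 : ∫ ω, ζ ω • Y ω ∂P = 0) : IndepFun ζ Y P := by
  refine (h.hasGaussianLaw_of_isNoiseLinear (hζ.prodMk hY)).indepFun_of_covariance_strongDual
    fun L₁ L₂ => ?_
  have hζ2 : MemLp ζ 2 P := (h.hasGaussianLaw_of_isNoiseLinear hζ).memLp_two
  have hY2 : MemLp Y 2 P := (h.hasGaussianLaw_of_isNoiseLinear hY).memLp_two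
  have h1 : ∫ ω, ζ ω ∂P = 0 := h.integral_of_isNoiseLinear hζ
  have hL1 : ∀ x, L₁ x = L₁ 1 * x := fun x => by
    have := L₁.map_smul x 1
    simpa [mul_comm] using this
  have hm1 : MemLp (L₁ ∘ ζ) 2 P := L₁.comp_memLp' hζ2
  have hm2 : MemLp (L₂ ∘ Y) 2 P := L₂.comp_memLp' hY2
  rw [covariance_eq_sub hm1 hm2]
  -- As `ζ` is real, `E[ζ Y] = 0` makes it uncorrelated with every real functional of `Y`, hence
  -- with real and imaginary parts alike.
  have h2 : P[(L₁ ∘ ζ) * (L₂ ∘ Y)] = L₁ 1 * L₂ (∫ ω, ζ ω • Y ω ∂P) := by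
    have hi : Integrable (fun ω => ζ ω • Y ω) P := memLp_one_iff_integrable.1 (hY2.smul hζ2)
    rw [← ContinuousLinearMap.integral_comp_comm L₂ hi, ← integral_const_mul]
    refine integral_congr_ae (Filter.Eventually.of_forall fun ω => ?_)
    simp only [Pi.mul_apply, Function.comp_apply, map_smul, smul_eq_mul]
    rw [hL1]; ring
  have h3 : P[L₁ ∘ ζ] = 0 := by
    have : ∫ ω, L₁ (ζ ω) ∂P = L₁ (∫ ω, ζ ω ∂P) :=
      ContinuousLinearMap.integral_comp_comm L₁ (h.hasGaussianLaw_of_isNoiseLinear hζ).integrable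
    rw [h1, map_zero] at this
    exact this
  rw [h2, h3, h0]
  simp

end IsIntermittentSystem

end IntermittentKalman

namespace IntermittentKalman

/-! ### Functionals of the noise with prescribed correlations -/

lemma IsCenteredGaussian.exists_functional_comp {Ω E : Type*} [MeasurableSpace Ω] {P : Measure Ω}
    [IsProbabilityMeasure P] [NormedAddCommGroup E] [NormedSpace ℝ E] [CompleteSpace E]
    {k : ℕ}
    {X : Ω → Fin k → ℂ} (hX : IsCenteredGaussian P X) {σ' : ℝ} (hσ' : 0 < σ')
    (h : (secondMoment P X - (σ' ^ 2 : ℂ) • (1 : Matrix (Fin k) (Fin k) ℂ)).PosSemidef)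
    (d : Fin k → ℂ) (hd : IsProperOrReal P X d) (ι : (Fin k → ℂ) →L[ℝ] E)
    (ρ : E →L[ℝ] (Fin k → ℂ)) (hρ : ∀ x, ρ (ι x) = x) :
    ∃ a : E →L[ℝ] ℝ, ∫ ω, a (ι (X ω)) • ι (X ω) ∂P = ι d ∧
      ∫ ω, a (ι (X ω)) ^ 2 ∂P ≤ 2 / σ' ^ 2 * ∑ j, ‖d j‖ ^ 2 := by
  obtain ⟨a, ha, ha2⟩ := hX.exists_functional hσ' h d hd
  refine ⟨a ∘L ρ, ?_, by simpa [hρ] using ha2⟩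
  have hX2 : MemLp X 2 P := hX.gaussian.memLp_two
  have haX : MemLp (fun ω => a (X ω)) 2 P := (hX.gaussian.map_fun a).memLp_two
  have hi : Integrable (fun ω => a (X ω) • X ω) P := memLp_one_iff_integrable.1 (hX2.smul haX)
  have h1 : ∫ ω, a (X ω) • X ω ∂P = d := by
    ext1 j
    rw [eval_integral (fun i => hi.eval i) j, ← ha j]
    simp
  have h2 : ∫ ω, ι (a (X ω) • X ω) ∂P = ι d := by
    rw [ContinuousLinearMap.integral_comp_comm ι hi, h1]
  simpa [hρ] using h2

/-- The linear functional `∑ α_s(G_s)` of the primitive Gaussian variables `G_s`. -/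
noncomputable def functional {Ω : Type*} {m g q : ℕ} (x₀ : Ω → Fin m → ℂ) (w : ℕ → Ω → Fin g → ℂ)
    (v : ℕ → Ω → Fin q → ℂ) (α : Source → Carrier m g q →L[ℝ] ℝ) (n : ℕ) (ω : Ω) : ℝ :=
  ∑ s ∈ horizon n, α s (padded x₀ w v s ω)

lemma isNoiseLinear_functional {Ω : Type*} {m g q : ℕ} (x₀ : Ω → Fin m → ℂ)
    (w : ℕ → Ω → Fin g → ℂ) (v : ℕ → Ω → Fin q → ℂ) (α : Source → Carrier m g q →L[ℝ] ℝ) (n : ℕ) :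
    IsNoiseLinear x₀ w v (horizon n) (functional x₀ w v α n) :=
  IsNoiseLinear.sum _ fun s hs => (IsNoiseLinear.padded hs).clm (α s)

namespace IsIntermittentSystem

variable {Ω : Type*} [MeasurableSpace Ω] {P : Measure Ω} [IsProbabilityMeasure P] {m g q : ℕ}
  {A : Matrix (Fin m) (Fin m) ℂ} {B : Matrix (Fin m) (Fin g) ℂ} {C : Matrix (Fin q) (Fin m) ℂ}
  {σ σ' pe : ℝ} {x₀ : Ω → Fin m → ℂ} {w : ℕ → Ω → Fin g → ℂ} {v : ℕ → Ω → Fin q → ℂ}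
  {β : ℕ → Ω → Bool}

/-- Assigning the zero functional to a zero target makes functionals with disjoint targets exactly
orthogonal. The target at the initial state is zero, so no lower bound for its covariance is needed.
-/
lemma exists_functional_padded (h : IsIntermittentSystem P A B C σ σ' pe x₀ w v β) (hσ' : 0 < σ')
    {u : ℕ → Fin g → ℂ} {e : ℕ → Fin q → ℂ} (hu : ∀ k, IsProperOrReal P (w k) (u k))
    (he : ∀ k, IsProperOrReal P (v k) (e k)) (s : Source) :
    ∃ a : Carrier m g q →L[ℝ] ℝ, (target u e s = (0 : Carrier m g q) → a = 0) ∧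
      ∫ ω, a (padded x₀ w v s ω) • padded x₀ w v s ω ∂P = target u e s ∧
      ∫ ω, a (padded x₀ w v s ω) ^ 2 ∂P ≤ 2 / σ' ^ 2 * sqSum (target u e s : Carrier m g q) := by
  by_cases h0 : target u e s = (0 : Carrier m g q)
  · exact ⟨0, fun _ => rfl, by simp [h0], by simp [h0, sqSum]⟩
  cases s with
  | init => exact (h0 rfl).elim
  | channel n => exact (h0 rfl).elim
  | disturbance n =>
    obtain ⟨a, ha, ha2⟩ := (h.gaussian_disturbance n).exists_functional_comp hσ'
      (h.lower_disturbance n) (u n) (hu n) (disturbanceCLM m g q)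
      (ContinuousLinearMap.comp (ContinuousLinearMap.fst ℝ _ _) (ContinuousLinearMap.snd ℝ _ _))
      fun _ => rfl
    refine ⟨a, fun h => (h0 h).elim, ha, ha2.trans_eq ?_⟩
    simp [sqSum, target]
  | noise n =>
    obtain ⟨a, ha, ha2⟩ := (h.gaussian_noise n).exists_functional_comp hσ'
      (h.lower_noise n) (e n) (he n) (noiseCLM m g q)
      (ContinuousLinearMap.comp (ContinuousLinearMap.snd ℝ _ _) (ContinuousLinearMap.snd ℝ _ _))
      fun _ => rfl
    refine ⟨a, fun h => (h0 h).elim, ha, ha2.trans_eq ?_⟩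
    simp [sqSum, target]

variable {E F : Type*} [NormedAddCommGroup E] [NormedSpace ℝ E] [NormedAddCommGroup F]
  [NormedSpace ℝ F]

omit [IsProbabilityMeasure P] in
lemma memLp_of_isNoiseLinear [CompleteSpace E] [SecondCountableTopology E]
    (h : IsIntermittentSystem P A B C σ σ' pe x₀ w v β)
    {S : Finset Source} {Y : Ω → E} (hY : IsNoiseLinear x₀ w v S Y) : MemLp Y 2 P := by
  borelize E
  exact (h.hasGaussianLaw_of_isNoiseLinear hY).memLp_two

omit [IsProbabilityMeasure P] in
lemma integrable_smul_of_isNoiseLinear [CompleteSpace E] [SecondCountableTopology E]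
    (h : IsIntermittentSystem P A B C σ σ' pe x₀ w v β) {S : Finset Source} {ζ : Ω → ℝ} {Y : Ω → E}
    (hζ : IsNoiseLinear x₀ w v S ζ) (hY : IsNoiseLinear x₀ w v S Y) :
    Integrable (fun ω => ζ ω • Y ω) P :=
  memLp_one_iff_integrable.1 ((h.memLp_of_isNoiseLinear hY).smul (h.memLp_of_isNoiseLinear hζ))

omit [IsProbabilityMeasure P] in
lemma integral_smul_clm [CompleteSpace E] [SecondCountableTopology E] [CompleteSpace F]
    (h : IsIntermittentSystem P A B C σ σ' pe x₀ w v β) {S : Finset Source} {ζ : Ω → ℝ} {Y : Ω → E}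
    (hζ : IsNoiseLinear x₀ w v S ζ) (hY : IsNoiseLinear x₀ w v S Y) (L : E →L[ℝ] F) :
    ∫ ω, ζ ω • L (Y ω) ∂P = L (∫ ω, ζ ω • Y ω ∂P) := by
  rw [← ContinuousLinearMap.integral_comp_comm L (h.integrable_smul_of_isNoiseLinear hζ hY)]
  simp

omit [IsProbabilityMeasure P] in
lemma integral_smul_padded_of_ne (h : IsIntermittentSystem P A B C σ σ' pe x₀ w v β)
    (a : Carrier m g q →L[ℝ] ℝ) {s s' : Source} (hs : s ≠ s') :
    ∫ ω, a (padded x₀ w v s ω) • padded x₀ w v s' ω ∂P = 0 := by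
  have h1 : IndepFun (fun ω => a (padded x₀ w v s ω)) (padded x₀ w v s') P :=
    (h.iIndepFun_padded.indepFun hs).comp a.continuous.measurable measurable_id
  rw [h1.integral_fun_smul_eq_smul_integral
    ((h.hasGaussianLaw_padded s).map_fun a).integrable.aestronglyMeasurable
    (h.hasGaussianLaw_padded s').integrable.aestronglyMeasurable, h.integral_padded, smul_zero]

omit [IsProbabilityMeasure P] in
lemma integral_functional_smul_padded (h : IsIntermittentSystem P A B C σ σ' pe x₀ w v β)
    (α : Source → Carrier m g q →L[ℝ] ℝ) {n : ℕ} {s : Source} (hs : s ∈ horizon n) :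
    ∫ ω, functional x₀ w v α n ω • padded x₀ w v s ω ∂P =
      ∫ ω, α s (padded x₀ w v s ω) • padded x₀ w v s ω ∂P := by
  simp only [functional, Finset.sum_smul]
  rw [integral_finsetSum _ fun s' hs' => h.integrable_smul_of_isNoiseLinear
    ((IsNoiseLinear.padded hs').clm (α s')) (IsNoiseLinear.padded hs)]
  exact Finset.sum_eq_single_of_mem s hs fun s' _ hne => h.integral_smul_padded_of_ne (α s') hne

-- Different sources are independent and centered, so the inner product reduces to its diagonal
-- terms.
omit [IsProbabilityMeasure P] in
lemma integral_functional_mul_functional (h : IsIntermittentSystem P A B C σ σ' pe x₀ w v β)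
    (α α' : Source → Carrier m g q →L[ℝ] ℝ) (n : ℕ) :
    ∫ ω, functional x₀ w v α n ω * functional x₀ w v α' n ω ∂P =
      ∑ s ∈ horizon n, α' s (∫ ω, α s (padded x₀ w v s ω) • padded x₀ w v s ω ∂P) := by
  have h1 : ∀ ω, functional x₀ w v α n ω * functional x₀ w v α' n ω =
      ∑ s ∈ horizon n, functional x₀ w v α n ω • α' s (padded x₀ w v s ω) := fun ω => by
    rw [← Finset.smul_sum]; rfl
  simp only [h1]
  rw [integral_finsetSum _ fun s hs => h.integrable_smul_of_isNoiseLinear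
    (isNoiseLinear_functional x₀ w v α n) ((IsNoiseLinear.padded hs).clm (α' s))]
  refine Finset.sum_congr rfl fun s hs => ?_
  rw [h.integral_smul_clm (isNoiseLinear_functional x₀ w v α n) (IsNoiseLinear.padded hs),
    h.integral_functional_smul_padded α hs]

/-- There are linear functionals of the noise whose correlations with the states and the output
noises are those of a deterministic trajectory. -/
lemma exists_correlated (h : IsIntermittentSystem P A B C σ σ' pe x₀ w v β) (hσ' : 0 < σ')
    {ι : Type*} {u : ι → ℕ → Fin g → ℂ} {e : ι → ℕ → Fin q → ℂ}
    (hu : ∀ j k, IsProperOrReal P (w k) (u j k)) (he : ∀ j k, IsProperOrReal P (v k) (e j k))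
    (n : ℕ) :
    ∃ ζ : ι → Ω → ℝ, (∀ j, IsNoiseLinear x₀ w v (horizon n) (ζ j)) ∧
      (∀ j k, k ≤ n → ∫ ω, ζ j ω • state A B x₀ w k ω ∂P = response A B (u j) k) ∧
      (∀ j k, k < n → ∫ ω, ζ j ω • v k ω ∂P = e j k) ∧
      (∀ j j', (∀ s, target (u j) (e j) s = (0 : Carrier m g q) ∨
        target (u j') (e j') s = (0 : Carrier m g q)) → ∫ ω, ζ j ω * ζ j' ω ∂P = 0) ∧
      ∀ j, ∫ ω, ζ j ω ^ 2 ∂P ≤ 2 / σ' ^ 2 *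
        (∑ k ∈ Finset.range n, ∑ i, ‖u j k i‖ ^ 2 + ∑ k ∈ Finset.range n, ∑ i, ‖e j k i‖ ^ 2) := by
  choose α hα0 hα hα2 using fun j => h.exists_functional_padded hσ' (hu j) (he j)
  set ζ := fun j => functional x₀ w v (α j) n with hζ
  have hlin : ∀ j, IsNoiseLinear x₀ w v (horizon n) (ζ j) := fun j =>
    isNoiseLinear_functional x₀ w v (α j) n
  have hcor : ∀ j s, s ∈ horizon n →
      ∫ ω, ζ j ω • padded x₀ w v s ω ∂P = target (u j) (e j) s := fun j s hs =>
    (h.integral_functional_smul_padded (α j) hs).trans (hα j s)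
  refine ⟨ζ, hlin, fun j k hk => ?_, fun j k hk => ?_, fun j j' hj => ?_, fun j => ?_⟩
  · induction k with
    | zero =>
      have := h.integral_smul_clm (hlin j) (IsNoiseLinear.padded (init_mem_horizon n))
        (ContinuousLinearMap.fst ℝ _ _)
      rw [hcor j _ (init_mem_horizon n)] at this
      exact this
    | succ k ih =>
      have hx := isNoiseLinear_state (A := A) (B := B) (x₀ := x₀) (w := w) (v := v)
        (show k ≤ n by omega)
      have hw := isNoiseLinear_disturbance (x₀ := x₀) (w := w) (v := v) (show k < n by omega)
      have hw' : ∫ ω, ζ j ω • w k ω ∂P = u j k := by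
        have := h.integral_smul_clm (hlin j)
          (IsNoiseLinear.padded (disturbance_mem_horizon (show k < n by omega)))
          (ContinuousLinearMap.comp (ContinuousLinearMap.fst ℝ _ _) (ContinuousLinearMap.snd ℝ _ _))
        rw [hcor j _ (disturbance_mem_horizon (show k < n by omega))] at this
        exact this
      have h1 := h.integral_smul_clm (hlin j) hx (mulVecCLM A)
      have h2 := h.integral_smul_clm (hlin j) hw (mulVecCLM B)
      rw [ih (by omega)] at h1
      rw [hw'] at h2
      simp only [state, smul_add, response]
      exact (integral_add (h.integrable_smul_of_isNoiseLinear (hlin j) (hx.clm (mulVecCLM A)))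
        (h.integrable_smul_of_isNoiseLinear (hlin j) (hw.clm (mulVecCLM B)))).trans
        (congrArg₂ (· + ·) h1 h2)
  · have := h.integral_smul_clm (hlin j) (IsNoiseLinear.padded (noise_mem_horizon hk))
      (ContinuousLinearMap.comp (ContinuousLinearMap.snd ℝ _ _) (ContinuousLinearMap.snd ℝ _ _))
    rw [hcor j _ (noise_mem_horizon hk)] at this
    exact this
  · rw [hζ, h.integral_functional_mul_functional]
    refine Finset.sum_eq_zero fun s _ => ?_
    rw [hα]
    rcases hj s with hs | hs
    · rw [hs, map_zero]
    · rw [hα0 j' s hs, zero_apply]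
  · have h1 : ∀ s ∈ horizon n, α j s (∫ ω, α j s (padded x₀ w v s ω) • padded x₀ w v s ω ∂P) ≤
        2 / σ' ^ 2 * sqSum (target (u j) (e j) s : Carrier m g q) := fun s hs => by
      have hs' := IsNoiseLinear.padded (x₀ := x₀) (w := w) (v := v) hs
      rw [← h.integral_smul_clm (hs'.clm (α j s)) hs']
      simpa only [smul_eq_mul, ← sq] using hα2 j s
    simp only [sq (ζ j _)]
    refine (h.integral_functional_mul_functional (α j) (α j) n).trans_le
      ((Finset.sum_le_sum h1).trans_eq ?_)
    rw [← Finset.mul_sum, sum_horizon]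
    simp [sqSum, target]

end IsIntermittentSystem

end IntermittentKalman

namespace IntermittentKalman

/-! ### A lower bound for the estimation error -/

/-- Bessel's inequality for an orthogonal family of real random variables. -/
lemma sum_le_integral_norm_sq {Ω ι : Type*} [MeasurableSpace Ω] {P : Measure Ω} [Fintype ι]
    {f : Ω → ℂ} (hf : MemLp f 2 P) {φ : ι → Ω → ℝ} (hφ : ∀ j, MemLp (φ j) 2 P)
    (horth : ∀ j j', j ≠ j' → ∫ ω, φ j ω * φ j' ω ∂P = 0) (b : ι → ℂ) :
    ∑ j, (2 * (star (b j) * ∫ ω, φ j ω • f ω ∂P).re - ‖b j‖ ^ 2 * ∫ ω, φ j ω ^ 2 ∂P) ≤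
      ∫ ω, ‖f ω‖ ^ 2 ∂P := by
  classical
  have hi1 : ∀ j, Integrable (fun ω => φ j ω • f ω) P := fun j =>
    memLp_one_iff_integrable.1 (hf.smul (hφ j))
  have hi2 : ∀ j j', Integrable (fun ω => φ j ω * φ j' ω) P := fun j j' =>
    (hφ j).integrable_mul (hφ j')
  have hi3 : Integrable (fun ω => ‖f ω‖ ^ 2) P := hf.integrable_norm_pow (by norm_num)
  -- This expands `|f - ∑ b_j φ_j|² ≥ 0`. Free coefficients `b_j` avoid a division by `E[φ_j²]`, for
  -- which only an upper bound will be available.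
  have hpt : ∀ ω, ∑ j, 2 * (star (b j) * φ j ω • f ω).re -
      ∑ j, ∑ j', (star (b j) * b j').re * (φ j ω * φ j' ω) ≤ ‖f ω‖ ^ 2 := by
    intro ω
    set s : ℂ := ∑ j, b j * φ j ω with hs
    have h1 : ∑ j, 2 * (star (b j) * φ j ω • f ω).re = 2 * (star s * f ω).re := by
      rw [hs, star_sum, Finset.sum_mul, Complex.re_sum, Finset.mul_sum]
      refine Finset.sum_congr rfl fun j _ => ?_
      rw [Complex.real_smul, star_mul', RCLike.star_def, Complex.conj_ofReal,
        mul_assoc]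
    have h2 : ∑ j, ∑ j', (star (b j) * b j').re * (φ j ω * φ j' ω) = (star s * s).re := by
      rw [hs, star_sum, Finset.sum_mul, Complex.re_sum]
      refine Finset.sum_congr rfl fun j _ => ?_
      rw [Finset.mul_sum, Complex.re_sum]
      refine Finset.sum_congr rfl fun j' _ => ?_
      rw [star_mul', RCLike.star_def, Complex.conj_ofReal, ← Complex.re_mul_ofReal]
      congr 1
      push_cast
      ring
    have h3 : (0 : ℝ) ≤ ‖f ω - s‖ ^ 2 := sq_nonneg _
    rw [h1, h2]
    rw [← Complex.normSq_eq_norm_sq] at h3 ⊢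
    simp only [Complex.normSq_apply, Complex.sub_re, Complex.sub_im, Complex.mul_re,
      RCLike.star_def, Complex.conj_re, Complex.conj_im] at h3 ⊢
    linarith
  have hi4 : ∀ j, Integrable (fun ω => 2 * (star (b j) * φ j ω • f ω).re) P := fun j =>
    (((hi1 j).const_mul (star (b j))).re).const_mul 2
  have hi5 : ∀ j j', Integrable (fun ω => (star (b j) * b j').re * (φ j ω * φ j' ω)) P :=
    fun j j' => (hi2 j j').const_mul _
  have key := integral_mono ((integrable_finsetSum _ fun j _ => hi4 j).sub
    (integrable_finsetSum _ fun j _ => integrable_finsetSum _ fun j' _ => hi5 j j')) hi3 hpt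
  refine le_trans (le_of_eq ?_) key
  rw [integral_sub' (integrable_finsetSum _ fun j _ => hi4 j)
    (integrable_finsetSum _ fun j _ => integrable_finsetSum _ fun j' _ => hi5 j j'),
    integral_finsetSum _ fun j _ => hi4 j,
    integral_finsetSum _ fun j _ => integrable_finsetSum _ fun j' _ => hi5 j j',
    Finset.sum_sub_distrib]
  congr 1
  · refine Finset.sum_congr rfl fun j _ => ?_
    rw [integral_const_mul, ← integral_const_mul]
    congr 1
    exact (integral_re (𝕜 := ℂ) ((hi1 j).const_mul (star (b j)))).symm
  · refine Finset.sum_congr rfl fun j _ => ?_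
    rw [integral_finsetSum _ fun j' _ => hi5 j j', Finset.sum_eq_single_of_mem j (Finset.mem_univ j)]
    · rw [integral_const_mul, RCLike.star_def, Complex.conj_mul']
      simp only [sq (φ j _)]
      norm_cast
    · intro j' _ hne
      rw [integral_const_mul, horth j j' hne.symm, mul_zero]

namespace IsIntermittentSystem

variable {Ω : Type*} [MeasurableSpace Ω] {P : Measure Ω} [IsProbabilityMeasure P] {m g q : ℕ}
  {A : Matrix (Fin m) (Fin m) ℂ} {B : Matrix (Fin m) (Fin g) ℂ} {C : Matrix (Fin q) (Fin m) ℂ}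
  {σ σ' pe : ℝ} {x₀ : Ω → Fin m → ℂ} {w : ℕ → Ω → Fin g → ℂ} {v : ℕ → Ω → Fin q → ℂ}
  {β : ℕ → Ω → Bool}

omit [IsProbabilityMeasure P] in
lemma setIntegral_channel {E : Type*} [NormedAddCommGroup E] [NormedSpace ℝ E] [MeasurableSpace E]
    [BorelSpace E] [SecondCountableTopology E]
    (h : IsIntermittentSystem P A B C σ σ' pe x₀ w v β) {X : Ω → E}
    (hX : Measurable[noiseSigma x₀ w v β] X) {S : Set Ω}
    (hS : MeasurableSet[channelSigma x₀ w v β] S) :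
    ∫ ω in S, X ω ∂P = P.real S • ∫ ω, X ω ∂P :=
  Indep.setIntegral_eq_smul (f := id) h.channelSigma_le
    (indep_of_indep_of_le_right h.indep_noise_channel.symm hX.comap_le)
    (hX.mono h.noiseSigma_le le_rfl).aemeasurable hS measurable_id.aestronglyMeasurable

omit [MeasurableSpace Ω] in
lemma measurableSet_erased (T : Finset ℕ) :
    MeasurableSet[channelSigma x₀ w v β] {ω | ∀ k ∈ T, β k ω = false} := by
  have : {ω | ∀ k ∈ T, β k ω = false} = ⋂ k ∈ T, β k ⁻¹' {false} := by
    ext ω; simp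
  rw [this]
  exact MeasurableSet.biInter T.countable_toSet fun k _ =>
    measurable_channel_channelSigma x₀ w v β k (measurableSet_singleton _)

/-- The outputs for a given erasure pattern. -/
noncomputable def patternOutput {Ω : Type*} {m q : ℕ} (C : Matrix (Fin q) (Fin m) ℂ)
    (x : ℕ → Ω → Fin m → ℂ) (v : ℕ → Ω → Fin q → ℂ) {n : ℕ} (p : Fin n → Bool) (ω : Ω)
    (k : Fin n) : Fin q → ℂ :=
  if p k then C.mulVec (x k ω) + v k ω else 0

omit [MeasurableSpace Ω] in
lemma isNoiseLinear_patternOutput {n : ℕ} (p : Fin n → Bool) :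
    IsNoiseLinear x₀ w v (horizon n) (patternOutput C (state A B x₀ w) v p) := by
  refine IsNoiseLinear.pi (Y := fun k ω => patternOutput C (state A B x₀ w) v p ω k) fun k => ?_
  unfold patternOutput
  split_ifs
  · exact ((isNoiseLinear_state k.2.le).clm (mulVecCLM C)).add (isNoiseLinear_noise k.2)
  · exact IsNoiseLinear.zero

/-- A functional that is uncorrelated with the outputs received outside `T` is, on the event that
the packets in `T` are erased, uncorrelated with every function of the observations. -/
lemma setIntegral_smul_observation_eq_zero (h : IsIntermittentSystem P A B C σ σ' pe x₀ w v β)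
    {n : ℕ} {ζ : Ω → ℝ} (hζ : IsNoiseLinear x₀ w v (horizon n) ζ) {T : Finset ℕ}
    (hT : ∀ k < n, k ∉ T → ∫ ω, ζ ω • (C.mulVec (state A B x₀ w k ω) + v k ω) ∂P = 0)
    {f : (Fin n → Fin q → ℂ) → ℂ} (hf : Measurable f)
    (hf2 : MemLp (fun ω => f fun k => observation C (state A B x₀ w) v β k ω) 2 P) :
    ∫ ω in {ω | ∀ k ∈ T, β k ω = false},
      ζ ω • f (fun k => observation C (state A B x₀ w) v β k ω) ∂P = 0 := by
  classical
  set G : Ω → ℂ := fun ω => ζ ω • f (fun k => observation C (state A B x₀ w) v β k ω) with hG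
  have hGi : Integrable G P :=
    memLp_one_iff_integrable.1 (hf2.smul (h.memLp_of_isNoiseLinear hζ))
  set E := {ω | ∀ k ∈ T, β k ω = false} with hE
  -- Splitting by the finitely many erasure patterns: on `R p` the outputs coincide with a fixed
  -- linear function of the noise.
  set R : (Fin n → Bool) → Set Ω := fun p => {ω | ∀ k : Fin n, β k ω = p k} with hR
  have hRc : ∀ p, MeasurableSet[channelSigma x₀ w v β] (R p) := fun p => by
    have : R p = ⋂ k : Fin n, β k ⁻¹' {p k} := by ext ω; simp [hR]
    rw [this]
    exact MeasurableSet.iInter fun k =>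
      measurable_channel_channelSigma x₀ w v β k (measurableSet_singleton _)
  have hEc : MeasurableSet[channelSigma x₀ w v β] E := measurableSet_erased T
  have hcover : ∀ ω, E.indicator G ω = ∑ p, (E ∩ R p).indicator G ω := by
    intro ω
    rw [Finset.sum_eq_single_of_mem (fun k : Fin n => β k ω) (Finset.mem_univ _)]
    · by_cases hω : ω ∈ E
      · have hω' : ω ∈ E ∩ R fun k : Fin n => β k ω := ⟨hω, fun _ => rfl⟩
        rw [Set.indicator_of_mem hω, Set.indicator_of_mem hω']
      · rw [Set.indicator_of_notMem hω, Set.indicator_of_notMem fun h => hω h.1]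
    · intro p _ hp
      exact Set.indicator_of_notMem (fun hω => hp (funext fun k => (hω.2 k).symm)) _
  have hm : ∀ p, MeasurableSet (E ∩ R p) := fun p =>
    h.channelSigma_le _ (hEc.inter (hRc p))
  change ∫ ω in E, G ω ∂P = 0
  rw [← integral_indicator (h.channelSigma_le _ hEc), integral_congr_ae (.of_forall hcover),
    integral_finsetSum _ fun p _ => hGi.indicator (hm p)]
  refine Finset.sum_eq_zero fun p _ => ?_
  rw [integral_indicator (hm p)]
  by_cases hp : ∀ k : Fin n, (k : ℕ) ∈ T → p k = false
  · set Y := patternOutput C (state A B x₀ w) v p with hY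
    have hYl : IsNoiseLinear x₀ w v (horizon n) Y := isNoiseLinear_patternOutput p
    have hcongr : ∫ ω in E ∩ R p, G ω ∂P = ∫ ω in E ∩ R p, ζ ω • f (Y ω) ∂P := by
      refine setIntegral_congr_fun (hm p) fun ω hω => ?_
      have : (fun k : Fin n => observation C (state A B x₀ w) v β k ω) = Y ω := by
        ext1 k
        simp only [observation, hY, patternOutput, hω.2 k]
      simp only [hG, this]
    have hζm : Measurable[noiseSigma x₀ w v β] ζ := measurable_of_isNoiseLinear hζ
    have hYm : Measurable[noiseSigma x₀ w v β] Y := measurable_of_isNoiseLinear hYl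
    have hsm : Measurable[noiseSigma x₀ w v β] fun ω => ζ ω • f (Y ω) :=
      (measurable_fst.smul measurable_snd : Measurable fun z : ℝ × ℂ => z.1 • z.2).comp
        (hζm.prodMk (hf.comp hYm))
    rw [hcongr, h.setIntegral_channel hsm (hEc.inter (hRc p))]
    have hzero : ∫ ω, ζ ω • Y ω ∂P = 0 := by
      ext1 k
      rw [eval_integral (fun i => (h.integrable_smul_of_isNoiseLinear hζ hYl).eval i) k]
      simp only [Pi.smul_apply, hY, patternOutput]
      by_cases hk : p k
      · simp only [hk, if_true]
        exact hT k k.2 fun hkT => by simp [hp k hkT] at hk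
      · simp [hk]
    -- Joint Gaussianity turns uncorrelatedness into independence, so that arbitrary measurable
    -- functions of the outputs are covered.
    have hind := h.indepFun_of_integral_smul_eq_zero hζ hYl hzero
    have hprod := (hind.comp measurable_id hf).integral_fun_smul_eq_smul_integral
      (hζm.mono h.noiseSigma_le le_rfl).aestronglyMeasurable
      ((hf.comp hYm).mono h.noiseSigma_le le_rfl).aestronglyMeasurable
    have hmean : ∫ ω, ζ ω ∂P = 0 := h.integral_of_isNoiseLinear hζ
    simp only [Function.comp_apply, id_eq] at hprod
    rw [hprod, hmean, zero_smul, smul_zero]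
  · push Not at hp
    obtain ⟨k, hkT, hk⟩ := hp
    have : E ∩ R p = ∅ := by
      rw [Set.eq_empty_iff_forall_notMem]
      rintro ω ⟨h1, h2⟩
      exact hk ((h2 k).symm.trans (h1 k hkT))
    rw [this, setIntegral_empty]

end IsIntermittentSystem

end IntermittentKalman

namespace IntermittentKalman

namespace IsIntermittentSystem

variable {Ω : Type*} [MeasurableSpace Ω] {P : Measure Ω} [IsProbabilityMeasure P] {m g q : ℕ}
  {A : Matrix (Fin m) (Fin m) ℂ} {B : Matrix (Fin m) (Fin g) ℂ} {C : Matrix (Fin q) (Fin m) ℂ}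
  {σ σ' pe : ℝ} {x₀ : Ω → Fin m → ℂ} {w : ℕ → Ω → Fin g → ℂ} {v : ℕ → Ω → Fin q → ℂ}
  {β : ℕ → Ω → Bool}

omit [IsProbabilityMeasure P] in
lemma measureReal_erased (h : IsIntermittentSystem P A B C σ σ' pe x₀ w v β) (T : Finset ℕ) :
    P.real {ω | ∀ k ∈ T, β k ω = false} = pe ^ T.card := by
  rw [Measure.real, h.measure_erased, ENNReal.toReal_pow, ENNReal.toReal_ofReal h.pe_nonneg]

omit [MeasurableSpace Ω] in
lemma measurable_mul_of_isNoiseLinear {S : Finset Source} {ζ ζ' : Ω → ℝ}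
    (hζ : IsNoiseLinear x₀ w v S ζ) (hζ' : IsNoiseLinear x₀ w v S ζ') :
    Measurable[noiseSigma x₀ w v β] fun ω => ζ ω * ζ' ω :=
  (measurable_fst.mul measurable_snd : Measurable fun z : ℝ × ℝ => z.1 * z.2).comp
    ((measurable_of_isNoiseLinear hζ).prodMk (measurable_of_isNoiseLinear hζ'))

omit [MeasurableSpace Ω] in
lemma measurable_smul_of_isNoiseLinear {S : Finset Source} {ζ : Ω → ℝ} {X : Ω → ℂ}
    (hζ : IsNoiseLinear x₀ w v S ζ) (hX : IsNoiseLinear x₀ w v S X) :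
    Measurable[noiseSigma x₀ w v β] fun ω => ζ ω • X ω :=
  (measurable_fst.smul measurable_snd : Measurable fun z : ℝ × ℂ => z.1 • z.2).comp
    ((measurable_of_isNoiseLinear hζ).prodMk (measurable_of_isNoiseLinear hX))

/-- Deterministic trajectories that are invisible to the observer while certain packets are erased
bound the estimation error of one coordinate from below. -/
lemma sum_le_integral_error_sq (h : IsIntermittentSystem P A B C σ σ' pe x₀ w v β)
    {ι : Type*} [Fintype ι] {n N : ℕ} (hnN : n ≤ N) {ζ : ι → Ω → ℝ}
    (hζ : ∀ j, IsNoiseLinear x₀ w v (horizon N) (ζ j)) {r : ι → Fin m → ℂ}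
    (hr : ∀ j, ∫ ω, ζ j ω • state A B x₀ w n ω ∂P = r j) {T : ι → Finset ℕ}
    (hT : ∀ j, ∀ k < N, k ∉ T j → ∫ ω, ζ j ω • (C.mulVec (state A B x₀ w k ω) + v k ω) ∂P = 0)
    (horth : ∀ j j', j ≠ j' → ∫ ω, ζ j ω * ζ j' ω ∂P = 0) {D : ℝ} (hD : 0 < D)
    (hζD : ∀ j, ∫ ω, ζ j ω ^ 2 ∂P ≤ D) (a : Fin m) {f : (Fin N → Fin q → ℂ) → ℂ}
    (hf : Measurable f)
    (hf2 : MemLp (fun ω => state A B x₀ w n ω a -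
      f fun k => observation C (state A B x₀ w) v β k ω) 2 P) :
    ∑ j, pe ^ (T j).card * ‖r j a‖ ^ 2 / D ≤ ∫ ω, ‖state A B x₀ w n ω a -
      f fun k => observation C (state A B x₀ w) v β k ω‖ ^ 2 ∂P := by
  have hxl : IsNoiseLinear x₀ w v (horizon N) fun ω => state A B x₀ w n ω a :=
    (isNoiseLinear_state hnN).clm (ContinuousLinearMap.proj (R := ℝ) (φ := fun _ => ℂ) a)
  set E : ι → Set Ω := fun j => {ω | ∀ k ∈ T j, β k ω = false} with hE
  have hEc : ∀ j, MeasurableSet[channelSigma x₀ w v β] (E j) := fun j => measurableSet_erased (T j)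
  have hEm : ∀ j, MeasurableSet (E j) := fun j => h.channelSigma_le _ (hEc j)
  have hx2 : MemLp (fun ω => state A B x₀ w n ω a) 2 P := h.memLp_of_isNoiseLinear hxl
  have hy2 : MemLp (fun ω => f fun k => observation C (state A B x₀ w) v β k ω) 2 P := by
    have := hx2.sub hf2
    rw [Pi.sub_def] at this
    simpa only [sub_sub_cancel] using this
  set φ : ι → Ω → ℝ := fun j => (E j).indicator (ζ j) with hφ
  have hφ2 : ∀ j, MemLp (φ j) 2 P := fun j => (h.memLp_of_isNoiseLinear (hζ j)).indicator (hEm j)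
  have hφφ : ∀ j j', ∫ ω, φ j ω * φ j' ω ∂P =
      P.real (E j ∩ E j') * ∫ ω, ζ j ω * ζ j' ω ∂P := by
    intro j j'
    have h1 : ∀ ω, φ j ω * φ j' ω = (E j ∩ E j').indicator (fun ω => ζ j ω * ζ j' ω) ω := by
      intro ω
      rw [Set.inter_indicator_mul]
    rw [integral_congr_ae (.of_forall h1), integral_indicator ((hEm j).inter (hEm j')),
      h.setIntegral_channel (measurable_mul_of_isNoiseLinear (hζ j) (hζ j'))
        ((hEc j).inter (hEc j')), smul_eq_mul]
  have hφo : ∀ j j', j ≠ j' → ∫ ω, φ j ω * φ j' ω ∂P = 0 := fun j j' hne => by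
    rw [hφφ, horth j j' hne, mul_zero]
  have hφs : ∀ j, ∫ ω, φ j ω ^ 2 ∂P ≤ pe ^ (T j).card * D := fun j => by
    simp only [sq (φ j _)]
    rw [hφφ, Set.inter_self, hE, h.measureReal_erased]
    simp only [← sq]
    exact mul_le_mul_of_nonneg_left (hζD j) (pow_nonneg h.pe_nonneg _)
  -- The estimate contributes nothing on the erasure event, so the error has the same correlation
  -- with `φ j` as the state, namely `P (E j) * r j a`.
  have hφe : ∀ j, ∫ ω, φ j ω • (state A B x₀ w n ω a -
      f fun k => observation C (state A B x₀ w) v β k ω) ∂P = pe ^ (T j).card * r j a := by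
    intro j
    have h1 : ∀ ω, φ j ω • (state A B x₀ w n ω a -
        f fun k => observation C (state A B x₀ w) v β k ω) =
        (E j).indicator (fun ω => ζ j ω • state A B x₀ w n ω a) ω - (E j).indicator
          (fun ω => ζ j ω • f fun k => observation C (state A B x₀ w) v β k ω) ω := by
      intro ω
      by_cases hω : ω ∈ E j
      · simp [hφ, hω, mul_sub]
      · simp [hφ, hω]
    have hi1 : Integrable (fun ω => ζ j ω • state A B x₀ w n ω a) P :=
      h.integrable_smul_of_isNoiseLinear (hζ j) hxl
    have hi2 : Integrable (fun ω => ζ j ω • f fun k =>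
        observation C (state A B x₀ w) v β k ω) P :=
      memLp_one_iff_integrable.1 (hy2.smul (h.memLp_of_isNoiseLinear (hζ j)))
    have hra : ∫ ω, ζ j ω • state A B x₀ w n ω a ∂P = r j a := by
      rw [← hr j]
      exact h.integral_smul_clm (hζ j) (isNoiseLinear_state hnN)
        (ContinuousLinearMap.proj (R := ℝ) (φ := fun _ => ℂ) a)
    rw [integral_congr_ae (.of_forall h1), integral_sub (hi1.indicator (hEm j))
      (hi2.indicator (hEm j)), integral_indicator (hEm j), integral_indicator (hEm j),
      h.setIntegral_smul_observation_eq_zero (hζ j) (hT j) hf hy2, sub_zero,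
      h.setIntegral_channel (measurable_smul_of_isNoiseLinear (hζ j) hxl) (hEc j), hra, hE,
      h.measureReal_erased, Complex.real_smul]
    push_cast
    rfl
  -- With `b_j = r_j / D` the linear term is twice `pe ^ |T_j| * |r_j|² / D`, and the quadratic term
  -- is at most once that amount.
  refine le_trans (Finset.sum_le_sum fun j _ => ?_)
    (sum_le_integral_norm_sq hf2 hφ2 hφo fun j => r j a / D)
  rw [hφe]
  have h1 : (star (r j a / (D : ℂ)) * ((pe : ℂ) ^ (T j).card * r j a)).re =
      pe ^ (T j).card * ‖r j a‖ ^ 2 / D := by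
    have : star (r j a / (D : ℂ)) * ((pe : ℂ) ^ (T j).card * r j a) =
        ((pe ^ (T j).card * ‖r j a‖ ^ 2 / D : ℝ) : ℂ) := by
      push_cast
      rw [RCLike.star_def, map_div₀, Complex.conj_ofReal, ← Complex.conj_mul']
      ring
    rw [this, Complex.ofReal_re]
  have h2 : ‖r j a / (D : ℂ)‖ ^ 2 * ∫ ω, φ j ω ^ 2 ∂P ≤ pe ^ (T j).card * ‖r j a‖ ^ 2 / D := by
    refine (mul_le_mul_of_nonneg_left (hφs j) (sq_nonneg _)).trans_eq ?_
    rw [norm_div, Complex.norm_real, Real.norm_of_nonneg hD.le]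
    field_simp
  rw [h1]
  linarith

/-- Deterministic trajectories that are invisible to the observer while certain packets are erased
bound the estimation error from below. -/
lemma ofReal_sum_le_lintegral_error_sq (h : IsIntermittentSystem P A B C σ σ' pe x₀ w v β)
    (hσ' : 0 < σ') {ι : Type*} [Fintype ι] {u : ι → ℕ → Fin g → ℂ} {e : ι → ℕ → Fin q → ℂ}
    (hu : ∀ j k, IsProperOrReal P (w k) (u j k)) (he : ∀ j k, IsProperOrReal P (v k) (e j k))
    (n : ℕ) {T : ι → Finset ℕ}
    (hT : ∀ j, ∀ k < n + 1, k ∉ T j → C.mulVec (response A B (u j) k) + e j k = 0)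
    (hdisj : ∀ j j', j ≠ j' → ∀ s, target (u j) (e j) s = (0 : Carrier m g q) ∨
      target (u j') (e j') s = (0 : Carrier m g q)) {D : ℝ} (hD : 0 < D)
    (hDle : ∀ j, 2 / σ' ^ 2 * (∑ k ∈ Finset.range (n + 1), ∑ i, ‖u j k i‖ ^ 2 +
      ∑ k ∈ Finset.range (n + 1), ∑ i, ‖e j k i‖ ^ 2) ≤ D)
    {f : (Fin (n + 1) → Fin q → ℂ) → Fin m → ℂ} (hf : Measurable f) :
    ENNReal.ofReal (∑ j, pe ^ (T j).card * (∑ a, ‖response A B (u j) n a‖ ^ 2) / D) ≤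
      ∫⁻ ω, ∑ a, ‖state A B x₀ w n ω a -
        f (fun k => observation C (state A B x₀ w) v β k ω) a‖ₑ ^ 2 ∂P := by
  -- The horizon is `n + 1` because the output at time `n` involves the noise `v n`.
  obtain ⟨ζ, hζ, hζx, hζv, hζo, hζ2⟩ := h.exists_correlated hσ' hu he (n + 1)
  have hobs : ∀ j, ∀ k < n + 1, k ∉ T j →
      ∫ ω, ζ j ω • (C.mulVec (state A B x₀ w k ω) + v k ω) ∂P = 0 := by
    intro j k hk hkT
    have hx := isNoiseLinear_state (A := A) (B := B) (x₀ := x₀) (w := w) (v := v) hk.le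
    have hv := isNoiseLinear_noise (x₀ := x₀) (w := w) (v := v) hk
    have h1 := h.integral_smul_clm (hζ j) hx (mulVecCLM C)
    rw [hζx j k hk.le] at h1
    simp only [smul_add]
    rw [← hT j k hk hkT]
    exact (integral_add (h.integrable_smul_of_isNoiseLinear (hζ j) (hx.clm (mulVecCLM C)))
      (h.integrable_smul_of_isNoiseLinear (hζ j) hv)).trans
        (congrArg₂ (· + ·) h1 (hζv j k hk))
  have hfa : ∀ a, Measurable fun y => f y a := fun a => (measurable_pi_apply a).comp hf
  have hym : ∀ k, Measurable (observation C (state A B x₀ w) v β k) :=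
    measurable_observation h.measurable_state (fun k => (h.gaussian_noise k).measurable)
      h.measurable_channel
  have herr : ∀ a, Measurable fun ω => state A B x₀ w n ω a -
      f (fun k => observation C (state A B x₀ w) v β k ω) a := fun a =>
    ((measurable_pi_apply a).comp (h.measurable_state n)).sub
      ((hfa a).comp (measurable_pi_lambda _ fun k => hym k))
  rw [lintegral_finsetSum _ fun a _ => (herr a).enorm.pow_const 2]
  have hsum : ∑ j, pe ^ (T j).card * (∑ a, ‖response A B (u j) n a‖ ^ 2) / D =
      ∑ a, ∑ j, pe ^ (T j).card * ‖response A B (u j) n a‖ ^ 2 / D := by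
    rw [Finset.sum_comm]
    refine Finset.sum_congr rfl fun j _ => ?_
    rw [Finset.mul_sum, Finset.sum_div]
  have hnn : ∀ a : Fin m, 0 ≤ ∑ j, pe ^ (T j).card * ‖response A B (u j) n a‖ ^ 2 / D := fun a =>
    Finset.sum_nonneg fun j _ => div_nonneg
      (mul_nonneg (pow_nonneg h.pe_nonneg _) (sq_nonneg _)) hD.le
  rw [hsum, ENNReal.ofReal_sum_of_nonneg fun a _ => hnn a]
  refine Finset.sum_le_sum fun a _ => ?_
  by_cases htop : ∫⁻ ω, ‖state A B x₀ w n ω a -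
      f (fun k => observation C (state A B x₀ w) v β k ω) a‖ₑ ^ 2 ∂P = ∞
  · rw [htop]; exact le_top
  have hmem : MemLp (fun ω => state A B x₀ w n ω a -
      f (fun k => observation C (state A B x₀ w) v β k ω) a) 2 P := by
    refine ⟨(herr a).aestronglyMeasurable, ?_⟩
    rw [lintegral_enorm_sq_eq] at htop
    rw [lt_top_iff_ne_top]
    intro h0
    exact htop (by simp [h0])
  have hle := h.sum_le_integral_error_sq n.le_succ hζ (fun j => hζx j n n.le_succ) hobs
    (fun j j' hne => hζo j j' (hdisj j j' hne)) hD (fun j => (hζ2 j).trans (hDle j)) a (hfa a) hmem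
  refine (ENNReal.ofReal_le_ofReal hle).trans_eq ?_
  rw [ofReal_integral_eq_lintegral_ofReal (hmem.integrable_norm_pow (by norm_num))
    (.of_forall fun _ => sq_nonneg _)]
  refine lintegral_congr fun ω => ?_
  rw [ENNReal.ofReal_pow (norm_nonneg _), ofReal_norm]

end IsIntermittentSystem

end IntermittentKalman

namespace IntermittentKalman

/-! ### Invisible trajectories -/

/-- `z` combines the first Jordan vectors of the cycle with coefficients from a null vector of the
stack left by a minimal erasure. On such vectors `C A ^ t` acts as `C_i A_i ^ t`, and powers
divisible by the period act as scalars. -/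
lemma JordanCycleForm.exists_invisible {m q : ℕ} {A : Matrix (Fin m) (Fin m) ℂ}
    (J : JordanCycleForm A) (C : Matrix (Fin q) (Fin m) ℂ) (i : Fin J.μ) :
    ∃ S : Finset ℕ, S.card = J.minErasures C i ∧ ∃ z : Fin m → ℂ, z ≠ 0 ∧
      (∀ t, t % J.period i ∉ S → C.mulVec ((A ^ t).mulVec z) = 0) ∧
      ∀ k, (A ^ (J.period i * k)).mulVec z = J.firstEig i ^ (J.period i * k) • z := by
  classical
  obtain ⟨S, -, hcard, u, hu, h⟩ := J.exists_card_eq_minErasures C i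
  set z : Fin m → ℂ := J.U.mulVec fun b => if hb : b.1.1 = i then
    if (b.2 : ℕ) = 0 then u (hb ▸ b.1.2) else 0 else 0 with hz
  have hcz : ∀ k a, k.1 ≠ i ∨ a ≠ 0 → J.coord z k a = 0 := by
    intro k a hka
    rw [JordanCycleForm.coord]
    split_ifs with ha
    · rw [hz, J.Uinv_mulVec_U_mulVec]
      rcases hka with hk | ha0
      · simp [hk]
      · simp [ha0]
    · rfl
  have hcu : ∀ j, J.coord z ⟨i, j⟩ 0 = u j := by
    intro j
    rw [JordanCycleForm.coord, dif_pos (J.size_pos i j), hz, J.Uinv_mulVec_U_mulVec]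
    simp
  refine ⟨S, hcard, z, fun h0 => hu ?_, fun t ht => ?_, fun k => ?_⟩
  · ext1 j
    rw [← hcu j, h0]
    simp [JordanCycleForm.coord]
  · rw [J.mulVec_pow_eq_cycle i hcz]
    simp only [hcu]
    rw [← Nat.div_add_mod t (J.period i), J.cycle_mulVec_period i (dvd_mul_right _ _),
      h _ (Finset.mem_sdiff.2 ⟨Finset.mem_range.2 (Nat.mod_lt _ (J.period_pos i)), ht⟩), smul_zero]
  · refine J.ext_coord fun b a => ?_
    rw [J.coord_smul]
    by_cases hb : b.1 ≠ i ∨ a ≠ 0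
    · rw [hcz b a hb, mul_zero]
      refine J.coord_pow_eq_zero (a := a) (fun c hc => hcz b c ?_) _ a le_rfl
      exact hb.imp id fun h0 => by omega
    · push Not at hb
      obtain ⟨⟨i', j⟩, rfl⟩ : ∃ b', b = b' := ⟨b, rfl⟩
      obtain ⟨rfl, rfl⟩ := hb
      rw [J.coord_pow_top fun c hc => hcz _ c (Or.inr (by omega)),
        J.eig_pow_eq _ (dvd_mul_right _ _) j ⟨0, J.ν_pos _⟩]
      rfl

/-- All coordinates of `x` are real. -/
def IsRealVector {k : ℕ} (x : Fin k → ℂ) : Prop := ∀ i, (x i).im = 0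

/-- The coordinatewise real part of `x`. -/
def reVector {k : ℕ} (x : Fin k → ℂ) : Fin k → ℂ := fun i => ((x i).re : ℂ)

lemma isRealVector_reVector {k : ℕ} (x : Fin k → ℂ) : IsRealVector (reVector x) :=
  fun _ => Complex.ofReal_im _

lemma isRealVector_zero {k : ℕ} : IsRealVector (0 : Fin k → ℂ) := fun _ => rfl

lemma IsRealVector.reVector_eq {k : ℕ} {x : Fin k → ℂ} (h : IsRealVector x) : reVector x = x :=
  funext fun i => Complex.ext rfl (h i).symm

lemma IsRealVector.neg {k : ℕ} {x : Fin k → ℂ} (h : IsRealVector x) : IsRealVector (-x) :=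
  fun i => by simp [h i]

lemma IsRealVector.add {k : ℕ} {x y : Fin k → ℂ} (hx : IsRealVector x) (hy : IsRealVector y) :
    IsRealVector (x + y) :=
  fun i => by simp [hx i, hy i]

lemma IsRealMatrix.mulVec_reVector {r s : ℕ} {M : Matrix (Fin r) (Fin s) ℂ} (h : IsRealMatrix M)
    (x : Fin s → ℂ) : M.mulVec (reVector x) = reVector (M.mulVec x) := by
  ext1 i
  simp only [Matrix.mulVec, dotProduct, reVector, Complex.re_sum, Complex.ofReal_sum,
    Complex.mul_re, h i, zero_mul, sub_zero, Complex.ofReal_mul]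
  exact Finset.sum_congr rfl fun j _ => by rw [show M i j = ((M i j).re : ℂ) from Complex.ext rfl (h i j), Complex.ofReal_re]

lemma IsRealMatrix.mulVec {r s : ℕ} {M : Matrix (Fin r) (Fin s) ℂ} (h : IsRealMatrix M)
    {x : Fin s → ℂ} (hx : IsRealVector x) : IsRealVector (M.mulVec x) := by
  rw [← hx.reVector_eq, h.mulVec_reVector]
  exact isRealVector_reVector _

lemma IsRealMatrix.pow_mulVec_reVector {m : ℕ} {A : Matrix (Fin m) (Fin m) ℂ}
    (h : IsRealMatrix A) (n : ℕ) (x : Fin m → ℂ) :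
    (A ^ n).mulVec (reVector x) = reVector ((A ^ n).mulVec x) := by
  induction n with
  | zero => simp
  | succ n ih => rw [pow_succ', ← Matrix.mulVec_mulVec, ih, h.mulVec_reVector, Matrix.mulVec_mulVec]

section

variable {m g q : ℕ} {A : Matrix (Fin m) (Fin m) ℂ} {B : Matrix (Fin m) (Fin g) ℂ}
  {C : Matrix (Fin q) (Fin m) ℂ}

lemma response_eq_sum (u : ℕ → Fin g → ℂ) (n : ℕ) :
    response A B u n = ∑ t ∈ Finset.range n, (A ^ (n - 1 - t) * B).mulVec (u t) := by
  induction n with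
  | zero => rfl
  | succ n ih =>
    rw [response, ih, Finset.sum_range_succ, Matrix.mulVec_sum]
    congr 1
    · refine Finset.sum_congr rfl fun t ht => ?_
      have := Finset.mem_range.1 ht
      rw [Matrix.mulVec_mulVec, ← Matrix.mul_assoc, ← pow_succ']
      congr 3
      omega
    · simp

lemma IsRealMatrix.isRealVector_response (hA : IsRealMatrix A) (hB : IsRealMatrix B)
    {u : ℕ → Fin g → ℂ} (hu : ∀ t, IsRealVector (u t)) (n : ℕ) :
    IsRealVector (response A B u n) := by
  induction n with
  | zero => exact isRealVector_zero
  | succ n ih => exact (hA.mulVec ih).add (hB.mulVec (hu n))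

lemma IsRealMatrix.response_reVector (hA : IsRealMatrix A) (hB : IsRealMatrix B)
    (u : ℕ → Fin g → ℂ) (n : ℕ) :
    response A B (fun t => reVector (u t)) n = reVector (response A B u n) := by
  induction n with
  | zero => ext1; simp [response, reVector]
  | succ n ih =>
    rw [response, ih, hA.mulVec_reVector, hB.mulVec_reVector]
    ext1 i
    simp [response, reVector]

lemma Controllable.exists_response_eq (h : Controllable A B) (z : Fin m → ℂ) :
    ∃ u, response A B u m = z := by
  set M : Matrix (Fin m) (Fin m × Fin g) ℂ := Matrix.of fun i k => (A ^ (k.1 : ℕ) * B) i k.2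
  have hM : M.rank = m := h
  have htop : LinearMap.range M.mulVecLin = ⊤ := by
    apply Submodule.eq_top_of_finrank_eq
    rw [Module.finrank_fin_fun]
    exact hM
  obtain ⟨y, hy⟩ := LinearMap.range_eq_top.1 htop z
  refine ⟨fun t => if ht : m - 1 - t < m then fun c => y (⟨m - 1 - t, ht⟩, c) else 0, ?_⟩
  rw [response_eq_sum, ← hy, Matrix.mulVecLin_apply]
  rw [← Finset.sum_range_reflect]
  ext1 i
  rw [Finset.sum_apply, Finset.sum_range]
  simp only [Matrix.mulVec, dotProduct, M, Matrix.of_apply]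
  rw [Fintype.sum_prod_type]
  refine Finset.sum_congr rfl fun k _ => Finset.sum_congr rfl fun c _ => ?_
  have hk : m - 1 - (m - 1 - (k : ℕ)) = k := by omega
  simp only [hk, Fin.is_lt, dif_pos, Fin.eta]

/-- The input that acts like `u` in the window `[τ, τ + m)` and vanishes elsewhere. -/
def windowInput (m τ : ℕ) (u : ℕ → Fin g → ℂ) (t : ℕ) : Fin g → ℂ :=
  if τ ≤ t ∧ t < τ + m then u (t - τ) else 0

/-- The output noise that hides the states in the window `[τ, τ + m)`. -/
def windowNoise (A : Matrix (Fin m) (Fin m) ℂ) (B : Matrix (Fin m) (Fin g) ℂ)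
    (C : Matrix (Fin q) (Fin m) ℂ) (τ : ℕ) (u : ℕ → Fin g → ℂ) (t : ℕ) : Fin q → ℂ :=
  if τ ≤ t ∧ t < τ + m then -C.mulVec (response A B u (t - τ)) else 0

lemma response_windowInput_of_le {τ t : ℕ} (u : ℕ → Fin g → ℂ) (ht : t ≤ τ) :
    response A B (windowInput m τ u) t = 0 := by
  induction t with
  | zero => rfl
  | succ t ih =>
    rw [response, ih (by omega), windowInput, if_neg (by omega)]
    simp

lemma response_windowInput_add {τ s : ℕ} (u : ℕ → Fin g → ℂ) (hs : s ≤ m) :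
    response A B (windowInput m τ u) (τ + s) = response A B u s := by
  induction s with
  | zero => exact response_windowInput_of_le u le_rfl
  | succ s ih =>
    rw [← add_assoc, response, ih (by omega), windowInput, if_pos (by omega), response,
      Nat.add_sub_cancel_left]

lemma response_windowInput_add_add (τ s : ℕ) (u : ℕ → Fin g → ℂ) :
    response A B (windowInput m τ u) (τ + m + s) = (A ^ s).mulVec (response A B u m) := by
  induction s with
  | zero => simpa using response_windowInput_add (A := A) (B := B) (τ := τ) u le_rfl
  | succ s ih =>
    rw [← add_assoc, response, ih, windowInput, if_neg (by omega), pow_succ',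
      ← Matrix.mulVec_mulVec]
    simp

/-- Before the window the state is zero, and inside it the noise cancels the output; only the free
evolution afterwards can be seen. -/
lemma output_window_eq_zero {τ t : ℕ} (u : ℕ → Fin g → ℂ)
    (h : τ + m ≤ t → C.mulVec ((A ^ (t - (τ + m))).mulVec (response A B u m)) = 0) :
    C.mulVec (response A B (windowInput m τ u) t) + windowNoise A B C τ u t = 0 := by
  rw [windowNoise]
  rcases lt_or_ge t τ with h1 | h1
  · rw [response_windowInput_of_le u h1.le, if_neg (by omega)]
    simp
  rcases lt_or_ge t (τ + m) with h2 | h2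
  · rw [if_pos ⟨h1, h2⟩]
    obtain ⟨s, rfl⟩ := Nat.exists_eq_add_of_le h1
    rw [response_windowInput_add u (by omega), Nat.add_sub_cancel_left, add_neg_cancel]
  · rw [if_neg (by omega), add_zero]
    have h3 := h h2
    obtain ⟨s, rfl⟩ := Nat.exists_eq_add_of_le h2
    rwa [response_windowInput_add_add, ← Nat.add_sub_cancel_left (n := τ + m) (m := s)]

/-- Trajectories started in disjoint windows use different sources; this is what makes their
functionals orthogonal. -/
lemma target_window_disjoint {τ τ' : ℕ} (h : τ + m ≤ τ' ∨ τ' + m ≤ τ) (u u' : ℕ → Fin g → ℂ)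
    (s : Source) :
    target (windowInput m τ u) (windowNoise A B C τ u) s = (0 : Carrier m g q) ∨
      target (windowInput m τ' u') (windowNoise A B C τ' u') s = (0 : Carrier m g q) := by
  have key : ∀ t, ¬ (τ ≤ t ∧ t < τ + m) ∨ ¬ (τ' ≤ t ∧ t < τ' + m) := fun t => by omega
  cases s with
  | init => exact Or.inl rfl
  | channel n => exact Or.inl rfl
  | disturbance n =>
    exact (key n).imp (fun h => by simp only [target, windowInput, if_neg h]; rfl)
      fun h => by simp only [target, windowInput, if_neg h]; rfl
  | noise n =>
    exact (key n).imp (fun h => by simp only [target, windowNoise, if_neg h]; rfl)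
      fun h => by simp only [target, windowNoise, if_neg h]; rfl

lemma sum_range_window {f : ℕ → ℝ} {F : ℕ → ℝ} {τ N : ℕ} (hN : τ + m ≤ N)
    (hF : ∀ t, F t = if τ ≤ t ∧ t < τ + m then f (t - τ) else 0) :
    ∑ t ∈ Finset.range N, F t = ∑ s ∈ Finset.range m, f s := by
  obtain ⟨r, rfl⟩ := Nat.exists_eq_add_of_le hN
  rw [Finset.sum_range_add, Finset.sum_range_add]
  have h1 : ∑ t ∈ Finset.range τ, F t = 0 := Finset.sum_eq_zero fun t ht => by
    rw [hF, if_neg]; have := Finset.mem_range.1 ht; omega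
  have h2 : ∑ t ∈ Finset.range r, F (τ + m + t) = 0 := Finset.sum_eq_zero fun t ht => by
    rw [hF, if_neg]; omega
  rw [h1, h2, zero_add, add_zero]
  refine Finset.sum_congr rfl fun s hs => ?_
  have := Finset.mem_range.1 hs
  rw [hF, if_pos (by omega), Nat.add_sub_cancel_left]

lemma sum_range_windowInput {τ N : ℕ} (hN : τ + m ≤ N) (u : ℕ → Fin g → ℂ) :
    ∑ t ∈ Finset.range N, ∑ i, ‖windowInput m τ u t i‖ ^ 2 =
      ∑ s ∈ Finset.range m, ∑ i, ‖u s i‖ ^ 2 :=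
  sum_range_window hN (f := fun s => ∑ i, ‖u s i‖ ^ 2) fun t => by
    rw [windowInput]; split_ifs <;> simp

lemma sum_range_windowNoise {τ N : ℕ} (hN : τ + m ≤ N) (u : ℕ → Fin g → ℂ) :
    ∑ t ∈ Finset.range N, ∑ i, ‖windowNoise A B C τ u t i‖ ^ 2 =
      ∑ s ∈ Finset.range m, ∑ i, ‖C.mulVec (response A B u s) i‖ ^ 2 :=
  sum_range_window hN (f := fun s => ∑ i, ‖C.mulVec (response A B u s) i‖ ^ 2) fun t => by
    rw [windowNoise]; split_ifs <;> simp

end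

/-- The times in `[a, a + p k]` whose residues relative to `a` belong to `S`. -/
def visibleTimes (S : Finset ℕ) (p a k : ℕ) : Finset ℕ :=
  (Finset.range (a + p * k + 1)).filter fun t => a ≤ t ∧ (t - a) % p ∈ S

/-- The right endpoint `a + p * k` is included, hence `k + 1` periods instead of `k`. -/
lemma card_visibleTimes_le {p : ℕ} (hp : 0 < p) (S : Finset ℕ) (a k : ℕ) :
    (visibleTimes S p a k).card ≤ (k + 1) * S.card := by
  have hsub : visibleTimes S p a k ⊆
      (Finset.range (k + 1) ×ˢ S).image fun x => a + (p * x.1 + x.2) := by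
    intro t ht
    obtain ⟨h1, h2, h3⟩ := Finset.mem_filter.1 ht
    refine Finset.mem_image.2 ⟨((t - a) / p, (t - a) % p), Finset.mem_product.2
      ⟨Finset.mem_range.2 ?_, h3⟩, ?_⟩
    · have := Finset.mem_range.1 h1
      have h4 : (t - a) / p ≤ p * k / p := Nat.div_le_div_right (by omega)
      rw [Nat.mul_div_cancel_left _ hp] at h4
      omega
    · simp only [Nat.div_add_mod]
      omega
  refine (Finset.card_le_card hsub).trans (Finset.card_image_le.trans_eq ?_)
  rw [Finset.card_product, Finset.card_range]

end IntermittentKalman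

/-! ### Necessity of the threshold -/

namespace IntermittentKalman

namespace IsIntermittentSystem

variable {Ω : Type*} [MeasurableSpace Ω] {P : Measure Ω} {m g q : ℕ}
  {A : Matrix (Fin m) (Fin m) ℂ} {B : Matrix (Fin m) (Fin g) ℂ} {C : Matrix (Fin q) (Fin m) ℂ}
  {σ σ' pe : ℝ} {x₀ : Ω → Fin m → ℂ} {w : ℕ → Ω → Fin g → ℂ} {v : ℕ → Ω → Fin q → ℂ}
  {β : ℕ → Ω → Bool}

/-- Admissible inputs that produce growing trajectories which can only be observed at the times in
a set of `minErasures` residues. -/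
lemma exists_invisible_inputs (h : IsIntermittentSystem P A B C σ σ' pe x₀ w v β)
    (hctrl : Controllable A B) (J : JordanCycleForm A) (i : Fin J.μ) :
    ∃ S : Finset ℕ, S.card = J.minErasures C i ∧ ∃ (d : Bool → ℕ → Fin g → ℂ) (c : ℝ), 0 < c ∧
      (∀ b τ k, IsProperOrReal P (w k) (windowInput m τ (d b) k)) ∧
      (∀ b τ k, IsProperOrReal P (v k) (windowNoise A B C τ (d b) k)) ∧
      (∀ b t, t % J.period i ∉ S → C.mulVec ((A ^ t).mulVec (response A B (d b) m)) = 0) ∧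
      ∀ k, ∃ b, c * ‖J.firstEig i‖ ^ (2 * (J.period i * k)) ≤
        ∑ a, ‖(A ^ (J.period i * k)).mulVec (response A B (d b) m) a‖ ^ 2 := by
  obtain ⟨S, hS, z, hz, hvis, hgrow⟩ := J.exists_invisible C i
  have hzpos : 0 < ∑ a, ‖z a‖ ^ 2 := by
    obtain ⟨a, ha⟩ := Function.ne_iff.1 hz
    exact Finset.sum_pos' (fun _ _ => sq_nonneg _)
      ⟨a, Finset.mem_univ a, pow_pos (norm_pos_iff.2 ha) 2⟩
  have hnorm : ∀ k, ∑ a, ‖(A ^ (J.period i * k)).mulVec z a‖ ^ 2 =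
      ‖J.firstEig i‖ ^ (2 * (J.period i * k)) * ∑ a, ‖z a‖ ^ 2 := fun k => by
    rw [hgrow, Finset.mul_sum]
    refine Finset.sum_congr rfl fun a _ => ?_
    rw [Pi.smul_apply, smul_eq_mul, norm_mul, norm_pow, mul_pow, ← pow_mul, mul_comm 2]
  refine ⟨S, hS, ?_⟩
  rcases h.proper_or_real with ⟨-, hw, hv⟩ | ⟨hA, hB, hC, -, hw, hv⟩
  · obtain ⟨d, hd⟩ := hctrl.exists_response_eq z
    refine ⟨fun _ => d, ∑ a, ‖z a‖ ^ 2, hzpos, fun _ _ k => Or.inl (hw k),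
      fun _ _ k => Or.inl (hv k), fun _ t ht => ?_, fun k => ⟨true, ?_⟩⟩
    · rw [hd, hvis t ht]
    · rw [hd, hnorm, mul_comm]
  · choose d hd using hctrl.exists_response_eq
    -- `reVector` turns these into the real and imaginary parts of `z`, both invisible because `A`
    -- and `C` are real. At each `k` one of them carries at least half of the squared norm, and
    -- which one may depend on `k`.
    set y : Bool → Fin m → ℂ := fun b => bif b then z else -Complex.I • z with hy
    have hresp : ∀ b, response A B (fun t => reVector (d (y b) t)) m = reVector (y b) := fun b => by
      rw [hA.response_reVector hB, hd]
    have hreal : ∀ b t, IsRealVector (reVector (d (y b) t)) := fun b t => isRealVector_reVector _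
    refine ⟨fun b t => reVector (d (y b) t), (∑ a, ‖z a‖ ^ 2) / 2, by positivity,
      fun b τ k => Or.inr ⟨hw k, ?_⟩, fun b τ k => Or.inr ⟨hv k, ?_⟩, fun b t ht => ?_,
      fun k => ?_⟩
    · rw [windowInput]
      split_ifs
      · exact hreal b _
      · exact isRealVector_zero
    · rw [windowNoise]
      split_ifs
      · exact (hC.mulVec (hA.isRealVector_response hB (hreal b) _)).neg
      · exact isRealVector_zero
    · rw [hresp, hA.pow_mulVec_reVector, hC.mulVec_reVector]
      have : C.mulVec ((A ^ t).mulVec (y b)) = 0 := by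
        cases b
        · simp only [hy, cond_false, Matrix.mulVec_smul, hvis t ht, smul_zero]
        · exact hvis t ht
      rw [this]
      ext1; simp [reVector]
    · have hsum : ∑ a, ‖(A ^ (J.period i * k)).mulVec (reVector (y true)) a‖ ^ 2 +
          ∑ a, ‖(A ^ (J.period i * k)).mulVec (reVector (y false)) a‖ ^ 2 =
          ‖J.firstEig i‖ ^ (2 * (J.period i * k)) * ∑ a, ‖z a‖ ^ 2 := by
        rw [← hnorm, ← Finset.sum_add_distrib]
        refine Finset.sum_congr rfl fun a _ => ?_
        rw [hA.pow_mulVec_reVector, hA.pow_mulVec_reVector]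
        simp only [hy, cond_true, cond_false, Matrix.mulVec_smul, reVector, Pi.smul_apply,
          smul_eq_mul, Complex.norm_real, Real.norm_eq_abs, sq_abs]
        rw [← Complex.normSq_eq_norm_sq, Complex.normSq_apply]
        simp
        ring
      simp only [hresp]
      by_contra! hcon
      have h1 := hcon true
      have h2 := hcon false
      nlinarith

/-- Intermittent observability forces the decay of the erasure probabilities to beat the growth of
every eigenvalue cycle. -/
theorem pow_mul_pow_lt_one [IsProbabilityMeasure P]
    (h : IsIntermittentSystem P A B C σ σ' pe x₀ w v β) (hσ' : 0 < σ')
    (hctrl : Controllable A B) (J : JordanCycleForm A)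
    (hobs : IsIntermittentObservable P A B C x₀ w v β) (i : Fin J.μ) :
    pe ^ J.minErasures C i * ‖J.firstEig i‖ ^ (2 * J.period i) < 1 := by
  by_contra! hge
  obtain ⟨S, hS, d, c, hc, hu, he, hvis, hgrow⟩ := h.exists_invisible_inputs hctrl J i
  obtain ⟨f, hf, hsup⟩ := hobs
  set p := J.period i with hp
  have hp0 : 0 < p := J.period_pos i
  set l := J.minErasures C i with hl
  set lam := ‖J.firstEig i‖ with hlam
  choose b hb using hgrow
  set cost : Bool → ℝ := fun b => 2 / σ' ^ 2 * (∑ s ∈ Finset.range m, ∑ i, ‖d b s i‖ ^ 2 +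
    ∑ s ∈ Finset.range m, ∑ i, ‖C.mulVec (response A B (d b) s) i‖ ^ 2) with hcost
  have hcost0 : ∀ b, 0 ≤ cost b := fun b => mul_nonneg (by positivity) (add_nonneg
    (Finset.sum_nonneg fun _ _ => Finset.sum_nonneg fun _ _ => sq_nonneg _)
    (Finset.sum_nonneg fun _ _ => Finset.sum_nonneg fun _ _ => sq_nonneg _))
  set D : ℝ := cost true + cost false + 1 with hD
  have hD0 : 0 < D := by linarith [hcost0 true, hcost0 false]
  have hcostD : ∀ b, cost b ≤ D := by
    intro b
    cases b <;> linarith [hcost0 true, hcost0 false]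
  have hpl : 0 < pe ^ l := by
    refine lt_of_le_of_ne (pow_nonneg h.pe_nonneg _) fun h0 => ?_
    rw [← h0, zero_mul] at hge
    linarith
  have hlower : ∀ N : ℕ, ENNReal.ofReal (N * (pe ^ l * c / D)) ≤
      ⨆ n, ∫⁻ ω, ∑ i, ‖state A B x₀ w n ω i -
        f n (fun k => observation C (state A B x₀ w) v β k ω) i‖ₑ ^ 2 ∂P := by
    intro N
    -- At time `n` the trajectory started at `τ j` has evolved freely for `p * (m * j)` steps, a
    -- multiple of the period. Starting times differ by at least `p * m ≥ m`, so the windows are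
    -- disjoint.
    set n := p * (m * N) + m with hn
    set τ : Fin N → ℕ := fun j => p * (m * (N - j)) with hτ
    have hτn : ∀ j, τ j + m + p * (m * j) = n := fun j => by
      have : p * (m * N) = p * (m * (N - j)) + p * (m * j) := by
        rw [← mul_add, ← mul_add, Nat.sub_add_cancel j.2.le]
      simp only [hτ, hn]
      omega
    refine le_trans ?_ ((h.ofReal_sum_le_lintegral_error_sq hσ'
      (u := fun j => windowInput m (τ j) (d (b (m * j))))
      (e := fun j => windowNoise A B C (τ j) (d (b (m * j))))
      (fun j k => hu _ _ k) (fun j k => he _ _ k) n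
      (T := fun j => visibleTimes S p (τ j + m) (m * j)) ?_ ?_ hD0 ?_ (hf n)).trans
        (le_iSup (fun n => ∫⁻ ω, ∑ i, ‖state A B x₀ w n ω i -
          f n (fun k => observation C (state A B x₀ w) v β k ω) i‖ₑ ^ 2 ∂P) n))
    · refine ENNReal.ofReal_le_ofReal ?_
      rw [← nsmul_eq_mul]
      have hcard : (Finset.univ : Finset (Fin N)).card = N := Finset.card_fin N
      conv_lhs => rw [← hcard]
      refine Finset.card_nsmul_le_sum _ _ _ fun j _ => ?_
      rw [← hτn j, response_windowInput_add_add]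
      refine div_le_div_of_nonneg_right ?_ hD0.le
      have h1 : pe ^ ((m * j + 1) * l) ≤ pe ^ (visibleTimes S p (τ j + m) (m * j)).card :=
        pow_le_pow_of_le_one h.pe_nonneg h.pe_le_one (by
          rw [← hS]; exact card_visibleTimes_le hp0 S _ _)
      -- Here the failure of the strict inequality enters: every trajectory contributes at least `pe
      -- ^ l * c / D`, so `N` of them exceed any bound.
      have h2 : 1 ≤ (pe ^ l * lam ^ (2 * p)) ^ (m * (j : ℕ)) := one_le_pow₀ hge
      calc pe ^ l * c = pe ^ l * c * 1 := (mul_one _).symm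
        _ ≤ pe ^ l * c * (pe ^ l * lam ^ (2 * p)) ^ (m * (j : ℕ)) :=
          mul_le_mul_of_nonneg_left h2 (by positivity)
        _ = pe ^ ((m * j + 1) * l) * (c * lam ^ (2 * (p * (m * j)))) := by
          rw [mul_pow, ← pow_mul, ← pow_mul, add_mul, one_mul, pow_add]
          ring
        _ ≤ _ := mul_le_mul h1 (hb (m * j)) (by positivity) (pow_nonneg h.pe_nonneg _)
    · intro j k hk hkT
      refine output_window_eq_zero _ fun hle => hvis _ _ fun hmem => hkT ?_
      refine Finset.mem_filter.2 ⟨Finset.mem_range.2 ?_, hle, hmem⟩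
      rw [hτn]
      exact hk
    · intro j j' hne
      refine target_window_disjoint ?_ _ _
      have key : ∀ j j' : Fin N, (j : ℕ) < j' → τ j' + m ≤ τ j := by
        intro j j' hlt
        have h3 : N - (j : ℕ) = (N - j' - 1) + (j' - j) + 1 := by omega
        have h4 : N - (j : ℕ) = (N - j') + (j' - j) := by omega
        simp only [hτ, h4, mul_add]
        have : m ≤ p * (m * (j' - j)) := by
          have h5 : 1 * (m * 1) ≤ p * (m * ((j' : ℕ) - j)) :=
            Nat.mul_le_mul hp0 (Nat.mul_le_mul_left m (by omega))
          simpa using h5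
        omega
      rcases lt_or_gt_of_ne (Fin.val_ne_of_ne hne) with hlt | hlt
      · exact Or.inr (key _ _ hlt)
      · exact Or.inl (key _ _ hlt)
    · intro j
      have hN : τ j + m ≤ n + 1 := by have := hτn j; omega
      rw [sum_range_windowInput hN, sum_range_windowNoise hN]
      exact hcostD _
  have hc0 : 0 < pe ^ l * c / D := by positivity
  obtain ⟨N, hN⟩ := exists_nat_gt ((⨆ n, ∫⁻ ω, ∑ i, ‖state A B x₀ w n ω i -
    f n (fun k => observation C (state A B x₀ w) v β k ω) i‖ₑ ^ 2 ∂P).toReal / (pe ^ l * c / D))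
  rw [div_lt_iff₀ hc0] at hN
  have := (ENNReal.ofReal_le_iff_le_toReal hsup.ne).1 (hlower N)
  linarith

end IsIntermittentSystem

end IntermittentKalman

namespace IntermittentKalman

/-! ### The forms of the threshold condition -/

lemma ofReal_lt_inv_ofReal_iff {x r : ℝ} (hr : 0 ≤ r) :
    ENNReal.ofReal x < (ENNReal.ofReal r)⁻¹ ↔ x * r < 1 := by
  rcases hr.eq_or_lt with rfl | hr
  · simp
  · rw [← ENNReal.ofReal_inv_of_pos hr, ENNReal.ofReal_lt_ofReal_iff (inv_pos.2 hr),
      inv_eq_one_div, lt_div_iff₀ hr]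

lemma rpow_div_mul_lt_one_iff {x r : ℝ} (hx : 0 ≤ x) (l : ℕ) {p : ℕ} (hp : 0 < p) :
    x ^ ((l : ℝ) / p) * r ^ 2 < 1 ↔ x ^ l * r ^ (2 * p) < 1 := by
  rw [← pow_lt_one_iff_of_nonneg (mul_nonneg (Real.rpow_nonneg hx _) (sq_nonneg r)) hp.ne',
    mul_pow, ← Real.rpow_natCast (x ^ ((l : ℝ) / p)), ← Real.rpow_mul hx,
    div_mul_cancel₀ _ (Nat.cast_ne_zero.2 hp.ne'), Real.rpow_natCast, ← pow_mul]

lemma mul_rpow_div_lt_one_iff {x r : ℝ} (hx : 0 ≤ x) (hr : 0 ≤ r) {l : ℕ} (hl : l ≠ 0) (p : ℕ) :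
    x * r ^ (2 * (p : ℝ) / l) < 1 ↔ x ^ l * r ^ (2 * p) < 1 := by
  rw [← pow_lt_one_iff_of_nonneg (mul_nonneg hx (Real.rpow_nonneg hr _)) hl, mul_pow,
    ← Real.rpow_natCast (r ^ _), ← Real.rpow_mul hr, div_mul_cancel₀ _ (Nat.cast_ne_zero.2 hl)]
  norm_cast

namespace JordanCycleForm

variable {m q : ℕ} {A : Matrix (Fin m) (Fin m) ℂ} (J : JordanCycleForm A)
  (C : Matrix (Fin q) (Fin m) ℂ)

/-- For `l = 0` the conventions fit: the growth is `0` or `∞` according to `|λ| < 1`, and the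
right-hand side reads `|λ| ^ (2 * p) < 1`. -/
lemma ofReal_lt_inv_growth_iff {pe : ℝ} (hpe : 0 ≤ pe) (i : Fin J.μ) :
    ENNReal.ofReal pe < (J.growth C i)⁻¹ ↔
      pe ^ J.minErasures C i * ‖J.firstEig i‖ ^ (2 * J.period i) < 1 := by
  have hp : 2 * J.period i ≠ 0 := by have := J.period_pos i; omega
  rw [growth]
  split_ifs with hl h1
  · rw [hl, pow_zero, one_mul]
    simpa using pow_lt_one₀ (norm_nonneg _) h1 hp
  · rw [hl, pow_zero, one_mul]
    simpa using one_le_pow₀ (not_lt.1 h1)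
  · rw [ofReal_lt_inv_ofReal_iff (Real.rpow_nonneg (norm_nonneg _) _),
      mul_rpow_div_lt_one_iff hpe (norm_nonneg _) hl]

lemma ofReal_lt_one_div_iSup_growth_iff {pe : ℝ} (hpe : 0 ≤ pe) :
    ENNReal.ofReal pe < 1 / ⨆ i, J.growth C i ↔
      ∀ i, pe ^ J.minErasures C i * ‖J.firstEig i‖ ^ (2 * J.period i) < 1 := by
  -- The infimum is over finitely many cycles, so a strict inequality passes to each of them; `pe <
  -- ∞` settles the empty case.
  rw [one_div, ENNReal.inv_iSup, ← Finset.inf_univ_eq_iInf, Finset.lt_inf_iff ENNReal.ofReal_lt_top]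
  simp [J.ofReal_lt_inv_growth_iff C hpe]

end JordanCycleForm

end IntermittentKalman
theorem mainTheorem1 {Ω : Type*} [MeasurableSpace Ω] (P : Measure Ω) [IsProbabilityMeasure P]
    {m g q : ℕ} (A : Matrix (Fin m) (Fin m) ℂ) (B : Matrix (Fin m) (Fin g) ℂ)
    (C : Matrix (Fin q) (Fin m) ℂ) (σ σ' pe : ℝ) (hσ : 0 < σ) (hσ' : 0 < σ')
    (x₀ : Ω → Fin m → ℂ) (w : ℕ → Ω → Fin g → ℂ) (v : ℕ → Ω → Fin q → ℂ) (β : ℕ → Ω → Bool)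
    (hsys : IntermittentKalman.IsIntermittentSystem P A B C σ σ' pe x₀ w v β)
    (hctrl : IntermittentKalman.Controllable A B)
    (J : IntermittentKalman.JordanCycleForm A) :
    (IntermittentKalman.IsIntermittentObservable P A B C x₀ w v β ↔
      ENNReal.ofReal pe < 1 / ⨆ i, J.growth C i) ∧
    (IntermittentKalman.IsIntermittentObservable P A B C x₀ w v β ↔
      ∀ i, pe ^ ((J.minErasures C i : ℝ) / (J.period i : ℝ)) * ‖J.firstEig i‖ ^ 2 < 1) := by
  -- With natural exponents the criterion needs no convention for division by `l = 0`; both stated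
  -- forms are equivalent to it.
  have hobs : IntermittentKalman.IsIntermittentObservable P A B C x₀ w v β ↔
      ∀ i, pe ^ J.minErasures C i * ‖J.firstEig i‖ ^ (2 * J.period i) < 1 :=
    ⟨fun h => hsys.pow_mul_pow_lt_one hσ' hctrl J h,
      fun h => hsys.isIntermittentObservable hσ hσ' J fun i _ => h i⟩
  refine ⟨hobs.trans (J.ofReal_lt_one_div_iSup_growth_iff C hsys.pe_nonneg).symm,
    hobs.trans (forall_congr' fun i => ?_)⟩
  exact (IntermittentKalman.rpow_div_mul_lt_one_iff hsys.pe_nonneg _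
    (J.period_pos i)).symm
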